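/- Let $\mathbb{F}_q$ be the field with $q$ elements, of characteristic $p$, and let $n\ge 1$. Put $d=\lceil 2\log_q n\rceil$ and $\bar n=q^{\lceil \log_q n\rceil}$. Let $g,h\in\mathbb{F}_q[X]$ be coprime with $\deg g,\deg h\le d$, and suppose that the rational function $f=g/h$, of degree $\deg f=\max\{\deg g,\deg h\}$, satisfies the following conditions: - $\deg f\ge 2$; - $f$ is not a monomial $aX^k$ ($a\in\mathbb{F}_q$, $k\in\mathbb{Z}$); - $f$ is not of the form $aX^{p^\ell}+b$ ($a,b\in\mathbb{F}_q$, $a\neq 0$, $\ell\ge 0$); - $f$ is not linearly conjugate to $1/X^{\deg f}$, i.e. there is no $\psi\in\mathbb{F}_q(X)$ of degree $1$ with $\psi^{-1}\circ f\circ\psi=1/X^{\deg f}$; - $\deg g\ne\deg h$, or $f$ is separable (i.e. $\mathbb{F}_q(X)$ is a separable extension of $\mathbb{F}_q(f)$), or $f$ is not of the form $L(X^{p^\ell})$ with $\ell\ge 0$ and $L\in\mathbb{F}_q(X)$ of degree $1$. Suppose that $\alpha$, in an extension field of $\mathbb{F}_q$, has degree $n$ over $\mathbb{F}_q$ and is a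 root of $X^{\bar n}h(X)-g(X)$. Then, with $t=\lfloor\log_d n\rfloor$ (note that $d\ge\deg f\ge 2$), the multiplicative order of $\alpha$ is at least \[ \binom{n+t-1}{t}\prod_{i=0}^{t-1}\frac{1}{d^i}. \] -/

import Mathlib

namespace RatIter

noncomputable section

/-- The degree of a rational function: the maximum of the degrees of its numerator and
denominator in lowest terms. -/
def deg {K : Type*} [Field K] (f : RatFunc K) : ℕ :=
  max f.num.natDegree f.denom.natDegree

/-- The composition `f ∘ u` of rational functions (for non-constant `u`). -/
def comp {K : Type*} [Field K] (f u : RatFunc K) : RatFunc K :=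
  RatFunc.eval (algebraMap K (RatFunc K)) u f

/-- `f` is a monomial `a X ^ k`; as `f` is a rational function, `k` is any integer. -/
def IsMonomial {K : Type*} [Field K] (f : RatFunc K) : Prop :=
  ∃ (a : K) (k : ℤ), f = RatFunc.C a * RatFunc.X ^ k

/-- `f` is of the form `a X ^ (p ^ l) + b` with `a ≠ 0`, where `p` is the characteristic. -/
def IsFrobBinomial {K : Type*} [Field K] (f : RatFunc K) : Prop :=
  ∃ (a b : K) (l : ℕ), a ≠ 0 ∧
    f = RatFunc.C a * RatFunc.X ^ (ringChar K ^ l) + RatFunc.C b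

/-- `φ` and `φ'` are linearly conjugate over `K`: `φ' = ψ⁻¹ ∘ φ ∘ ψ` for some `ψ` of degree one
with coefficients in `K`. Here `χ` is the compositional inverse of `ψ`. -/
def LinConj {K : Type*} [Field K] (φ φ' : RatFunc K) : Prop :=
  ∃ ψ χ : RatFunc K, deg ψ = 1 ∧ comp ψ χ = RatFunc.X ∧ comp χ ψ = RatFunc.X ∧
    φ' = comp χ (comp φ ψ)

/-- `f` is separable: the extension `K(X) / K(f)` is separable. -/
def IsSep {K : Type*} [Field K] (f : RatFunc K) : Prop :=
  Algebra.IsSeparable (IntermediateField.adjoin K {f}) (RatFunc K)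

/-- `f` is of the form `L (X ^ (p ^ l))`, with `L` of degree one. -/
def IsLinearFrob {K : Type*} [Field K] (f : RatFunc K) : Prop :=
  ∃ (L : RatFunc K) (l : ℕ), deg L = 1 ∧ f = comp L (RatFunc.X ^ (ringChar K ^ l))

/-- The conditions on `f` under which its iterates are considered. -/
structure Admissible {K : Type*} [Field K] (f : RatFunc K) : Prop where
  two_le_deg : 2 ≤ deg f
  not_monomial : ¬ IsMonomial f
  not_binomial : ¬ IsFrobBinomial f
  not_conj : ¬ LinConj f (1 / RatFunc.X ^ deg f)
  shape : f.num.natDegree ≠ f.denom.natDegree ∨ IsSep f ∨ ¬ IsLinearFrob f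

end

end RatIter

/-! Put Q = q^k = n̄, so that α^Q = f(α). Since f has coefficients in 𝔽_q, iterating gives α^(Q^i) =
f_i(α), where f_i is the i-th iterate of f, a quotient of polynomials of degree at most d^i
(`exists_iter_eq`). A product of powers of these conjugates with exponents c_i is thus the value at
α of ∏ f_i^(c_i). If ∑ |c_i| d^i < n and the value is 1, comparing degrees with the minimal
polynomial shows that the product is 1 as a rational function (`relation_of_aeval`).

Suppose first that the iterates are multiplicatively independent. Then exponent vectors whose
differences all have weight below n give distinct powers of α. The vectors with s ≤ a_0 < n - s,
where s = ∑_{l ≥ 1} |a_l| d^l, form such a family (`packCount_le_card`). Slicing by the last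
coordinate and comparing with the integral of x^k shows that there are at least n^(i+1) / ((i+1)!
∏_{l ≤ i} d^l) of them. For i = t - 1 this is the desired bound, except that n^t stands in place of
n(n+1)⋯(n+t-1). The difference is recovered from the excess of the trapezoidal rule over the
integral, or from one more coordinate of weight d^t ≤ n. Small parameters are evaluated, and where
counting alone falls short the order N is excluded arithmetically: q must have order exactly n
modulo N, and N must divide no short combination c_0 + c_1 Q + c_2 Q² (`LongRelations`).

Suppose now that the iterates are dependent. Comparing orders of vanishing on the projective line
shows that 0 and ∞ are the only preimages of their images, so f is a Möbius transformation of X^D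
(`of_relation`). The conditions on f leave only f = β / (1 + γ X^(p^l)) (`Admissible.eq_of_isSpan`).
Extracting a p^l-th root turns the equation of α into α^(p^S) = b / (1 + aα), with p^S p^l = Q. The
dependence makes some iterate vanish or have a pole at 0, and then an iterate of the twisted Möbius
map is a scaling, which forces n ≤ S(t+1). As 2^(S+1) < n², n is bounded. Since the conjugates are
now Möbius transforms of α, of degree one, all weights may be taken to be 1. This gives orders of at
least n²/2 or n³/6, which are enough. -/

namespace RatIter

/-! ### Packing exponent vectors with short differences -/

/-- The number of integer vectors `(a₀, …, aᵢ)` with `s ≤ a₀ < m - s`, where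
`s = ∑_{l ≥ 1} |a_l| w_l`. -/
noncomputable def packCount (w : ℕ → ℕ) : ℕ → ℕ → ℕ
  | 0, m => m
  | i + 1, m => ∑ j ∈ Finset.Icc (-(m : ℤ)) m, packCount w i (m - 2 * w (i + 1) * j.natAbs)

/-- The weight of the coordinates of positive index. -/
noncomputable def tailWeight (w : ℕ → ℕ) (i : ℕ) (a : ℕ → ℤ) : ℤ :=
  ∑ l ∈ Finset.range i, |a (l + 1)| * w (l + 1)

/-- The weight of all coordinates up to `i`. -/
noncomputable def weight (w : ℕ → ℕ) (i : ℕ) (a : ℕ → ℤ) : ℤ :=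
  ∑ l ∈ Finset.range (i + 1), |a l| * w l

/-- Fixing the last coordinate j raises s by w |j|, so the interval allowed for a_0 loses w |j| at
each end. Moving a_0 by w |j| therefore identifies the slice with the lower-dimensional packing for
m - 2 w |j|. -/
theorem exists_packSet (w : ℕ → ℕ) (i m : ℕ) :
    ∃ A : Finset (ℕ → ℤ), A.card = packCount w i m ∧
      ∀ a ∈ A, (∀ l, i < l → a l = 0) ∧ tailWeight w i a ≤ a 0 ∧ a 0 + tailWeight w i a < m := by
  classical
  induction i generalizing m with
  | zero =>
    refine ⟨(Finset.range m).image (fun a : ℕ => Pi.single 0 (a : ℤ)), ?_, ?_⟩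
    · rw [Finset.card_image_of_injective, Finset.card_range, packCount]
      intro a b hab
      have := congrFun hab 0
      simpa using this
    · intro a ha
      simp only [Finset.mem_image, Finset.mem_range] at ha
      obtain ⟨b, hb, rfl⟩ := ha
      refine ⟨fun l hl => by simp [Pi.single_apply]; omega, by simp [tailWeight], by simp [tailWeight, hb]⟩
  | succ i ih =>
    choose A hA1 hA2 using ih
    let W := w (i + 1)
    let sh : ℤ → (ℕ → ℤ) → (ℕ → ℤ) := fun j v => v + (Pi.single 0 (W * |j|) + Pi.single (i + 1) j)
    have hsh_inj : ∀ j, Function.Injective (sh j) := fun j => add_left_injective _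
    have hsh_top : ∀ j k, ∀ v ∈ A k, sh j v (i + 1) = j := by
      intro j k v hv
      simp [sh, (hA2 k v hv).1 (i + 1) (by omega)]
    refine ⟨(Finset.Icc (-(m : ℤ)) m).biUnion
      (fun j => (A (m - 2 * w (i + 1) * j.natAbs)).image (sh j)), ?_, ?_⟩
    · rw [Finset.card_biUnion, packCount]
      · refine Finset.sum_congr rfl fun j _ => ?_
        rw [Finset.card_image_of_injective _ (hsh_inj j), hA1]
      · intro j _ k _ hjk
        rw [Function.onFun, Finset.disjoint_left]
        intro a ha hb
        simp only [Finset.mem_image] at ha hb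
        obtain ⟨u, hu, rfl⟩ := ha
        obtain ⟨v, hv, hvu⟩ := hb
        apply hjk
        rw [← hsh_top j _ u hu, ← hsh_top k _ v hv, hvu]
    · intro a ha
      simp only [Finset.mem_biUnion, Finset.mem_image] at ha
      obtain ⟨j, _, v, hv, rfl⟩ := ha
      obtain ⟨h1, h2, h3⟩ := hA2 _ v hv
      have h0 : sh j v 0 = v 0 + W * |j| := by simp [sh]
      have ht : tailWeight w (i + 1) (sh j v) = tailWeight w i v + |j| * W := by
        unfold tailWeight
        rw [Finset.sum_range_succ, hsh_top j _ v hv]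
        congr 1
        refine Finset.sum_congr rfl fun l hl => ?_
        have : l ≠ i := by have := Finset.mem_range.1 hl; omega
        simp [sh, this]
      have hnn : 0 ≤ tailWeight w i v :=
        Finset.sum_nonneg fun l _ => by positivity
      -- The truncated subtraction is genuine: if it were cut off at 0, the slice would require 0 ≤
      -- v 0 < 0.
      have hsub : ((m - 2 * w (i + 1) * j.natAbs : ℕ) : ℤ) = m - 2 * W * |j| := by
        have : 2 * w (i + 1) * j.natAbs ≤ m := by
          by_contra hcon
          rw [Nat.sub_eq_zero_of_le (by omega)] at h3
          simp only [Nat.cast_zero] at h3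
          omega
        rw [Nat.cast_sub this]
        push_cast
        rfl
      rw [hsub] at h3
      refine ⟨fun l hl => ?_, ?_, ?_⟩
      · have e1 : l ≠ i + 1 := by omega
        have e2 : l ≠ 0 := by omega
        simp [sh, e1, e2, h1 l (by omega)]
      · rw [h0, ht]; linarith
      · rw [h0, ht]; linarith

/-- If no short nontrivial exponent vector gives a trivial product, the group is large. -/
theorem packCount_le_card {G : Type*} [CommGroup G] [Finite G] (x : ℕ → G) (w : ℕ → ℕ)
    (hw : w 0 = 1) (i n : ℕ)
    (hx : ∀ c : ℕ → ℤ, (∃ l ≤ i, c l ≠ 0) → weight w i c < n →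
      ∏ l ∈ Finset.range (i + 1), x l ^ c l ≠ 1) :
    packCount w i n ≤ Nat.card G := by
  obtain ⟨A, hA1, hA2⟩ := exists_packSet w i n
  have := Fintype.ofFinite G
  rw [← hA1, Nat.card_eq_fintype_card, ← Finset.card_univ]
  refine Finset.card_le_card_of_injOn (fun a => ∏ l ∈ Finset.range (i + 1), x l ^ a l)
    (fun _ _ => by simp) ?_
  intro a ha b hb hab
  by_contra hne
  obtain ⟨a1, a2, a3⟩ := hA2 a ha
  obtain ⟨b1, b2, b3⟩ := hA2 b hb
  refine hx (a - b) ?_ ?_ ?_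
  · by_contra hcon
    push Not at hcon
    apply hne
    funext l
    by_cases hl : l ≤ i
    · have := hcon l hl
      simp only [Pi.sub_apply] at this
      omega
    · rw [a1 l (by omega), b1 l (by omega)]
  -- With s_a, s_b the tail weights, a_0 and b_0 lie in [s_a, n - s_a) and [s_b, n - s_b). So |a_0 -
  -- b_0| < n - s_a - s_b, which leaves exactly enough room for the tail of a - b.
  · have htail : ∑ l ∈ Finset.range i, |(a - b) (l + 1)| * (w (l + 1) : ℤ) ≤
        tailWeight w i a + tailWeight w i b := by
      unfold tailWeight
      rw [← Finset.sum_add_distrib]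
      refine Finset.sum_le_sum fun l _ => ?_
      rw [← add_mul]
      exact mul_le_mul_of_nonneg_right (abs_sub _ _) (by positivity)
    have h0 : |(a - b) 0| + (tailWeight w i a + tailWeight w i b) < n := by
      have : |(a - b) 0| < n - (tailWeight w i a + tailWeight w i b) := by
        rw [Pi.sub_apply, abs_lt]
        constructor <;> linarith
      linarith
    unfold weight
    rw [Finset.sum_range_succ', hw]
    simp only [Nat.cast_one, mul_one]
    linarith
  · simp only [Pi.sub_apply, zpow_sub, Finset.prod_mul_distrib, Finset.prod_inv_distrib]
    simp only at hab
    rw [hab, mul_inv_cancel]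

theorem packCount_zero_right (w : ℕ → ℕ) (i : ℕ) : packCount w i 0 = 0 := by
  induction i with
  | zero => rfl
  | succ i ih => simp [packCount, ih]

theorem packCount_succ (w : ℕ → ℕ) (i m : ℕ) :
    packCount w (i + 1) m = packCount w i m +
      2 * ∑ j ∈ Finset.range m, packCount w i (m - 2 * w (i + 1) * (j + 1)) := by
  have key : ∀ (f : ℕ → ℕ) (m : ℕ), ∑ j ∈ Finset.Icc (-(m : ℤ)) m, f j.natAbs =
      f 0 + 2 * ∑ j ∈ Finset.range m, f (j + 1) := by
    intro f m
    induction m with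
    | zero => simp
    | succ m ih =>
      have : Finset.Icc (-((m + 1 : ℕ) : ℤ)) ((m + 1 : ℕ) : ℤ) =
          insert (-((m + 1 : ℕ) : ℤ)) (insert ((m + 1 : ℕ) : ℤ) (Finset.Icc (-(m : ℤ)) m)) := by
        ext x
        simp only [Finset.mem_Icc, Finset.mem_insert]
        push_cast
        omega
      rw [this, Finset.sum_insert, Finset.sum_insert, ih, Finset.sum_range_succ]
      · have e1 : (-((m + 1 : ℕ) : ℤ)).natAbs = m + 1 := by omega
        have e2 : ((m + 1 : ℕ) : ℤ).natAbs = m + 1 := by omega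
        rw [e1, e2]
        ring
      · simp
      · simp only [Finset.mem_Icc, Finset.mem_insert]
        push_cast
        omega
  rw [packCount, key (fun j => packCount w i (m - 2 * w (i + 1) * j)) m]
  simp

/-- Only the slices j = 0 and j = ±1 are kept. -/
theorem packCount_succ_ge_two (w : ℕ → ℕ) (i m : ℕ) :
    packCount w i m + 2 * packCount w i (m - 2 * w (i + 1)) ≤ packCount w (i + 1) m := by
  rw [packCount_succ]
  rcases Nat.eq_zero_or_pos m with rfl | hm
  · simp [packCount_zero_right]
  · have := Finset.single_le_sum (f := fun j => packCount w i (m - 2 * w (i + 1) * (j + 1)))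
      (fun _ _ => Nat.zero_le _) (Finset.mem_range.2 hm)
    simp only [zero_add, mul_one] at this
    omega

/-! ### Trapezoidal rule and the volume of the packing -/

/-- The sum of the `k`-th powers of `m - 2w, m - 4w, …`, as long as these are positive. -/
noncomputable def stepPowSum (k w m : ℕ) : ℝ :=
  ∑ j ∈ Finset.range m, ((m - 2 * w * (j + 1) : ℕ) : ℝ) ^ k

theorem stepPowSum_of_lt {k w m : ℕ} (hk : k ≠ 0) (hm : m < 2 * w) : stepPowSum k w m = 0 := by
  refine Finset.sum_eq_zero fun j _ => ?_
  rw [Nat.sub_eq_zero_of_le (by nlinarith), Nat.cast_zero, zero_pow hk]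

theorem stepPowSum_of_le {k w m : ℕ} (hk : k ≠ 0) (hw : 0 < w) (hm : 2 * w ≤ m) :
    stepPowSum k w m = ((m - 2 * w : ℕ) : ℝ) ^ k + stepPowSum k w (m - 2 * w) := by
  obtain ⟨p, rfl⟩ : ∃ p, m = p + 1 := ⟨m - 1, by omega⟩
  unfold stepPowSum
  rw [Finset.sum_range_succ', add_comm]
  simp only [zero_add, mul_one]
  congr 1
  have hsub : Finset.range (p + 1 - 2 * w) ⊆ Finset.range p := by
    intro x; simp only [Finset.mem_range]; omega
  rw [← Finset.sum_subset hsub]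
  · refine Finset.sum_congr rfl fun j _ => ?_
    congr 2
    rw [Nat.sub_sub]
    congr 1
    ring
  · intro j _ hj
    have hj' : p + 1 - 2 * w ≤ j := by simpa using hj
    have h1 : j ≤ w * j := Nat.le_mul_of_pos_left _ hw
    have h2 : p + 1 ≤ j + 2 * w := by omega
    rw [Nat.sub_eq_zero_of_le (by nlinarith), Nat.cast_zero, zero_pow hk]

/-- The excess of the trapezoidal rule for `x ^ k`. -/
noncomputable def trapExcess (k : ℕ) (a b : ℝ) : ℝ :=
  ∑ i ∈ Finset.range (k + 1), (b ^ i - a ^ i) * (b ^ (k - i) - a ^ (k - i))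

/-- Both power differences come from the geometric sum of b^i a^(k-i). The excess collects a^k + b^k
- b^i a^(k-i) - a^i b^(k-i), which factors as (b^i - a^i)(b^(k-i) - a^(k-i)). -/
theorem trap_identity (k : ℕ) (a b : ℝ) :
    2 * (b ^ (k + 1) - a ^ (k + 1)) + (b - a) * trapExcess k a b =
      (k + 1) * (b - a) * (a ^ k + b ^ k) := by
  have hgeom : b ^ (k + 1) - a ^ (k + 1) =
      (b - a) * ∑ i ∈ Finset.range (k + 1), b ^ i * a ^ (k - i) := by
    have := (Commute.all b a).geom_sum₂_mul (k + 1)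
    rw [← this, mul_comm]
    simp
  have hrefl : ∑ i ∈ Finset.range (k + 1), b ^ i * a ^ (k - i) =
      ∑ i ∈ Finset.range (k + 1), a ^ i * b ^ (k - i) := by
    rw [← Finset.sum_range_reflect]
    refine Finset.sum_congr rfl fun i hi => ?_
    have : i ≤ k := by have := Finset.mem_range.1 hi; omega
    rw [show k + 1 - 1 - i = k - i by omega, show k - (k - i) = i by omega, mul_comm]
  have hE : trapExcess k a b = (k + 1) * (a ^ k + b ^ k) -
      2 * ∑ i ∈ Finset.range (k + 1), b ^ i * a ^ (k - i) := by
    have : trapExcess k a b = ∑ i ∈ Finset.range (k + 1), ((a ^ k + b ^ k) -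
        (b ^ i * a ^ (k - i) + a ^ i * b ^ (k - i))) := by
      refine Finset.sum_congr rfl fun i hi => ?_
      have hi' : i ≤ k := by have := Finset.mem_range.1 hi; omega
      have h1 : a ^ k = a ^ i * a ^ (k - i) := by rw [← pow_add]; congr 1; omega
      have h2 : b ^ k = b ^ i * b ^ (k - i) := by rw [← pow_add]; congr 1; omega
      rw [h1, h2]; ring
    rw [this]
    simp only [Finset.sum_sub_distrib, Finset.sum_add_distrib, Finset.sum_const, Finset.card_range,
      nsmul_eq_mul]
    rw [← hrefl]
    push_cast
    ring
  rw [hE, hgeom]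
  ring

theorem trapExcess_term_nonneg {a b : ℝ} (ha : 0 ≤ a) (hab : a ≤ b) (k i : ℕ) :
    0 ≤ (b ^ i - a ^ i) * (b ^ (k - i) - a ^ (k - i)) :=
  mul_nonneg (sub_nonneg.2 (pow_le_pow_left₀ ha hab _)) (sub_nonneg.2 (pow_le_pow_left₀ ha hab _))

theorem trapExcess_nonneg {a b : ℝ} (ha : 0 ≤ a) (hab : a ≤ b) (k : ℕ) : 0 ≤ trapExcess k a b :=
  Finset.sum_nonneg fun i _ => trapExcess_term_nonneg ha hab k i

/-- The right side is (k+1) times the trapezoidal sum for the convex function x^k with nodes m, m -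
2w, m - 4w, …, so it dominates (k+1) times the integral over [0, m]. On the last incomplete interval
[0, r] with r < 2w one has r^(k+1) ≤ (k+1) w r^k, because k ≥ 1. -/
theorem pow_succ_le_stepPowSum {k w : ℕ} (hk : k ≠ 0) (hw : 0 < w) (m : ℕ) :
    (m : ℝ) ^ (k + 1) ≤ (k + 1) * w * ((m : ℝ) ^ k + 2 * stepPowSum k w m) := by
  induction m using Nat.strong_induction_on with
  | _ m ih =>
    rcases lt_or_ge m (2 * w) with h | h
    · rw [stepPowSum_of_lt hk h, pow_succ]
      have h1 : (m : ℝ) ≤ 2 * w := by exact_mod_cast h.le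
      have h2 : (1 : ℝ) ≤ k := by exact_mod_cast Nat.one_le_iff_ne_zero.2 hk
      have h3 : (0 : ℝ) ≤ (m : ℝ) ^ k := by positivity
      have h4 : (m : ℝ) ≤ (k + 1) * w := by
        have : (0 : ℝ) < w := by exact_mod_cast hw
        nlinarith
      nlinarith
    · have := ih (m - 2 * w) (by omega)
      rw [stepPowSum_of_le hk hw h]
      have hc : ((m - 2 * w : ℕ) : ℝ) = m - 2 * w := by push_cast [Nat.cast_sub h]; ring
      rw [hc] at this ⊢
      have h0 : (0 : ℝ) ≤ (m : ℝ) - 2 * w := by rw [← hc]; positivity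
      have ht := trap_identity k ((m : ℝ) - 2 * w) m
      have hw' : (0 : ℝ) ≤ w := Nat.cast_nonneg w
      have hE := trapExcess_nonneg (b := (m : ℝ)) h0 (by linarith) k
      have := mul_nonneg hw' hE
      nlinarith

/-- The excess of the topmost trapezoid, on [m - 2w, m], is retained; the others are discarded. -/
theorem pow_succ_add_excess_le {k w m : ℕ} (hk : k ≠ 0) (hw : 0 < w) (hm : 2 * w ≤ m) :
    (m : ℝ) ^ (k + 1) + w * trapExcess k ((m : ℝ) - 2 * w) m ≤
      (k + 1) * w * ((m : ℝ) ^ k + 2 * stepPowSum k w m) := by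
  have := pow_succ_le_stepPowSum hk hw (m - 2 * w)
  rw [stepPowSum_of_le hk hw hm]
  have hc : ((m - 2 * w : ℕ) : ℝ) = m - 2 * w := by push_cast [Nat.cast_sub hm]; ring
  rw [hc] at this ⊢
  have ht := trap_identity k ((m : ℝ) - 2 * w) m
  linarith

/-- For x² every full trapezoid of width 2w has the same excess, contributing 4w³, and there are ⌊m
/ 2w⌋ of them. -/
theorem cube_add_le_stepPowSum {w : ℕ} (hw : 0 < w) (m : ℕ) :
    (m : ℝ) ^ 3 + 4 * w ^ 3 * (m / (2 * w) : ℕ) ≤ 3 * w * ((m : ℝ) ^ 2 + 2 * stepPowSum 2 w m) := by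
  induction m using Nat.strong_induction_on with
  | _ m ih =>
    rcases lt_or_ge m (2 * w) with h | h
    · have := pow_succ_le_stepPowSum two_ne_zero hw m
      rw [Nat.div_eq_of_lt h]
      norm_num at this ⊢
      linarith
    · have := ih (m - 2 * w) (by omega)
      have hd : m / (2 * w) = (m - 2 * w) / (2 * w) + 1 := by
        conv_lhs => rw [← Nat.sub_add_cancel h]
        rw [Nat.add_div_right _ (by omega)]
      rw [stepPowSum_of_le two_ne_zero hw h, hd]
      have hc : ((m - 2 * w : ℕ) : ℝ) = m - 2 * w := by push_cast [Nat.cast_sub h]; ring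
      rw [hc] at this ⊢
      push_cast
      nlinarith

theorem trapExcess_three (a b : ℝ) : trapExcess 3 a b = 2 * (b - a) * (b ^ 2 - a ^ 2) := by
  simp [trapExcess, Finset.sum_range_succ]
  ring

/-- Since b^(i+2) - a^(i+2) ≥ b^i (b² - a²), each of the j + 1 inner terms is at least b^j (b² -
a²)². The two terms next to the ends, which contain the factor b - a, give the remaining summand. -/
theorem le_trapExcess {a b : ℝ} (ha : 0 ≤ a) (hab : a ≤ b) (j : ℕ) :
    b ^ j * (b ^ 2 - a ^ 2) * (2 * (b - a) * b + (j + 1) * (b ^ 2 - a ^ 2)) ≤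
      trapExcess (j + 4) a b := by
  have hb : 0 ≤ b := ha.trans hab
  have hsq : ∀ i, b ^ i * (b ^ 2 - a ^ 2) ≤ b ^ (i + 2) - a ^ (i + 2) := by
    intro i
    have := mul_le_mul_of_nonneg_right (pow_le_pow_left₀ ha hab i) (sq_nonneg a)
    rw [pow_add, pow_add]
    linarith
  have h2 : 0 ≤ b ^ 2 - a ^ 2 := sub_nonneg.2 (pow_le_pow_left₀ ha hab _)
  unfold trapExcess
  rw [Finset.sum_range_succ, Finset.sum_range_succ, Finset.sum_range_succ', Finset.sum_range_succ']
  have hmid : ((j : ℝ) + 1) * (b ^ j * (b ^ 2 - a ^ 2) ^ 2) ≤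
      ∑ i ∈ Finset.range (j + 1),
        (b ^ (i + 1 + 1) - a ^ (i + 1 + 1)) *
          (b ^ (j + 4 - (i + 1 + 1)) - a ^ (j + 4 - (i + 1 + 1))) := by
    calc ((j : ℝ) + 1) * (b ^ j * (b ^ 2 - a ^ 2) ^ 2)
        = ∑ i ∈ Finset.range (j + 1), b ^ j * (b ^ 2 - a ^ 2) ^ 2 := by simp
      _ ≤ _ := by
        refine Finset.sum_le_sum fun i hi => ?_
        have hi' : i ≤ j := by have := Finset.mem_range.1 hi; omega
        have e : j + 4 - (i + 1 + 1) = (j - i) + 2 := by omega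
        rw [e]
        calc b ^ j * (b ^ 2 - a ^ 2) ^ 2
            = (b ^ i * (b ^ 2 - a ^ 2)) * (b ^ (j - i) * (b ^ 2 - a ^ 2)) := by
              have : b ^ j = b ^ i * b ^ (j - i) := by rw [← pow_add]; congr 1; omega
              rw [this]; ring
          _ ≤ _ := mul_le_mul (hsq i) (hsq (j - i)) (by positivity)
              ((mul_nonneg (by positivity) h2).trans (hsq i))
  have hend : b ^ (j + 1) * (b ^ 2 - a ^ 2) * (b - a) ≤
      (b ^ (j + 3) - a ^ (j + 3)) * (b - a) :=
    mul_le_mul_of_nonneg_right (hsq (j + 1)) (by linarith)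
  have e1 : j + 4 - (0 + 1) = j + 3 := by omega
  have e2 : j + 4 - (j + 1 + 1 + 1) = 1 := by omega
  have e3 : j + 4 - (j + 4) = 0 := by omega
  rw [e1, e2, e3]
  simp only [pow_zero, sub_self, mul_zero, zero_mul, add_zero, zero_add, pow_one]
  have e4 : b ^ (j + 1) = b ^ j * b := pow_succ b j
  rw [e4] at hend
  have e5 : j + 1 + 1 + 1 = j + 3 := rfl
  rw [e5]
  nlinarith

/-- The normalising factor in the volume estimate for `packCount`. -/
noncomputable def packVol (w : ℕ → ℕ) (i : ℕ) : ℝ :=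
  (i + 1).factorial * ∏ l ∈ Finset.range i, (w (l + 1) : ℝ)

theorem packVol_succ (w : ℕ → ℕ) (i : ℕ) :
    packVol w (i + 1) = packVol w i * ((i + 1 : ℕ) + 1) * w (i + 1) := by
  unfold packVol
  rw [Finset.prod_range_succ, Nat.factorial_succ (i + 1)]
  push_cast
  ring

theorem packVol_nonneg (w : ℕ → ℕ) (i : ℕ) : 0 ≤ packVol w i := by
  unfold packVol; positivity

/-- Induction on the dimension: bounding each slice by the inductive estimate makes the slice sum a
trapezoidal sum, which is at least the integral. -/
theorem pow_succ_le_packVol_mul_packCount (w : ℕ → ℕ) (hw : ∀ l, 0 < w l) (i : ℕ) :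
    ∀ m : ℕ, (m : ℝ) ^ (i + 1) ≤ packVol w i * packCount w i m := by
  induction i with
  | zero => intro m; simp [packVol, packCount]
  | succ i ih =>
    intro m
    have h1 := pow_succ_le_stepPowSum (k := i + 1) (by omega) (hw (i + 1)) m
    have h2 : (m : ℝ) ^ (i + 1) + 2 * stepPowSum (i + 1) (w (i + 1)) m ≤
        packVol w i * packCount w (i + 1) m := by
      rw [packCount_succ]
      push_cast
      rw [mul_add, mul_left_comm, Finset.mul_sum]
      refine add_le_add (ih m) (mul_le_mul_of_nonneg_left ?_ zero_le_two)
      exact Finset.sum_le_sum fun j _ => ih _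
    refine h1.trans ?_
    rw [packVol_succ]
    have h3 : (0 : ℝ) ≤ ((i + 1 : ℕ) + 1) * w (i + 1) := by positivity
    have := mul_le_mul_of_nonneg_left h2 h3
    linarith

/-- The trapezoidal sum of the last slicing is left unevaluated, so that its excess over the
integral can still be used. -/
theorem stepPowSum_le_packCount (w : ℕ → ℕ) (hw : ∀ l, 0 < w l) (i m : ℕ) :
    ((i + 1 : ℕ) + 1) * w (i + 1) * ((m : ℝ) ^ (i + 1) + 2 * stepPowSum (i + 1) (w (i + 1)) m) ≤
      packVol w (i + 1) * packCount w (i + 1) m := by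
  have h2 : (m : ℝ) ^ (i + 1) + 2 * stepPowSum (i + 1) (w (i + 1)) m ≤
      packVol w i * packCount w (i + 1) m := by
    rw [packCount_succ]
    push_cast
    rw [mul_add, mul_left_comm, Finset.mul_sum]
    refine add_le_add (pow_succ_le_packVol_mul_packCount w hw i m) (mul_le_mul_of_nonneg_left ?_ zero_le_two)
    exact Finset.sum_le_sum fun j _ => pow_succ_le_packVol_mul_packCount w hw i _
  rw [packVol_succ]
  have h3 : (0 : ℝ) ≤ ((i + 1 : ℕ) + 1) * w (i + 1) := by positivity
  have := mul_le_mul_of_nonneg_left h2 h3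
  linarith

/-! ### From powers to ascending factorials -/

/-- This is ∏ (1 + i/n) ≤ 1 / (1 - ∑ i/n) over i < t, with denominators cleared. -/
theorem ascFactorial_mul_le (n t : ℕ) :
    (n.ascFactorial t : ℝ) * (2 * n - t * (t - 1)) ≤ 2 * n * n ^ t := by
  induction t with
  | zero => simp
  | succ t ih =>
    rw [Nat.ascFactorial_succ]
    push_cast
    have hA : (0 : ℝ) ≤ n.ascFactorial t := Nat.cast_nonneg _
    have hn : (0 : ℝ) ≤ n := Nat.cast_nonneg _
    have ht : (0 : ℝ) ≤ t := Nat.cast_nonneg _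
    have key : ((n : ℝ) + t) * (2 * n - (t + 1) * (t + 1 - 1)) ≤ n * (2 * n - t * (t - 1)) := by
      have : (0 : ℝ) ≤ t ^ 2 * (t + 1) := by positivity
      nlinarith
    calc ((n : ℝ) + t) * n.ascFactorial t * (2 * n - (t + 1) * (t + 1 - 1))
        = n.ascFactorial t * (((n : ℝ) + t) * (2 * n - (t + 1) * (t + 1 - 1))) := by ring
      _ ≤ n.ascFactorial t * (n * (2 * n - t * (t - 1))) := mul_le_mul_of_nonneg_left key hA
      _ = n * (n.ascFactorial t * (2 * n - t * (t - 1))) := by ring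
      _ ≤ n * (2 * n * n ^ t) := mul_le_mul_of_nonneg_left ih hn
      _ = 2 * n * n ^ (t + 1) := by ring

/-- `G` is the gain over n^t; the last hypothesis is the size it must have to cover the passage to
the ascending factorial. -/
theorem ascFactorial_le_of_gain {n t : ℕ} {V G : ℝ} (hV : (n : ℝ) ^ t + G ≤ V)
    (hpos : (0 : ℝ) < 2 * n - t * (t - 1))
    (hG : (n : ℝ) ^ t * (t * (t - 1)) ≤ G * (2 * n - t * (t - 1))) :
    (n.ascFactorial t : ℝ) ≤ V := by
  have h := ascFactorial_mul_le n t
  refine le_trans ?_ hV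
  refine le_of_mul_le_mul_right ?_ hpos
  linarith

/-- A further coordinate of weight d^(i+1), restricted to 0 and ±1, while the normalising factor
remains that of dimension i. -/
theorem packVol_mul_ge_two (d i n : ℕ) (hd : 0 < d) :
    (n : ℝ) ^ (i + 1) + 2 * ((n - 2 * d ^ (i + 1) : ℕ) : ℝ) ^ (i + 1) ≤
      packVol (d ^ ·) i * packCount (d ^ ·) (i + 1) n := by
  have hw : ∀ l, 0 < (d ^ · : ℕ → ℕ) l := fun l => by positivity
  have h1 := pow_succ_le_packVol_mul_packCount (d ^ · : ℕ → ℕ) hw i n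
  have h2 := pow_succ_le_packVol_mul_packCount (d ^ · : ℕ → ℕ) hw i (n - 2 * d ^ (i + 1))
  have h3 : (packCount (d ^ ·) i n : ℝ) + 2 * packCount (d ^ ·) i (n - 2 * d ^ (i + 1)) ≤
      packCount (d ^ ·) (i + 1) n := by exact_mod_cast packCount_succ_ge_two (d ^ ·) i n
  have := mul_le_mul_of_nonneg_left h3 (packVol_nonneg (d ^ ·) i)
  linarith

theorem mul_three_pow_le (t : ℕ) : (t : ℝ) * (t - 1) * 3 ^ t ≤ 6 * 4 ^ t := by
  rcases Nat.lt_or_ge t 7 with h | h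
  · interval_cases t <;> norm_num
  · induction t, h using Nat.le_induction with
    | base => norm_num
    | succ t ht ih =>
      have ht' : (7 : ℝ) ≤ t := by exact_mod_cast ht
      push_cast
      have h3 : (0 : ℝ) < 3 ^ t := by positivity
      have : ((t : ℝ) + 1) * (t + 1 - 1) * 3 ≤ 4 * (t * (t - 1)) := by nlinarith
      calc ((t : ℝ) + 1) * (t + 1 - 1) * 3 ^ (t + 1) = ((t : ℝ) + 1) * (t + 1 - 1) * 3 * 3 ^ t := by ring
        _ ≤ 4 * (t * (t - 1)) * 3 ^ t := mul_le_mul_of_nonneg_right this h3.le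
        _ ≤ 6 * 4 ^ (t + 1) := by rw [pow_succ (4 : ℝ)]; linarith

/-- Here n - 2d^t ≥ n/3, so the slices ±1 of the extra coordinate gain 2(n/3)^t. This suffices
because t(t-1) 3^t ≤ 6 · 4^t ≤ 6 d^t ≤ 2n. -/
theorem ascFactorial_le_of_three_mul_le {d n i : ℕ} (hd : 4 ≤ d) (hn : 3 * d ^ (i + 1) ≤ n) :
    (n.ascFactorial (i + 1) : ℝ) ≤ packVol (d ^ ·) i * packCount (d ^ ·) (i + 1) n := by
  set t := i + 1 with ht
  have hn' : (3 : ℝ) * d ^ t ≤ n := by exact_mod_cast hn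
  have hd4 : (4 : ℝ) ^ t ≤ d ^ t := pow_le_pow_left₀ (by norm_num) (by exact_mod_cast hd) _
  have h34 : (4 : ℝ) ^ t > 0 := by positivity
  have h3 : (0 : ℝ) < 3 ^ t := by positivity
  have hs := mul_three_pow_le t
  have h3t : (3 : ℝ) ≤ 3 ^ t := by
    simpa using pow_le_pow_right₀ (a := (3 : ℝ)) (by norm_num) (show 1 ≤ t by omega)
  have hss : (t : ℝ) * (t - 1) * 3 ^ t ≤ 2 * n := by linarith
  have ht0 : (0 : ℝ) ≤ t * (t - 1) := by
    have : (1 : ℝ) ≤ t := by exact_mod_cast (show 1 ≤ t by omega)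
    nlinarith
  have hnpos : (0 : ℝ) < n := by linarith
  have hgain : (n : ℝ) ^ t + 2 * ((n : ℝ) ^ t / 3 ^ t) ≤
      packVol (d ^ ·) i * packCount (d ^ ·) (i + 1) n := by
    refine le_trans ?_ (packVol_mul_ge_two d i n (by omega))
    have hc : ((n - 2 * d ^ t : ℕ) : ℝ) = n - 2 * d ^ t := by
      rw [Nat.cast_sub (by omega)]; push_cast; ring
    rw [← ht, hc, ← div_pow]
    have : (n : ℝ) / 3 ≤ n - 2 * d ^ t := by linarith
    have := pow_le_pow_left₀ (by positivity) this t
    linarith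
  have hb : (t : ℝ) * (t - 1) * 3 ≤ 2 * n :=
    (mul_le_mul_of_nonneg_left h3t ht0).trans hss
  refine ascFactorial_le_of_gain hgain (by linarith) ?_
  have hX : (0 : ℝ) ≤ (n : ℝ) ^ t / 3 ^ t := by positivity
  have hXe : (n : ℝ) ^ t = (n : ℝ) ^ t / 3 ^ t * 3 ^ t := by field_simp
  calc (n : ℝ) ^ t * (t * (t - 1)) = (n : ℝ) ^ t / 3 ^ t * (t * (t - 1) * 3 ^ t) := by
        conv_lhs => rw [hXe]
        ring
    _ ≤ (n : ℝ) ^ t / 3 ^ t * (2 * (2 * n - t * (t - 1))) :=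
        mul_le_mul_of_nonneg_left (by linarith) hX
    _ = _ := by ring

/-- The condition on the gain of `ascFactorial_le_of_lt_three_mul`, in the variable z = n / d^(t-1).
For d = 2 it fails at z = 3d = 6, hence the sharper restriction z ≤ 4 there. -/
theorem quintic_le {d z : ℝ} (hd : d = 2 ∧ z ≤ 4 ∨ 3 ≤ d) (h1 : d ≤ z) (h2 : z ≤ 3 * d) :
    5 * z ^ 5 ≤ 4 * d ^ 4 * ((z - 1) * (2 * z - 1) * (2 * z - 5 / 4)) := by
  rcases hd with ⟨rfl, hz⟩ | hd
  · have h5 : 5 * z ^ 5 ≤ 20 * z ^ 4 := by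
      have : 0 ≤ z ^ 4 := by positivity
      nlinarith
    refine h5.trans ?_
    obtain ⟨x, rfl⟩ : ∃ x, z = 2 + x := ⟨z - 2, by ring⟩
    have hx0 : 0 ≤ x := by linarith
    have hx2 : x ≤ 2 := by linarith
    have e1 := mul_nonneg hx0 (sub_nonneg.2 hx2)
    have e2 := mul_nonneg e1 hx0
    have e3 := mul_nonneg e2 hx0
    have e4 : 0 ≤ x ^ 2 := by positivity
    nlinarith
  · have hz : 3 ≤ z := by linarith
    have hzz : z ^ 2 ≤ 9 * d ^ 2 := by nlinarith
    have hd9 : 9 ≤ d ^ 2 := by nlinarith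
    have hdd : 9 * d ^ 2 ≤ d ^ 4 := by nlinarith
    have hp : (5 / 4) * z ^ 3 ≤ (z - 1) * (2 * z - 1) * (2 * z - 5 / 4) := by
      obtain ⟨x, rfl⟩ : ∃ x, z = 3 + x := ⟨z - 3, by ring⟩
      have hx0 : 0 ≤ x := by linarith
      have e4 : 0 ≤ x ^ 2 := by positivity
      have e5 : 0 ≤ x ^ 3 := by positivity
      nlinarith
    have hz3 : 0 ≤ z ^ 3 := by positivity
    calc 5 * z ^ 5 = 5 * z ^ 3 * z ^ 2 := by ring
      _ ≤ 5 * z ^ 3 * d ^ 4 := mul_le_mul_of_nonneg_left (hzz.trans hdd) (by positivity)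
      _ = 4 * d ^ 4 * ((5 / 4) * z ^ 3) := by ring
      _ ≤ _ := mul_le_mul_of_nonneg_left hp (by positivity)

theorem four_mul_two_pow_ge (j : ℕ) : j + 4 ≤ 4 * 2 ^ j := by
  induction j with
  | zero => norm_num
  | succ j ih => rw [pow_succ]; omega

theorem mul_le_five_mul_two_pow (j : ℕ) : 4 * ((j + 4) * (j + 5)) ≤ 5 * 2 ^ (j + 4) := by
  induction j with
  | zero => norm_num
  | succ j ih =>
    rw [show j + 1 + 4 = (j + 4) + 1 from rfl, pow_succ]
    nlinarith

/-- With t = j + 5, the extra coordinate of weight d^t may be unavailable or too costly. The gain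
comes instead from the topmost trapezoid in the slicing by the coordinate of weight W = d^(t-1). -/
theorem ascFactorial_le_of_lt_three_mul {d n j : ℕ} (hd : 2 ≤ d) (h1 : d ^ (j + 5) ≤ n)
    (h2 : n < 3 * d ^ (j + 5)) (h3 : n < d ^ (j + 6)) :
    (n.ascFactorial (j + 5) : ℝ) ≤ packVol (d ^ ·) (j + 4) * packCount (d ^ ·) (j + 4) n := by
  have hw : ∀ l, 0 < (d ^ · : ℕ → ℕ) l := fun l => by positivity
  set Wn := d ^ (j + 4) with hWn
  set W : ℝ := (Wn : ℝ) with hW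
  have hW0 : 0 < W := by rw [hW]; exact_mod_cast hw (j + 4)
  have hdr : (2 : ℝ) ≤ d := by exact_mod_cast hd
  have e5 : d ^ (j + 5) = d * Wn := by rw [hWn]; ring
  have e6 : d ^ (j + 6) = d ^ 2 * Wn := by rw [hWn]; ring
  rw [e5] at h1 h2
  rw [e6] at h3
  have g1 : d * W ≤ n := by rw [hW]; exact_mod_cast h1
  have g2 : n ≤ 3 * d * W := by
    have : (n : ℝ) < 3 * (d * W) := by rw [hW]; exact_mod_cast h2
    linarith
  have g3 : n ≤ d ^ 2 * W := by rw [hW]; exact_mod_cast h3.le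
  have h2W : 2 * Wn ≤ n := le_trans (Nat.mul_le_mul_right _ hd) h1
  have hgain : (n : ℝ) ^ (j + 5) + W * trapExcess (j + 4) ((n : ℝ) - 2 * W) n ≤
      packVol (d ^ ·) (j + 4) * packCount (d ^ ·) (j + 4) n := by
    refine le_trans ?_ (stepPowSum_le_packCount (d ^ ·) hw (j + 3) n)
    exact pow_succ_add_excess_le (k := j + 4) (by omega) (hw (j + 4)) h2W
  have hWn2 : 2 * W ≤ n := by rw [hW]; exact_mod_cast h2W
  have hE := le_trapExcess (a := (n : ℝ) - 2 * W) (b := n) (by linarith) (by linarith) j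
  -- This allows t(t-1) to be replaced by (5/4) W, the source of the factor 2z - 5/4 in the quintic
  -- inequality.
  have hk1 : 4 * (((j : ℝ) + 4) * (j + 5)) ≤ 5 * W := by
    have a1 := mul_le_five_mul_two_pow j
    have a2 : 2 ^ (j + 4) ≤ Wn := Nat.pow_le_pow_left hd _
    rw [hW]
    exact_mod_cast a1.trans (Nat.mul_le_mul_left 5 a2)
  have hk2 : ((j : ℝ) + 4) * d ^ 4 ≤ 4 * W := by
    have a1 := four_mul_two_pow_ge j
    have a2 : 2 ^ j ≤ d ^ j := Nat.pow_le_pow_left hd _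
    have a3 : (j + 4) * d ^ 4 ≤ 4 * Wn := by
      calc (j + 4) * d ^ 4 ≤ (4 * d ^ j) * d ^ 4 :=
            Nat.mul_le_mul_right _ (a1.trans (Nat.mul_le_mul_left 4 a2))
        _ = 4 * Wn := by rw [hWn]; ring
    rw [hW]
    exact_mod_cast a3
  have hjr : (0 : ℝ) ≤ j := Nat.cast_nonneg j
  have hn0 : (0 : ℝ) < n := by linarith
  have hcast : ((j + 5 : ℕ) : ℝ) * ((j + 5 : ℕ) - 1) = ((j : ℝ) + 4) * (j + 5) := by
    push_cast; ring
  refine ascFactorial_le_of_gain hgain ?_ ?_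
  · rw [hcast]; linarith
  rw [hcast]
  set z : ℝ := n / W with hz
  have hnz : (n : ℝ) = z * W := by rw [hz]; field_simp
  have hdz : (d : ℝ) ≤ z := by rw [hz, le_div_iff₀ hW0]; exact g1
  have hz3 : z ≤ 3 * d := by rw [hz, div_le_iff₀ hW0]; exact g2
  -- For d = 2 this is z ≤ 4, which is where the hypothesis n < d^(t+1) enters.
  have hz2 : z ≤ d ^ 2 := by rw [hz, div_le_iff₀ hW0]; exact g3
  have hquint := quintic_le (d := d) (z := z) (by
    rcases Nat.lt_or_ge d 3 with h | h
    · left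
      have : d = 2 := by omega
      subst this
      norm_num at hz2 ⊢
      exact hz2
    · right; exact_mod_cast h) hdz hz3
  have hd4 : (0 : ℝ) < (d : ℝ) ^ 4 := by positivity
  have hA : (n : ℝ) ^ j * (4 * W * (n - W)) * (4 * W * ((j + 5) / 5 * (2 * n - W))) ≤
      trapExcess (j + 4) ((n : ℝ) - 2 * W) n := by
    refine le_trans ?_ hE
    have x1 : (n : ℝ) ^ 2 - (n - 2 * W) ^ 2 = 4 * W * (n - W) := by ring
    rw [x1]
    refine mul_le_mul_of_nonneg_left ?_ ?_
    · have : 0 ≤ (j : ℝ) * (3 * n - 4 * W) := mul_nonneg hjr (by linarith)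
      nlinarith
    · have : 0 ≤ (n : ℝ) - W := by linarith
      positivity
  have hfin : 5 * ((j : ℝ) + 4) * n ^ 5 ≤
      16 * W ^ 3 * ((n - W) * (2 * n - W) * (2 * n - 5 / 4 * W)) := by
    rw [hnz]
    have x1 : 5 * ((j : ℝ) + 4) * (z * W) ^ 5 * d ^ 4 ≤ 20 * z ^ 5 * W ^ 6 := by
      have : 0 ≤ 5 * z ^ 5 * W ^ 5 := by
        have : 0 ≤ z := by linarith
        positivity
      nlinarith [mul_le_mul_of_nonneg_left hk2 this]
    have x2 : 20 * z ^ 5 * W ^ 6 ≤ 16 * W ^ 3 * ((z * W - W) * (2 * (z * W) - W) *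
        (2 * (z * W) - 5 / 4 * W)) * d ^ 4 := by
      have : 0 ≤ 4 * W ^ 6 := by positivity
      have := mul_le_mul_of_nonneg_left hquint this
      linarith
    exact le_of_mul_le_mul_right (x1.trans x2) hd4
  have hpos : 0 ≤ 2 * (n : ℝ) - (j + 4) * (j + 5) := by linarith
  have hpos2 : (0 : ℝ) ≤ n - W := by linarith
  have hpos3 : (0 : ℝ) ≤ 2 * n - W := by linarith
  calc (n : ℝ) ^ (j + 5) * ((j + 4) * (j + 5))
      = (n : ℝ) ^ j * ((j + 5) / 5) * (5 * ((j : ℝ) + 4) * n ^ 5) := by ring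
    _ ≤ (n : ℝ) ^ j * ((j + 5) / 5) *
        (16 * W ^ 3 * ((n - W) * (2 * n - W) * (2 * n - 5 / 4 * W))) :=
        mul_le_mul_of_nonneg_left hfin (by positivity)
    _ ≤ (n : ℝ) ^ j * ((j + 5) / 5) *
        (16 * W ^ 3 * ((n - W) * (2 * n - W) * (2 * n - (j + 4) * (j + 5)))) := by
        refine mul_le_mul_of_nonneg_left ?_ (by positivity)
        refine mul_le_mul_of_nonneg_left ?_ (by positivity)
        exact mul_le_mul_of_nonneg_left (by linarith) (by positivity)
    _ = W * ((n : ℝ) ^ j * (4 * W * (n - W)) * (4 * W * ((j + 5) / 5 * (2 * n - W)))) *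
        (2 * n - (j + 4) * (j + 5)) := by ring
    _ ≤ W * trapExcess (j + 4) ((n : ℝ) - 2 * W) n * (2 * n - (j + 4) * (j + 5)) := by
        refine mul_le_mul_of_nonneg_right ?_ hpos
        exact mul_le_mul_of_nonneg_left hA hW0.le

theorem ascFactorial_four_le {d n : ℕ} (hd : 4 ≤ d) (h1 : d ^ 4 ≤ n) (h2 : n < 3 * d ^ 4) :
    (n.ascFactorial 4 : ℝ) ≤ packVol (d ^ ·) 3 * packCount (d ^ ·) 3 n := by
  have hw : ∀ l, 0 < (d ^ · : ℕ → ℕ) l := fun l => by positivity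
  have hdr : (4 : ℝ) ≤ d := by exact_mod_cast hd
  have g1 : (d : ℝ) ^ 4 ≤ n := by exact_mod_cast h1
  have g2 : (n : ℝ) ≤ 3 * d ^ 4 := by exact_mod_cast h2.le
  have hW64 : (64 : ℝ) ≤ (d : ℝ) ^ 3 := by
    have := pow_le_pow_left₀ (by norm_num) hdr 3
    norm_num at this ⊢; exact this
  have hWle : 2 * d ^ 3 ≤ n := by
    refine le_trans ?_ h1
    rw [pow_succ d 3, mul_comm]
    exact Nat.mul_le_mul_left _ (by omega)
  have hgain := (pow_succ_add_excess_le (k := 3) (by omega) (hw 3) hWle).trans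
    (stepPowSum_le_packCount (d ^ ·) hw 2 n)
  rw [trapExcess_three] at hgain
  push_cast at hgain
  set W : ℝ := (d : ℝ) ^ 3 with hW
  have hW0 : 0 < W := by linarith
  have e4 : (d : ℝ) ^ 4 = d * W := by rw [hW]; ring
  rw [e4] at g1 g2
  refine ascFactorial_le_of_gain hgain (by push_cast; nlinarith) ?_
  push_cast
  set z : ℝ := n / W with hz
  have hnz : (n : ℝ) = z * W := by rw [hz]; field_simp
  have hdz : (d : ℝ) ≤ z := by rw [hz, le_div_iff₀ hW0]; exact g1
  have hz3 : z ≤ 3 * d := by rw [hz, div_le_iff₀ hW0]; linarith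
  have hz4 : 4 ≤ z := by linarith
  have hzz : z ^ 2 ≤ 9 * d ^ 2 := by nlinarith
  -- The factor 1 - 3/128 absorbs the subtracted t(t-1)/2 = 6: since z ≥ 4 and W ≥ 64, n = zW ≥ 256
  -- and 6 ≤ (3/128) n.
  have key : 3 * z ^ 3 ≤ (8 * (1 - 3 / 128)) * W * (z - 1) := by
    rcases le_total z 8 with h | h
    · have : 3 * z ^ 3 ≤ 192 * z := by nlinarith
      nlinarith
    · have x1 : 3 * z ^ 3 ≤ 27 * d ^ 2 * z := by nlinarith
      have x2 : 4 * (d : ℝ) ^ 2 ≤ W := by rw [hW]; nlinarith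
      have x3 : 27 * z ≤ (8 * (1 - 3 / 128)) * 4 * (z - 1) := by linarith
      have x4 : 0 ≤ (d : ℝ) ^ 2 := by positivity
      have x5 : 0 ≤ (8 * (1 - 3 / 128)) * (z - 1) := by nlinarith
      nlinarith [mul_le_mul_of_nonneg_left x3 x4, mul_le_mul_of_nonneg_left x2 x5]
  have hlin : (1 - 3 / 128) * (z * W) ≤ z * W - 6 := by nlinarith
  rw [hnz]
  have hz1 : 0 ≤ z - 1 := by linarith
  have c1 : 3 * z ^ 4 ≤ 8 * (z - 1) * (z * W - 6) := by
    have y1 : 3 * z ^ 4 ≤ 8 * (z - 1) * ((1 - 3 / 128) * (z * W)) := by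
      have := mul_le_mul_of_nonneg_left key (show (0 : ℝ) ≤ z by linarith)
      linarith
    exact y1.trans (mul_le_mul_of_nonneg_left hlin (by linarith))
  have c2 : 0 ≤ 4 * W ^ 4 := by positivity
  have := mul_le_mul_of_nonneg_left c1 c2
  linarith

/-- All full trapezoids are needed here. There are at least (n - 2w) / 2w of them with w = d², for a
total gain of at least 2w²(n - 2w), to be compared with the deficit 3n² + 2n. -/
theorem ascFactorial_three_le_of_lt {d n : ℕ} (hd : 5 ≤ d) (h1 : d ^ 3 ≤ n)
    (h2 : n < 2 * d ^ 3 + 3 * d ^ 2) :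
    (n.ascFactorial 3 : ℝ) ≤ packVol (d ^ ·) 2 * packCount (d ^ ·) 2 n := by
  have hw : ∀ l, 0 < (d ^ · : ℕ → ℕ) l := fun l => by positivity
  have hdr : (5 : ℝ) ≤ d := by exact_mod_cast hd
  have h := (cube_add_le_stepPowSum (hw 2) n)
  have h' := stepPowSum_le_packCount (d ^ ·) hw 1 n
  norm_num at h h'
  refine le_trans ?_ (h.trans h')
  have hK : (n : ℝ) - 2 * d ^ 2 ≤ 2 * d ^ 2 * (n / (2 * d ^ 2) : ℕ) := by
    have a1 := Nat.div_add_mod n (2 * d ^ 2)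
    have a2 := Nat.mod_lt n (show 0 < 2 * d ^ 2 by positivity)
    have : n ≤ 2 * d ^ 2 * (n / (2 * d ^ 2)) + 2 * d ^ 2 := by omega
    have : (n : ℝ) ≤ 2 * d ^ 2 * (n / (2 * d ^ 2) : ℕ) + 2 * d ^ 2 := by exact_mod_cast this
    linarith
  have hasc : (n.ascFactorial 3 : ℝ) = n ^ 3 + 3 * n ^ 2 + 2 * n := by
    simp only [Nat.ascFactorial]
    push_cast
    ring
  rw [hasc]
  have g1 : (d : ℝ) ^ 3 ≤ n := by exact_mod_cast h1
  have g2 : (n : ℝ) ≤ 2 * d ^ 3 + 3 * d ^ 2 := by exact_mod_cast h2.le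
  set W : ℝ := (d : ℝ) ^ 2 with hW
  have hW0 : 0 < W := by positivity
  have e3 : (d : ℝ) ^ 3 = d * W := by rw [hW]; ring
  rw [e3] at g1 g2
  have : 3 * (n : ℝ) ^ 2 + 2 * n ≤ 2 * W ^ 2 * (n - 2 * W) := by
    set z : ℝ := n / W with hz
    have hnz : (n : ℝ) = z * W := by rw [hz]; field_simp
    have hdz : (d : ℝ) ≤ z := by rw [hz, le_div_iff₀ hW0]; exact g1
    have hz3 : z ≤ 2 * d + 3 := by rw [hz, div_le_iff₀ hW0]; linarith
    rw [hnz]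
    have key : 3 * W * z ^ 2 + 2 * z ≤ 2 * W ^ 2 * (z - 2) := by
      have hW25 : 25 ≤ W := by rw [hW]; nlinarith
      have q1 : z ^ 2 ≤ (3 * d + 3) * z - d * (2 * d + 3) := by nlinarith
      have q2 : 2 * z ≤ W * z * (2 / 25) := by
        have : 0 ≤ z := by linarith
        nlinarith
      -- The difference is concave in z on [d, 2d + 3], so it suffices to check the endpoints (`r2`,
      -- `r3`); d + 3 is the length of the interval.
      have q3 : 3 * z ^ 2 + 2 / 25 * z ≤ 2 * W * (z - 2) := by
        have r0 : 0 ≤ z - d := by linarith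
        have r1 : 0 ≤ 2 * d + 3 - z := by linarith
        have r2 : 0 ≤ 2 * W * (d - 2) - 3 * d ^ 2 - 2 / 25 * d := by rw [hW]; nlinarith
        have r3 : 0 ≤ 2 * W * (2 * d + 1) - 3 * (2 * d + 3) ^ 2 - 2 / 25 * (2 * d + 3) := by
          rw [hW]
          obtain ⟨x, hx⟩ : ∃ x, (d : ℝ) = 5 + x := ⟨d - 5, by ring⟩
          have hx0 : 0 ≤ x := by linarith
          rw [hx]
          have e4 : 0 ≤ x ^ 2 := by positivity
          have e5 : 0 ≤ x ^ 3 := by positivity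
          nlinarith
        have r4 : (0 : ℝ) < d + 3 := by linarith
        have := mul_nonneg r0 r3
        have := mul_nonneg r1 r2
        have := mul_nonneg (mul_nonneg r0 r1) r4.le
        refine le_of_mul_le_mul_right ?_ r4
        nlinarith
      nlinarith
    have := mul_le_mul_of_nonneg_left key hW0.le
    linarith
  have hW2 : 0 ≤ 2 * W ^ 2 := by positivity
  have := mul_le_mul_of_nonneg_left hK hW2
  have e6 : (d : ℝ) ^ 2 = W := rfl
  nlinarith

theorem ascFactorial_three_le_of_ge {d n : ℕ} (hd : 2 ≤ d) (h2 : 2 * d ^ 3 + 3 * d ^ 2 ≤ n) :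
    (n.ascFactorial 3 : ℝ) ≤ packVol (d ^ ·) 2 * packCount (d ^ ·) 3 n := by
  have hdr : (2 : ℝ) ≤ d := by exact_mod_cast hd
  refine le_trans ?_ (packVol_mul_ge_two d 2 n (by omega))
  have hc : ((n - 2 * d ^ (2 + 1) : ℕ) : ℝ) = n - 2 * d ^ 3 := by
    rw [Nat.cast_sub (by norm_num; omega)]; push_cast; ring
  have hasc : (n.ascFactorial 3 : ℝ) = n ^ 3 + 3 * n ^ 2 + 2 * n := by
    simp only [Nat.ascFactorial]
    push_cast
    ring
  rw [hc, hasc]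
  have g2 : 2 * (d : ℝ) ^ 3 + 3 * d ^ 2 ≤ n := by exact_mod_cast h2
  obtain ⟨x, hx⟩ : ∃ x, (n : ℝ) = 2 * (d : ℝ) ^ 3 + 3 * d ^ 2 + x :=
    ⟨n - (2 * (d : ℝ) ^ 3 + 3 * d ^ 2), by ring⟩
  have hx0 : 0 ≤ x := by linarith
  -- In terms of x = n - (2d³ + 3d²), the difference of the two sides is a cubic with coefficients
  -- `k0`, `k1`, `k2` and 2, all nonnegative for d ≥ 2.
  have k0 : 0 ≤ 42 * (d : ℝ) ^ 6 - 36 * d ^ 5 - 27 * d ^ 4 - 4 * d ^ 3 - 6 * d ^ 2 := by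
    obtain ⟨y, hy⟩ : ∃ y, (d : ℝ) = 2 + y := ⟨d - 2, by ring⟩
    have hy0 : 0 ≤ y := by linarith
    rw [hy]
    ring_nf
    positivity
  have k1 : 0 ≤ 54 * (d : ℝ) ^ 4 - 12 * d ^ 3 - 18 * d ^ 2 - 2 := by
    obtain ⟨y, hy⟩ : ∃ y, (d : ℝ) = 2 + y := ⟨d - 2, by ring⟩
    have hy0 : 0 ≤ y := by linarith
    rw [hy]
    ring_nf
    positivity
  have k2 : 0 ≤ 18 * (d : ℝ) ^ 2 - 3 := by nlinarith
  have m1 := mul_nonneg k1 hx0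
  have m2 := mul_nonneg k2 (sq_nonneg x)
  have m3 : 0 ≤ x ^ 3 := by positivity
  rw [hx]
  simp only [Nat.reduceAdd]
  linarith

theorem ascFactorial_two_le {d n : ℕ} (h2 : 2 * d ^ 2 + d + 1 ≤ n) (hd : 0 < d) :
    (n.ascFactorial 2 : ℝ) ≤ packVol (d ^ ·) 1 * packCount (d ^ ·) 2 n := by
  refine le_trans ?_ (packVol_mul_ge_two d 1 n hd)
  have hc : ((n - 2 * d ^ (1 + 1) : ℕ) : ℝ) = n - 2 * d ^ 2 := by
    rw [Nat.cast_sub (by norm_num; omega)]; push_cast; ring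
  have hasc : (n.ascFactorial 2 : ℝ) = n ^ 2 + n := by
    simp only [Nat.ascFactorial]
    push_cast
    ring
  rw [hc, hasc]
  have g2 : 2 * (d : ℝ) ^ 2 + d + 1 ≤ n := by exact_mod_cast h2
  have hd0 : (0 : ℝ) ≤ d := Nat.cast_nonneg d
  obtain ⟨x, hx⟩ : ∃ x, (n : ℝ) = 2 * (d : ℝ) ^ 2 + d + 1 + x :=
    ⟨n - (2 * (d : ℝ) ^ 2 + d + 1), by ring⟩
  have hx0 : 0 ≤ x := by linarith
  rw [hx]
  norm_num
  nlinarith [mul_nonneg hd0 hx0]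

/-! ### Arithmetic exclusion of exceptional orders -/

/-- Bounded existential quantifier. -/
def anyBelow (p : ℕ → Bool) : ℕ → Bool
  | 0 => false
  | n + 1 => p n || anyBelow p n

/-- Bounded universal quantifier. -/
def allBelow (p : ℕ → Bool) : ℕ → Bool
  | 0 => true
  | n + 1 => p n && allBelow p n

theorem exists_of_anyBelow {p : ℕ → Bool} {n : ℕ} (h : anyBelow p n = true) :
    ∃ m < n, p m = true := by
  induction n with
  | zero => simp [anyBelow] at h
  | succ n ih =>
    rw [anyBelow, Bool.or_eq_true] at h
    rcases h with h | h
    · exact ⟨n, by omega, h⟩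
    · obtain ⟨m, hm, hp⟩ := ih h
      exact ⟨m, by omega, hp⟩

theorem of_allBelow {p : ℕ → Bool} {n : ℕ} (h : allBelow p n = true) : ∀ m < n, p m = true := by
  induction n with
  | zero => intro m hm; omega
  | succ n ih =>
    rw [allBelow, Bool.and_eq_true] at h
    intro m hm
    rcases Nat.lt_succ_iff_lt_or_eq.1 hm with h' | rfl
    · exact ih h.2 m h'
    · exact h.1

/-- Search for a short vector `(c₀, c₁, c₂)` with `N ∣ c₀ + c₁ T + c₂ T ^ 2`. -/
def hasShortVec (d n N T : ℕ) : Bool :=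
  anyBelow (fun c₁ => anyBelow (fun c₂ =>
    Nat.blt 0 (c₁ + c₂) &&
      (Nat.blt ((c₁ * T + c₂ * T ^ 2) % N + (d * c₁ + d ^ 2 * c₂)) n ||
        (Nat.blt (N - (c₁ * T + c₂ * T ^ 2) % N + (d * c₁ + d ^ 2 * c₂)) n ||
        (Nat.blt ((c₁ * T + c₂ * (N - 1) * T ^ 2) % N + (d * c₁ + d ^ 2 * c₂)) n ||
          Nat.blt (N - (c₁ * T + c₂ * (N - 1) * T ^ 2) % N + (d * c₁ + d ^ 2 * c₂)) n))))
    (n / d ^ 2 + 1)) (n / d + 1)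

/-- Up to a global sign, only the relative sign of c₁ and c₂ matters; the negative one is encoded by
N - 1 in place of -1. For given c₁, c₂ with residue r, the candidates for c₀ are -r and N - r. -/
theorem exists_of_hasShortVec {d n N T : ℕ} (hN : 0 < N) (h : hasShortVec d n N T = true) :
    ∃ c₀ c₁ c₂ : ℤ, (c₁ ≠ 0 ∨ c₂ ≠ 0) ∧ |c₀| + d * |c₁| + d ^ 2 * |c₂| < n ∧
      (N : ℤ) ∣ c₀ + c₁ * T + c₂ * T ^ 2 := by
  obtain ⟨c₁, -, h⟩ := exists_of_anyBelow h
  obtain ⟨c₂, -, h⟩ := exists_of_anyBelow h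
  simp only [Bool.and_eq_true, Bool.or_eq_true, Nat.blt_eq] at h
  obtain ⟨h0, h⟩ := h
  have hne : (c₁ : ℤ) ≠ 0 ∨ (c₂ : ℤ) ≠ 0 := by omega
  have hne' : (c₁ : ℤ) ≠ 0 ∨ (-c₂ : ℤ) ≠ 0 := by omega
  have hlt1 := Nat.mod_lt (c₁ * T + c₂ * T ^ 2) hN
  have hlt2 := Nat.mod_lt (c₁ * T + c₂ * (N - 1) * T ^ 2) hN
  have hd1 : (N : ℤ) ∣ c₁ * T + c₂ * T ^ 2 - ((c₁ * T + c₂ * T ^ 2) % N : ℕ) := by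
    have := Nat.div_add_mod (c₁ * T + c₂ * T ^ 2) N
    refine ⟨((c₁ * T + c₂ * T ^ 2) / N : ℕ), ?_⟩
    have : (N : ℤ) * ((c₁ * T + c₂ * T ^ 2) / N : ℕ) + ((c₁ * T + c₂ * T ^ 2) % N : ℕ) =
      c₁ * T + c₂ * T ^ 2 := by exact_mod_cast this
    linarith
  have hd2 : (N : ℤ) ∣ c₁ * T + (-c₂) * T ^ 2 - ((c₁ * T + c₂ * (N - 1) * T ^ 2) % N : ℕ) := by
    have := Nat.div_add_mod (c₁ * T + c₂ * (N - 1) * T ^ 2) N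
    have hc : ((N - 1 : ℕ) : ℤ) = N - 1 := by push_cast [hN]; ring
    have : (N : ℤ) * ((c₁ * T + c₂ * (N - 1) * T ^ 2) / N : ℕ) +
        ((c₁ * T + c₂ * (N - 1) * T ^ 2) % N : ℕ) = c₁ * T + c₂ * ((N : ℤ) - 1) * T ^ 2 := by
      rw [← hc]; exact_mod_cast this
    refine ⟨((c₁ * T + c₂ * (N - 1) * T ^ 2) / N : ℕ) - c₂ * T ^ 2, ?_⟩
    linarith
  set r := (c₁ * T + c₂ * T ^ 2) % N
  set r' := (c₁ * T + c₂ * (N - 1) * T ^ 2) % N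
  have hz : ∀ {x : ℕ}, x + (d * c₁ + d ^ 2 * c₂) < n →
      (x : ℤ) + d * (c₁ : ℤ) + d ^ 2 * (c₂ : ℤ) < n := by
    intro x hx
    have : ((x + (d * c₁ + d ^ 2 * c₂) : ℕ) : ℤ) < n := by exact_mod_cast hx
    push_cast at this
    linarith
  rcases h with h | h | h | h
  · refine ⟨-r, c₁, c₂, hne, ?_, ?_⟩
    · rw [abs_neg]; simp only [Nat.abs_cast]; exact hz h
    · obtain ⟨e, he⟩ := hd1
      exact ⟨e, by linarith⟩
  · refine ⟨(N - r : ℕ), c₁, c₂, hne, ?_, ?_⟩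
    · simp only [Nat.abs_cast]; exact hz h
    · obtain ⟨e, he⟩ := hd1
      rw [Nat.cast_sub hlt1.le]
      exact ⟨e + 1, by linarith⟩
  · refine ⟨-r', c₁, -c₂, hne', ?_, ?_⟩
    · rw [abs_neg, abs_neg]; simp only [Nat.abs_cast]; exact hz h
    · obtain ⟨e, he⟩ := hd2
      exact ⟨e, by linarith⟩
  · refine ⟨(N - r' : ℕ), c₁, -c₂, hne', ?_, ?_⟩
    · rw [abs_neg]; simp only [Nat.abs_cast]; exact hz h
    · obtain ⟨e, he⟩ := hd2
      rw [Nat.cast_sub hlt2.le]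
      exact ⟨e + 1, by linarith⟩

/-- The multiplicative order of `q` modulo `N` is not `n`, or there is a short relation. -/
def orderExcluded (d n k q N : ℕ) : Bool :=
  !Nat.beq (q ^ n % N) 1 ||
    (anyBelow (fun m => Nat.blt 0 m && Nat.beq (q ^ m % N) 1) n || hasShortVec d n N (q ^ k % N))

/-- The arithmetic properties of the order `N` of an element of degree `n` over `𝔽_q` all of whose
multiplicative relations are long. -/
structure LongRelations (d n k q N : ℕ) : Prop where
  modEq : q ^ n ≡ 1 [MOD N]
  not_modEq : ∀ m, 0 < m → m < n → ¬ q ^ m ≡ 1 [MOD N]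
  long : ∀ c₀ c₁ c₂ : ℤ, (c₁ ≠ 0 ∨ c₂ ≠ 0) → |c₀| + d * |c₁| + d ^ 2 * |c₂| < n →
    ¬ (N : ℤ) ∣ c₀ + c₁ * (q ^ k : ℕ) + c₂ * (q ^ k : ℕ) ^ 2

theorem LongRelations.orderExcluded_eq_false {d n k q N : ℕ} (h : LongRelations d n k q N)
    (hN : 2 ≤ N) : orderExcluded d n k q N = false := by
  by_contra hcon
  rw [Bool.not_eq_false, orderExcluded, Bool.or_eq_true, Bool.or_eq_true] at hcon
  have h1 : 1 % N = 1 := Nat.mod_eq_of_lt (by omega)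
  rcases hcon with hc | hc | hc
  · have := h.modEq
    rw [Nat.ModEq, h1] at this
    simp [this] at hc
  · obtain ⟨m, hm, hc⟩ := exists_of_anyBelow hc
    rw [Bool.and_eq_true, Nat.blt_eq] at hc
    refine h.not_modEq m hc.1 hm ?_
    rw [Nat.ModEq, h1, Nat.eq_of_beq_eq_true hc.2]
  · obtain ⟨c₀, c₁, c₂, hne, hlt, hdvd⟩ := exists_of_hasShortVec (by omega) hc
    refine h.long c₀ c₁ c₂ hne hlt ?_
    have e : ((q ^ k % N : ℕ) : ℤ) ≡ ((q ^ k : ℕ) : ℤ) [ZMOD N] := by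
      rw [Int.natCast_mod]
      exact Int.mod_modEq _ _
    have := ((Int.ModEq.refl c₀).add (e.mul_left c₁)).add ((e.pow 2).mul_left c₂)
    exact (Int.modEq_zero_iff_dvd).1 (this.symm.trans ((Int.modEq_zero_iff_dvd).2 hdvd))

/-- An upper bound for the field sizes that have to be inspected. -/
def maxField (d : ℕ) : ℕ := if d = 2 then 49 else if d = 3 then 21 else 11

/-- Inspection of all the pairs `(q, n)` with `d ^ 2 ≤ n ≤ 2 d ^ 2 + d`. -/
def smallDegreesExcluded (d : ℕ) : Bool :=
  allBelow (fun x => allBelow (fun q =>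
    !(Nat.blt 1 q && Nat.blt (d ^ 2 + x) (d ^ 3) && Nat.blt (q ^ (d - 1)) ((d ^ 2 + x) ^ 2) &&
      Nat.ble ((d ^ 2 + x) ^ 2) (q ^ d)) ||
    allBelow (fun y =>
      !(Nat.blt (2 * d * (((d ^ 2 + x) ^ 2 + (2 * d - 1)) / (2 * d) + y))
        ((d ^ 2 + x) * (d ^ 2 + x + 1))) ||
      orderExcluded d (d ^ 2 + x) ((d + 1) / 2) q
        (((d ^ 2 + x) ^ 2 + (2 * d - 1)) / (2 * d) + y)) ((d ^ 2 + x) / (2 * d) + 1))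
    (maxField d)) (d ^ 2 + d + 1)

-- For t = 2 and n ≤ 2d² + d the counting argument is too weak. Every N between n²/2d and n(n+1)/2d
-- is therefore tested against the order of q modulo N and against short relations.
set_option maxRecDepth 100000 in
theorem smallDegreesExcluded_all :
    allBelow (fun d => !Nat.blt 1 d || smallDegreesExcluded d) 21 = true := by
  decide +kernel

theorem blt_eq_false {a b : ℕ} : Nat.blt a b = false ↔ b ≤ a := by
  rw [← Bool.not_eq_true, Nat.blt_eq, not_lt]

theorem ble_eq_false {a b : ℕ} : Nat.ble a b = false ↔ b < a := by
  rw [← Bool.not_eq_true, Nat.ble_eq, not_le]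

/-- With d = ⌈2 log_q n⌉ and k = ⌈log_q n⌉, k is half of d rounded up; so the search does not need
to range over k. -/
theorem exponent_eq {q n d k : ℕ} (hq : 2 ≤ q) (h1 : q ^ (d - 1) < n ^ 2) (h2 : n ^ 2 ≤ q ^ d)
    (hd : 2 ≤ d) (hk1 : n ≤ q ^ k) (hk2 : q ^ (k - 1) < n) : k = (d + 1) / 2 := by
  have a : q ^ (2 * (k - 1)) < q ^ d := by
    calc q ^ (2 * (k - 1)) = (q ^ (k - 1)) ^ 2 := by rw [← pow_mul, mul_comm]
      _ < n ^ 2 := Nat.pow_lt_pow_left hk2 (by norm_num)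
      _ ≤ q ^ d := h2
  have b : q ^ (d - 1) < q ^ (2 * k) := by
    calc q ^ (d - 1) < n ^ 2 := h1
      _ ≤ (q ^ k) ^ 2 := Nat.pow_le_pow_left hk1 2
      _ = q ^ (2 * k) := by rw [← pow_mul, mul_comm]
  have a' := (Nat.pow_lt_pow_iff_right (by omega)).1 a
  have b' := (Nat.pow_lt_pow_iff_right (by omega)).1 b
  omega

/-- With q^(d-1) < n² and n ≤ 2d² + d, this confines the search to d ≤ 20. -/
theorem sq_le_two_pow {d : ℕ} (hd : 21 ≤ d) : (2 * d ^ 2 + d) ^ 2 ≤ 2 ^ (d - 1) := by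
  induction d, hd using Nat.le_induction with
  | base => norm_num
  | succ d hd ih =>
    have e : 2 ^ (d + 1 - 1) = 2 * 2 ^ (d - 1) := by
      rw [← pow_succ']; congr 1; omega
    rw [e]
    refine le_trans ?_ (Nat.mul_le_mul_left 2 ih)
    obtain ⟨x, rfl⟩ : ∃ x, d = 21 + x := ⟨d - 21, by omega⟩
    ring_nf
    have : x ^ 2 ≤ x ^ 3 + x := by
      rcases x with _ | x
      · simp
      · nlinarith [Nat.zero_le (x ^ 3), Nat.zero_le (x ^ 2)]
    nlinarith [Nat.zero_le (x ^ 4), Nat.zero_le (x ^ 3), Nat.zero_le (x ^ 2)]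

theorem false_of_small_degree {d n k q N : ℕ} (h : LongRelations d n k q N) (hq : 2 ≤ q)
    (hd : 2 ≤ d) (h1 : q ^ (d - 1) < n ^ 2) (h2 : n ^ 2 ≤ q ^ d) (hk1 : n ≤ q ^ k)
    (hk2 : q ^ (k - 1) < n) (hn1 : d ^ 2 ≤ n) (hn2 : n ≤ 2 * d ^ 2 + d) (hn3 : n < d ^ 3)
    (hN1 : n ^ 2 ≤ 2 * d * N) (hN2 : 2 * d * N < n * (n + 1)) : False := by
  have hk := exponent_eq hq h1 h2 hd hk1 hk2
  have hd21 : d < 21 := by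
    by_contra hcon
    have a := sq_le_two_pow (d := d) (by omega)
    have b : 2 ^ (d - 1) ≤ q ^ (d - 1) := Nat.pow_le_pow_left hq _
    have c : n ^ 2 ≤ (2 * d ^ 2 + d) ^ 2 := Nat.pow_le_pow_left hn2 2
    omega
  -- The bounds n ≤ 2d² + d and n ≤ d³ - 1 together with q^(d-1) < n² bound q; the table of
  -- `maxField` is verified for each d.
  have hqm : q < maxField d := by
    by_contra hcon
    have b : maxField d ^ (d - 1) ≤ q ^ (d - 1) := Nat.pow_le_pow_left (by omega) _
    have c : n ^ 2 ≤ (2 * d ^ 2 + d) ^ 2 := Nat.pow_le_pow_left hn2 2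
    have c' : n ^ 2 ≤ (d ^ 3 - 1) ^ 2 := Nat.pow_le_pow_left (by omega) 2
    have : ∀ d < 21, 2 ≤ d → min ((2 * d ^ 2 + d) ^ 2) ((d ^ 3 - 1) ^ 2) ≤ maxField d ^ (d - 1) := by
      decide
    exact absurd (le_min c c') (not_le.2 ((h1.trans_le' b).trans_le' (this d hd21 hd)))
  have ha := of_allBelow smallDegreesExcluded_all d hd21
  rw [Bool.or_eq_true] at ha
  rcases ha with ha | ha
  · rw [Bool.not_eq_true', blt_eq_false] at ha; omega
  obtain ⟨x, rfl⟩ : ∃ x, n = d ^ 2 + x := ⟨n - d ^ 2, by omega⟩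
  have ha := of_allBelow (of_allBelow ha x (by omega)) q hqm
  rw [Bool.or_eq_true] at ha
  rcases ha with ha | ha
  · simp only [Bool.not_eq_true', Bool.and_eq_false_iff, blt_eq_false, ble_eq_false] at ha
    omega
  set n := d ^ 2 + x
  have hlow : (n ^ 2 + (2 * d - 1)) / (2 * d) ≤ N := by
    rw [Nat.div_le_iff_le_mul_add_pred (by omega)]
    omega
  obtain ⟨y, rfl⟩ : ∃ y, N = (n ^ 2 + (2 * d - 1)) / (2 * d) + y :=
    ⟨N - (n ^ 2 + (2 * d - 1)) / (2 * d), by omega⟩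
  -- The window n² ≤ 2dN < n(n+1) has length n / 2d in N.
  have hy : y < n / (2 * d) + 1 := by
    have a1 := Nat.div_add_mod (n ^ 2 + (2 * d - 1)) (2 * d)
    have a2 := Nat.mod_lt (n ^ 2 + (2 * d - 1)) (show 0 < 2 * d by omega)
    have a3 : n ^ 2 ≤ 2 * d * ((n ^ 2 + (2 * d - 1)) / (2 * d)) := by omega
    have a4 : y * (2 * d) < n := by nlinarith
    have a5 : y ≤ n / (2 * d) := (Nat.le_div_iff_mul_le (by omega)).2 a4.le
    omega
  have ha := of_allBelow ha y hy
  rw [Bool.or_eq_true] at ha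
  rcases ha with ha | ha
  · rw [Bool.not_eq_true', blt_eq_false] at ha
    exact absurd hN2 (not_lt.2 ha)
  · rw [← hk, h.orderExcluded_eq_false ?_] at ha
    · simp at ha
    · by_contra hcon
      have : 4 ≤ d ^ 2 := by nlinarith
      have hdn : d * d ≤ n := by nlinarith
      have : 2 * d * ((n ^ 2 + (2 * d - 1)) / (2 * d) + y) ≤ 2 * d * 1 :=
        Nat.mul_le_mul_left _ (by omega)
      nlinarith

/-- The exceptional degrees for three coordinates. -/
def cubicExcluded (d n N Q : ℕ) : Bool :=
  allBelow (fun q => !(Nat.blt 1 q && Nat.blt (q ^ (d - 1)) (n ^ 2) && Nat.ble (n ^ 2) (q ^ d)) ||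
    orderExcluded d n ((d + 1) / 2) q N) Q

theorem false_of_cubicExcluded {d n k q N Q : ℕ} (hx : cubicExcluded d n N Q = true)
    (h : LongRelations d n k q N) (hN : 2 ≤ N) (hQ : n ^ 2 ≤ Q ^ (d - 1)) (hq : 2 ≤ q)
    (hd : 2 ≤ d) (h1 : q ^ (d - 1) < n ^ 2) (h2 : n ^ 2 ≤ q ^ d) (hk1 : n ≤ q ^ k)
    (hk2 : q ^ (k - 1) < n) : False := by
  have hk := exponent_eq hq h1 h2 hd hk1 hk2
  have hqQ : q < Q := by
    by_contra hcon
    have := Nat.pow_le_pow_left (not_lt.1 hcon) (d - 1)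
    omega
  have ha := of_allBelow hx q hqQ
  rw [← hk, h.orderExcluded_eq_false hN, Bool.or_false, Bool.not_eq_true'] at ha
  simp only [Bool.and_eq_false_iff, blt_eq_false, ble_eq_false] at ha
  omega

/-- For t = 3 these are the remaining orders: at least the packing number, yet with 6d³ N <
n(n+1)(n+2). The last argument bounds q through n² ≤ Q^(d-1). -/
theorem cubicExcluded_all : cubicExcluded 2 12 44 144 = true ∧ cubicExcluded 2 12 45 144 = true ∧
    cubicExcluded 2 15 83 225 = true ∧ cubicExcluded 2 15 84 225 = true ∧
    cubicExcluded 3 54 1026 54 = true := by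
  refine ⟨?_, ?_, ?_, ?_, ?_⟩ <;> decide +kernel

/-! ### Evaluated packing numbers and the bound for independent iterates -/

/-- Sum of the values of `f` at the numbers below `n`. -/
def sumBelow (f : ℕ → ℕ) : ℕ → ℕ
  | 0 => 0
  | n + 1 => sumBelow f n + f n

theorem sumBelow_eq (f : ℕ → ℕ) (n : ℕ) : sumBelow f n = ∑ j ∈ Finset.range n, f j := by
  induction n with
  | zero => rfl
  | succ n ih => rw [sumBelow, Finset.sum_range_succ, ih]

/-- A version of `packCount (d ^ ·)` that can be evaluated. -/
def packEval (d : ℕ) : ℕ → ℕ → ℕ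
  | 0, m => m
  | i + 1, m => packEval d i m + 2 * sumBelow (fun j => packEval d i (m - 2 * d ^ (i + 1) * (j + 1)))
      (m / (2 * d ^ (i + 1)))

/-- Slices with |j| > m / 2d^(i+1) are empty, so the sum can stop there. -/
theorem packEval_eq {d : ℕ} (hd : 0 < d) (i m : ℕ) : packEval d i m = packCount (d ^ ·) i m := by
  induction i generalizing m with
  | zero => rfl
  | succ i ih =>
    rw [packEval, packCount_succ, sumBelow_eq, ih]
    congr 2
    have hpos : 0 < 2 * d ^ (i + 1) := by positivity
    rw [Finset.sum_subset (Finset.range_mono (Nat.div_le_self m (2 * d ^ (i + 1))))]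
    · simp only [ih]
    · intro j _ hj
      have hj' : m / (2 * d ^ (i + 1)) ≤ j := by simpa using hj
      have : m < 2 * d ^ (i + 1) * (j + 1) := by
        rw [mul_comm]
        exact (Nat.div_lt_iff_lt_mul hpos).1 (by omega)
      rw [Nat.sub_eq_zero_of_le this.le, ih, packCount_zero_right]

theorem packVol_pow_two (d : ℕ) : packVol (d ^ ·) 2 = ((6 * d ^ 3 : ℕ) : ℝ) := by
  norm_num [packVol, Finset.prod_range_succ, Nat.factorial]
  ring

theorem packVol_pow_three (d : ℕ) : packVol (d ^ ·) 3 = ((24 * d ^ 6 : ℕ) : ℝ) := by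
  norm_num [packVol, Finset.prod_range_succ, Nat.factorial]
  ring

theorem packVol_pow_one (d : ℕ) : packVol (d ^ ·) 1 = ((2 * d : ℕ) : ℝ) := by
  norm_num [packVol, Finset.prod_range_succ, Nat.factorial]

theorem packEval_three_all : allBelow (fun d => allBelow (fun n => Nat.blt d 2 || (Nat.blt n (d ^ 3) ||
    (Nat.ble (d ^ 4) n || (Nat.beq d 2 && (Nat.beq n 12 || Nat.beq n 15)) || (Nat.beq d 3 && Nat.beq n 54) ||
    Nat.ble (n.ascFactorial 3) (6 * d ^ 3 * packEval d 3 n)))) (2 * d ^ 3 + 3 * d ^ 2)) 5 = true := by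
  decide +kernel

theorem packEval_four_all : allBelow (fun d => allBelow (fun n => Nat.blt d 2 || (Nat.blt n (d ^ 4) ||
    Nat.ble (n.ascFactorial 4) (24 * d ^ 6 * packEval d 3 n))) (d ^ 5)) 4 = true := by
  decide +kernel

theorem packEval_special : packEval 2 3 12 = 44 ∧ packEval 2 3 15 = 83 ∧ packEval 3 3 54 = 1026 := by
  decide +kernel

theorem packEval_three {d n : ℕ} (hd : 2 ≤ d) (hd4 : d ≤ 4) (h1 : d ^ 3 ≤ n) (h2 : n < d ^ 4)
    (h3 : n < 2 * d ^ 3 + 3 * d ^ 2) (h4 : ¬ (d = 2 ∧ (n = 12 ∨ n = 15))) (h5 : ¬ (d = 3 ∧ n = 54)) :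
    n.ascFactorial 3 ≤ 6 * d ^ 3 * packEval d 3 n := by
  have := of_allBelow (of_allBelow packEval_three_all d (by omega)) n h3
  simp only [Bool.or_eq_true, Bool.and_eq_true, Nat.blt_eq, Nat.ble_eq, Nat.beq_eq] at this
  omega

theorem packEval_four {d n : ℕ} (hd : 2 ≤ d) (hd3 : d ≤ 3) (h1 : d ^ 4 ≤ n) (h2 : n < d ^ 5) :
    n.ascFactorial 4 ≤ 24 * d ^ 6 * packEval d 3 n := by
  have := of_allBelow (of_allBelow packEval_four_all d (by omega)) n h2
  simp only [Bool.or_eq_true, Nat.blt_eq, Nat.ble_eq] at this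
  omega

/-- The counting estimates cover all t ≥ 1 apart from small n for t = 2 and three pairs (d, n) for t
= 3, where long relations are used. The number of coordinates counted is t or t + 1, according to
whether n is near d^t or well above it. -/
theorem ascFactorial_le_of_longRelations {d n k q N t : ℕ} (hq : 2 ≤ q) (hd : 2 ≤ d)
    (h1 : q ^ (d - 1) < n ^ 2) (h2 : n ^ 2 ≤ q ^ d) (hk1 : n ≤ q ^ k) (hk2 : q ^ (k - 1) < n)
    (ht : 1 ≤ t) (ht1 : d ^ t ≤ n) (ht2 : n < d ^ (t + 1))
    (hpack : ∀ i ≤ t, packCount (d ^ ·) i n ≤ N) (h : 2 ≤ t → LongRelations d n k q N) :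
    (n.ascFactorial t : ℝ) ≤ packVol (d ^ ·) (t - 1) * N := by
  have hup : ∀ i ≤ t, (n.ascFactorial t : ℝ) ≤ packVol (d ^ ·) (t - 1) * packCount (d ^ ·) i n →
      (n.ascFactorial t : ℝ) ≤ packVol (d ^ ·) (t - 1) * N := fun i hi hle =>
    hle.trans (mul_le_mul_of_nonneg_left (by exact_mod_cast hpack i hi) (packVol_nonneg _ _))
  obtain rfl | rfl | rfl | rfl | ht5 : t = 1 ∨ t = 2 ∨ t = 3 ∨ t = 4 ∨ 5 ≤ t := by omega
  · have := hpack 0 (by omega)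
    simp only [packCount] at this
    simp only [Nat.ascFactorial, packVol]
    norm_num
    exact this
  · rcases Nat.lt_or_ge n (2 * d ^ 2 + d + 1) with hn | hn
    · by_contra hcon
      rw [not_le, show 2 - 1 = 1 from rfl, packVol_pow_one] at hcon
      have hcon' : 2 * d * N < n.ascFactorial 2 := by exact_mod_cast hcon
      have hN1 : n ^ 2 ≤ 2 * d * N := by
        have a := pow_succ_le_packVol_mul_packCount (d ^ · : ℕ → ℕ) (fun l => by positivity) 1 n
        rw [packVol_pow_one] at a
        have b : n ^ 2 ≤ 2 * d * packCount (d ^ ·) 1 n := by exact_mod_cast a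
        exact b.trans (Nat.mul_le_mul_left _ (hpack 1 (by omega)))
      refine false_of_small_degree (h le_rfl) hq hd h1 h2 hk1 hk2 ht1 (by omega) ht2 hN1 ?_
      simp only [Nat.ascFactorial] at hcon'
      linarith
    · exact hup 2 le_rfl (ascFactorial_two_le hn (by omega))
  · rcases Nat.lt_or_ge n (2 * d ^ 3 + 3 * d ^ 2) with hn | hn
    · rcases Nat.lt_or_ge d 5 with hd5 | hd5
      · have hp3 := hpack 3 le_rfl
        rw [← packEval_eq (by omega)] at hp3
        have hL := h (by omega)
        suffices n.ascFactorial 3 ≤ 6 * d ^ 3 * N by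
          rw [show 3 - 1 = 2 from rfl, packVol_pow_two]
          exact_mod_cast this
        obtain ⟨e1, e2, e3⟩ := packEval_special
        obtain ⟨c1, c2, c3, c4, c5⟩ := cubicExcluded_all
        by_cases hs : d = 2 ∧ (n = 12 ∨ n = 15)
        · obtain ⟨rfl, rfl | rfl⟩ := hs
          · by_contra hcon
            norm_num [Nat.ascFactorial] at hcon
            obtain rfl | rfl : N = 44 ∨ N = 45 := by omega
            · exact false_of_cubicExcluded c1 hL (by norm_num) (by norm_num) hq hd h1 h2 hk1 hk2
            · exact false_of_cubicExcluded c2 hL (by norm_num) (by norm_num) hq hd h1 h2 hk1 hk2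
          · by_contra hcon
            norm_num [Nat.ascFactorial] at hcon
            obtain rfl | rfl : N = 83 ∨ N = 84 := by omega
            · exact false_of_cubicExcluded c3 hL (by norm_num) (by norm_num) hq hd h1 h2 hk1 hk2
            · exact false_of_cubicExcluded c4 hL (by norm_num) (by norm_num) hq hd h1 h2 hk1 hk2
        by_cases hs' : d = 3 ∧ n = 54
        · obtain ⟨rfl, rfl⟩ := hs'
          by_contra hcon
          norm_num [Nat.ascFactorial] at hcon
          obtain rfl : N = 1026 := by omega
          exact false_of_cubicExcluded c5 hL (by norm_num) (by norm_num) hq hd h1 h2 hk1 hk2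
        exact (packEval_three hd (by omega) ht1 ht2 hn hs hs').trans (Nat.mul_le_mul_left _ hp3)
      · exact hup 2 (by omega) (ascFactorial_three_le_of_lt hd5 ht1 hn)
    · exact hup 3 le_rfl (ascFactorial_three_le_of_ge hd hn)
  · rcases Nat.lt_or_ge d 4 with hd4 | hd4
    · refine hup 3 (by omega) ?_
      rw [show 4 - 1 = 3 from rfl, packVol_pow_three, ← packEval_eq (by omega)]
      exact_mod_cast packEval_four hd (by omega) ht1 ht2
    · rcases Nat.lt_or_ge n (3 * d ^ 4) with hn | hn
      · exact hup 3 (by omega) (ascFactorial_four_le hd4 ht1 hn)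
      · exact hup 4 le_rfl (ascFactorial_le_of_three_mul_le (i := 3) hd4 hn)
  · obtain ⟨j, rfl⟩ : ∃ j, t = j + 5 := ⟨t - 5, by omega⟩
    rcases Nat.lt_or_ge n (3 * d ^ (j + 5)) with hn | hn
    · exact hup (j + 4) (by omega) (ascFactorial_le_of_lt_three_mul hd ht1 hn ht2)
    · refine hup (j + 5) le_rfl (ascFactorial_le_of_three_mul_le (i := j + 4) ?_ hn)
      -- For d ≤ 3 the inequality n ≥ 3d^t would contradict n < d^(t+1).
      by_contra hcon
      have : d ^ (j + 5 + 1) ≤ 3 * d ^ (j + 5) := by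
        rw [pow_succ, mul_comm]
        exact Nat.mul_le_mul_right _ (by omega)
      omega

/-! ### Orders of vanishing on the projective line -/

open Polynomial in
/-- Order of vanishing of a polynomial at a point of the projective line; `none` is the point at
infinity. -/
noncomputable def polyOrd {F : Type*} [Field F] (P : Option F) (p : F[X]) : ℤ :=
  match P with
  | some x => p.rootMultiplicity x
  | none => -p.natDegree

/-- Order of vanishing of a rational function at a point of the projective line. -/
noncomputable def ordAt {F : Type*} [Field F] (P : Option F) (R : RatFunc F) : ℤ :=
  polyOrd P R.num - polyOrd P R.denom

section Order

open Polynomial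

variable {F : Type*} [Field F]

theorem polyOrd_mul (P : Option F) {p q : F[X]} (hp : p ≠ 0) (hq : q ≠ 0) :
    polyOrd P (p * q) = polyOrd P p + polyOrd P q := by
  cases P with
  | none => simp only [polyOrd]; rw [natDegree_mul hp hq]; push_cast; ring
  | some x => simp only [polyOrd]; rw [rootMultiplicity_mul (mul_ne_zero hp hq)]; push_cast; ring

theorem polyOrd_C (P : Option F) (a : F) : polyOrd P (C a) = 0 := by
  cases P <;> simp [polyOrd]

theorem polyOrd_one (P : Option F) : polyOrd P (1 : F[X]) = 0 := by
  rw [← C_1, polyOrd_C]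

theorem ordAt_div (P : Option F) {p q : F[X]} (hp : p ≠ 0) (hq : q ≠ 0) :
    ordAt P (algebraMap F[X] (RatFunc F) p / algebraMap F[X] (RatFunc F) q) =
      polyOrd P p - polyOrd P q := by
  set x := algebraMap F[X] (RatFunc F) p / algebraMap F[X] (RatFunc F) q with hx
  have h := (RatFunc.num_mul_eq_mul_denom_iff (x := x) hq).2 hx
  have hx0 : x ≠ 0 := div_ne_zero (RatFunc.algebraMap_ne_zero hp) (RatFunc.algebraMap_ne_zero hq)
  have h' := congrArg (polyOrd P) h
  rw [polyOrd_mul P (RatFunc.num_ne_zero hx0) hq, polyOrd_mul P hp (RatFunc.denom_ne_zero x)] at h'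
  unfold ordAt
  linarith

theorem ordAt_algebraMap (P : Option F) {p : F[X]} (hp : p ≠ 0) :
    ordAt P (algebraMap F[X] (RatFunc F) p) = polyOrd P p := by
  have := ordAt_div P hp one_ne_zero
  rwa [map_one, div_one, polyOrd_one, sub_zero] at this

theorem ordAt_mul (P : Option F) {R S : RatFunc F} (hR : R ≠ 0) (hS : S ≠ 0) :
    ordAt P (R * S) = ordAt P R + ordAt P S := by
  have h : R * S = algebraMap F[X] (RatFunc F) (R.num * S.num) /
      algebraMap F[X] (RatFunc F) (R.denom * S.denom) := by
    rw [map_mul, map_mul, mul_div_mul_comm, RatFunc.num_div_denom, RatFunc.num_div_denom]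
  have hR' := RatFunc.num_ne_zero hR
  have hS' := RatFunc.num_ne_zero hS
  have hRd := RatFunc.denom_ne_zero R
  have hSd := RatFunc.denom_ne_zero S
  rw [h, ordAt_div P (mul_ne_zero hR' hS') (mul_ne_zero hRd hSd), polyOrd_mul P hR' hS',
    polyOrd_mul P hRd hSd]
  unfold ordAt
  ring

theorem ordAt_one (P : Option F) : ordAt P (1 : RatFunc F) = 0 := by
  have := ordAt_algebraMap P (one_ne_zero : (1 : F[X]) ≠ 0)
  rwa [map_one, polyOrd_one] at this

theorem ordAt_C (P : Option F) {a : F} (ha : a ≠ 0) : ordAt P (RatFunc.C a) = 0 := by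
  have := ordAt_algebraMap P (C_ne_zero.2 ha)
  rwa [RatFunc.algebraMap_C, polyOrd_C] at this

theorem ordAt_inv (P : Option F) {R : RatFunc F} (hR : R ≠ 0) : ordAt P R⁻¹ = -ordAt P R := by
  have := ordAt_mul P hR (inv_ne_zero hR)
  rw [mul_inv_cancel₀ hR, ordAt_one] at this
  linarith

theorem ordAt_pow (P : Option F) {R : RatFunc F} (hR : R ≠ 0) (n : ℕ) :
    ordAt P (R ^ n) = n * ordAt P R := by
  induction n with
  | zero => simp [ordAt_one]
  | succ n ih => rw [pow_succ, ordAt_mul P (pow_ne_zero _ hR) hR, ih]; push_cast; ring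

theorem ordAt_zpow (P : Option F) {R : RatFunc F} (hR : R ≠ 0) (n : ℤ) :
    ordAt P (R ^ n) = n * ordAt P R := by
  cases n with
  | ofNat n => simp [ordAt_pow P hR]
  | negSucc n =>
    rw [zpow_negSucc, ordAt_inv P (pow_ne_zero _ hR), ordAt_pow P hR, Int.negSucc_eq]
    push_cast; ring

theorem ordAt_prod (P : Option F) {ι : Type*} (s : Finset ι) (f : ι → RatFunc F)
    (hf : ∀ i ∈ s, f i ≠ 0) : ordAt P (∏ i ∈ s, f i) = ∑ i ∈ s, ordAt P (f i) := by
  classical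
  induction s using Finset.induction_on with
  | empty => simp [ordAt_one]
  | insert a s ha ih =>
    rw [Finset.prod_insert ha, Finset.sum_insert ha, ordAt_mul P (hf _ (by simp))
      (Finset.prod_ne_zero_iff.2 fun i hi => hf i (by simp [hi])),
      ih fun i hi => hf i (by simp [hi])]

theorem ordAt_X_zero : ordAt (some (0 : F)) RatFunc.X = 1 := by
  rw [← RatFunc.algebraMap_X, ordAt_algebraMap _ X_ne_zero]
  have : rootMultiplicity (0 : F) X = 1 := by
    simpa using rootMultiplicity_X_sub_C_self (x := (0 : F))
  simp [polyOrd, this]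

theorem ordAt_X_infty : ordAt (none : Option F) RatFunc.X = -1 := by
  rw [← RatFunc.algebraMap_X, ordAt_algebraMap _ X_ne_zero]
  simp [polyOrd]

theorem ordAt_X_some {x : F} (hx : x ≠ 0) : ordAt (some x) RatFunc.X = 0 := by
  rw [← RatFunc.algebraMap_X, ordAt_algebraMap _ X_ne_zero]
  simp only [polyOrd]
  rw [rootMultiplicity_eq_zero (by simpa using hx)]
  simp

theorem polyOrd_X_sub_C_infty (a : F) : polyOrd none (X - C a) = -1 := by
  simp [polyOrd]

theorem polyOrd_X_sub_C_self (a : F) : polyOrd (some a) (X - C a) = 1 := by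
  simp [polyOrd, rootMultiplicity_X_sub_C_self]

theorem polyOrd_X_sub_C_of_ne {a b : F} (h : b ≠ a) : polyOrd (some b) (X - C a) = 0 := by
  classical
  simp [polyOrd, rootMultiplicity_X_sub_C, h]

end Order

/-! ### The self-map of the projective line and its ramification -/

section Map

open Polynomial

variable {F : Type*} [Field F]

/-- The map of the projective line given by `g / h`. -/
noncomputable def ptMap (g h : F[X]) (P : Option F) : Option F :=
  open Classical in
  match P with
  | some x => if h.eval x = 0 then none else some (g.eval x / h.eval x)
  | none => if h.natDegree < g.natDegree then none
      else some (g.coeff h.natDegree / h.leadingCoeff)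

theorem ptMap_some_of_eq {g h : F[X]} {x : F} (hx : h.eval x = 0) : ptMap g h (some x) = none := by
  simp [ptMap, hx]

theorem ptMap_some_of_ne {g h : F[X]} {x : F} (hx : h.eval x ≠ 0) :
    ptMap g h (some x) = some (g.eval x / h.eval x) := by
  simp [ptMap, hx]

/-- A pair of coprime polynomials, not both constant. -/
structure IsMapPair (g h : F[X]) : Prop where
  coprime : IsCoprime g h
  nonconst : g.natDegree ≠ 0 ∨ h.natDegree ≠ 0

theorem IsMapPair.denom_ne_zero {g h : F[X]} (H : IsMapPair g h) : h ≠ 0 := by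
  rintro rfl
  have hu := isCoprime_zero_right.1 H.coprime
  have := natDegree_eq_zero_of_isUnit hu
  rcases H.nonconst with h | h <;> simp_all

theorem IsMapPair.sub_ne_zero {g h : F[X]} (H : IsMapPair g h) (a : F) : g - C a * h ≠ 0 := by
  intro h0
  have hg : g = C a * h := sub_eq_zero.1 h0
  have hc := H.coprime
  rw [hg] at hc
  have hu : IsUnit h := by
    have : h ∣ C a * h := Dvd.intro_left _ rfl
    exact hc.isUnit_of_dvd' this dvd_rfl
  have h1 := natDegree_eq_zero_of_isUnit hu
  have h2 : g.natDegree = 0 := by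
    rw [hg]
    exact Nat.le_zero.1 ((natDegree_C_mul_le a h).trans h1.le)
  rcases H.nonconst with h | h <;> contradiction

theorem IsMapPair.eval_ne_zero {g h : F[X]} (H : IsMapPair g h) {x : F} (hx : h.eval x = 0) :
    g.eval x ≠ 0 := by
  intro hg
  obtain ⟨a, b, hab⟩ := H.coprime
  have := congrArg (eval x) hab
  simp [hg, hx] at this

/-- The ramification index e at P works for all a simultaneously. At a pole of f = g/h, every f - a
has the same pole order; elsewhere f - a vanishes only for a = f(P), and e is the order of that
zero. -/
theorem IsMapPair.exists_ramification {g h : F[X]} (H : IsMapPair g h) (P : Option F) :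
    ∃ e : ℤ, 0 < e ∧ ∀ a : F,
      polyOrd P (g - C a * h) - polyOrd P h = e * polyOrd (ptMap g h P) (X - C a) := by
  have hh := H.denom_ne_zero
  cases P with
  | some x =>
    by_cases hx : h.eval x = 0
    · refine ⟨h.rootMultiplicity x, ?_, fun a => ?_⟩
      · exact_mod_cast (rootMultiplicity_pos hh).2 hx
      · rw [ptMap_some_of_eq hx, polyOrd_X_sub_C_infty]
        simp only [polyOrd]
        rw [rootMultiplicity_eq_zero]
        · simp
        · simpa [IsRoot, hx] using H.eval_ne_zero hx
    · rw [ptMap_some_of_ne hx]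
      set y := g.eval x / h.eval x with hy
      have hrm : h.rootMultiplicity x = 0 := rootMultiplicity_eq_zero hx
      refine ⟨(g - C y * h).rootMultiplicity x, ?_, fun a => ?_⟩
      · have : (g - C y * h).IsRoot x := by
          simp [IsRoot, hy]
          field_simp
          ring
        exact_mod_cast (rootMultiplicity_pos (H.sub_ne_zero y)).2 this
      · by_cases ha : y = a
        · subst ha
          rw [polyOrd_X_sub_C_self]
          simp [polyOrd, hrm]
        · rw [polyOrd_X_sub_C_of_ne ha]
          simp only [polyOrd]
          rw [rootMultiplicity_eq_zero, hrm]
          · simp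
          · intro hr
            apply ha
            have : g.eval x - a * h.eval x = 0 := by simpa [IsRoot] using hr
            rw [hy, div_eq_iff hx]
            linear_combination this
  | none =>
    by_cases hd : h.natDegree < g.natDegree
    · refine ⟨g.natDegree - h.natDegree, by omega, fun a => ?_⟩
      have : ptMap g h none = none := by simp [ptMap, hd]
      rw [this, polyOrd_X_sub_C_infty]
      simp only [polyOrd]
      rw [natDegree_sub_eq_left_of_natDegree_lt ((natDegree_C_mul_le a h).trans_lt hd)]
      ring
    · set y := g.coeff h.natDegree / h.leadingCoeff with hy
      have hp : ptMap g h none = some y := by simp [ptMap, hd, hy]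
      have hlc : h.leadingCoeff ≠ 0 := leadingCoeff_ne_zero.2 hh
      have hle : ∀ a, (g - C a * h).natDegree ≤ h.natDegree := fun a =>
        (natDegree_sub_le _ _).trans (max_le (not_lt.1 hd) (natDegree_C_mul_le a h))
      have hco : ∀ a, (g - C a * h).coeff h.natDegree = (y - a) * h.leadingCoeff := by
        intro a
        rw [coeff_sub, coeff_C_mul, hy, leadingCoeff]
        rw [leadingCoeff] at hlc
        field_simp
      have hpos : (g - C y * h).natDegree < h.natDegree := by
        refine lt_of_le_of_ne (hle y) fun heq => ?_
        have h0 : (g - C y * h).leadingCoeff = 0 := by rw [leadingCoeff, heq, hco]; ring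
        exact H.sub_ne_zero y (leadingCoeff_eq_zero.1 h0)
      refine ⟨h.natDegree - (g - C y * h).natDegree, by omega, fun a => ?_⟩
      rw [hp]
      by_cases ha : y = a
      · subst ha
        rw [polyOrd_X_sub_C_self]
        simp only [polyOrd]
        ring
      · rw [polyOrd_X_sub_C_of_ne ha]
        simp only [polyOrd]
        have : (g - C a * h).natDegree = h.natDegree := by
          refine le_antisymm (hle a) (le_natDegree_of_ne_zero ?_)
          rw [hco]
          exact mul_ne_zero (_root_.sub_ne_zero.2 ha) hlc
        rw [this]
        ring

/-- The fibre over a is the zero set of g - a h, and that over ∞ the zero set of h. If such a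
polynomial is constant it has no zeros, and then the point ∞ maps to the required value. -/
theorem IsMapPair.ptMap_surjective [IsAlgClosed F] {g h : F[X]} (H : IsMapPair g h) :
    Function.Surjective (ptMap g h) := by
  have hh := H.denom_ne_zero
  intro y
  cases y with
  | none =>
    by_cases hd : h.natDegree = 0
    · refine ⟨none, ?_⟩
      have : h.natDegree < g.natDegree := by have := H.nonconst; omega
      simp [ptMap, this]
    · obtain ⟨x, hx⟩ := IsAlgClosed.exists_root h (fun h0 => hd (natDegree_eq_zero_iff_degree_le_zero.2 h0.le))
      exact ⟨some x, ptMap_some_of_eq hx⟩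
  | some a =>
    by_cases hd : (g - C a * h).natDegree = 0
    · refine ⟨none, ?_⟩
      obtain ⟨c, hc⟩ := natDegree_eq_zero.1 hd
      have hg : g = C c + C a * h := by rw [hc]; ring
      have hgd : g.natDegree ≤ h.natDegree := by
        rw [hg]
        exact (natDegree_add_le _ _).trans (max_le (by simp) (natDegree_C_mul_le a h))
      have hhd : h.natDegree ≠ 0 := by have := H.nonconst; omega
      have hlc : h.leadingCoeff ≠ 0 := leadingCoeff_ne_zero.2 hh
      have : g.coeff h.natDegree = a * h.leadingCoeff := by
        rw [hg, coeff_add, coeff_C_mul, coeff_C_of_ne_zero hhd, zero_add, leadingCoeff]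
      simp [ptMap, not_lt.2 hgd, this, hlc]
    · obtain ⟨x, hx⟩ := IsAlgClosed.exists_root (g - C a * h)
        (fun h0 => hd (natDegree_eq_zero_iff_degree_le_zero.2 h0.le))
      have hx' : g.eval x = a * h.eval x := by
        have : g.eval x - a * h.eval x = 0 := by simpa [IsRoot] using hx
        linear_combination this
      have hne : h.eval x ≠ 0 := fun h0 => H.eval_ne_zero h0 (by rw [hx', h0, mul_zero])
      refine ⟨some x, ?_⟩
      rw [ptMap_some_of_ne hne, hx', mul_div_cancel_right₀ _ hne]

/-- The rational function `g / h`. -/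
noncomputable def quot (g h : F[X]) : RatFunc F :=
  algebraMap F[X] (RatFunc F) g / algebraMap F[X] (RatFunc F) h

theorem IsMapPair.quot_sub {g h : F[X]} (H : IsMapPair g h) (a : F) :
    quot g h - RatFunc.C a =
      algebraMap F[X] (RatFunc F) (g - C a * h) / algebraMap F[X] (RatFunc F) h := by
  have := RatFunc.algebraMap_ne_zero (K := F) H.denom_ne_zero
  rw [quot, map_sub, map_mul, RatFunc.algebraMap_C]
  field_simp

theorem IsMapPair.quot_sub_ne_zero {g h : F[X]} (H : IsMapPair g h) (a : F) :
    quot g h - RatFunc.C a ≠ 0 := by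
  rw [H.quot_sub]
  exact div_ne_zero (RatFunc.algebraMap_ne_zero (H.sub_ne_zero a))
    (RatFunc.algebraMap_ne_zero H.denom_ne_zero)

theorem IsMapPair.aeval_quot_ne_zero [IsAlgClosed F] {g h : F[X]} (H : IsMapPair g h) {p : F[X]}
    (hp : p ≠ 0) : aeval (quot g h) p ≠ 0 := by
  have hs := (IsAlgClosed.splits p).eq_prod_roots
  rw [hs, map_mul, aeval_C]
  refine mul_ne_zero ?_ ?_
  · simpa using hp
  · rw [map_multiset_prod]
    intro h0
    rw [Multiset.prod_eq_zero_iff] at h0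
    simp only [Multiset.map_map, Multiset.mem_map, Function.comp_apply] at h0
    obtain ⟨a, -, ha⟩ := h0
    apply H.quot_sub_ne_zero a
    simpa [RatFunc.algebraMap_eq_C] using ha

/-- Composition with `g / h` on the right, as an endomorphism of the field of rational
functions. -/
noncomputable def compHom [IsAlgClosed F] {g h : F[X]} (H : IsMapPair g h) :
    RatFunc F →ₐ[F] RatFunc F :=
  RatFunc.liftAlgHom (aeval (quot g h)) (fun p hp => by
    rw [Submonoid.mem_comap]
    exact mem_nonZeroDivisors_of_ne_zero (H.aeval_quot_ne_zero (nonZeroDivisors.ne_zero hp)))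

theorem compHom_algebraMap [IsAlgClosed F] {g h : F[X]} (H : IsMapPair g h) (p : F[X]) :
    compHom H (algebraMap F[X] (RatFunc F) p) = aeval (quot g h) p := by
  have := RatFunc.liftAlgHom_apply_div' (L := RatFunc F) (aeval (quot g h)) (fun p hp => by
    rw [Submonoid.mem_comap]
    exact mem_nonZeroDivisors_of_ne_zero (H.aeval_quot_ne_zero (nonZeroDivisors.ne_zero hp))) p 1
  rw [map_one, map_one, map_one, div_one, div_one] at this
  exact this

/-- Both sides are additive over products in R, and over an algebraically closed field R is built
from constants and factors X - a, which are covered by `exists_ramification`. -/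
theorem IsMapPair.exists_ordAt_compHom [IsAlgClosed F] {g h : F[X]} (H : IsMapPair g h)
    (P : Option F) : ∃ e : ℤ, 0 < e ∧ ∀ R : RatFunc F, R ≠ 0 →
      ordAt P (compHom H R) = e * ordAt (ptMap g h P) R := by
  obtain ⟨e, he, hlin⟩ := H.exists_ramification P
  refine ⟨e, he, ?_⟩
  have hfac : ∀ a, ordAt P (quot g h - RatFunc.C a) = e * polyOrd (ptMap g h P) (X - C a) := by
    intro a
    rw [H.quot_sub, ordAt_div P (H.sub_ne_zero a) H.denom_ne_zero, hlin]
  have hprod : ∀ s : Multiset F,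
      (s.map fun a => (X - C a : F[X])).prod ≠ 0 ∧
      ordAt P (aeval (quot g h) (s.map fun a => (X - C a : F[X])).prod) =
        e * polyOrd (ptMap g h P) (s.map fun a => (X - C a : F[X])).prod := by
    intro s
    induction s using Multiset.induction_on with
    | empty => simp [ordAt_one, polyOrd_one]
    | cons a s ih =>
      rw [Multiset.map_cons, Multiset.prod_cons, map_mul,
        polyOrd_mul _ (X_sub_C_ne_zero a) ih.1]
      refine ⟨mul_ne_zero (X_sub_C_ne_zero a) ih.1, ?_⟩
      have hlinear : aeval (quot g h) (X - C a : F[X]) = quot g h - RatFunc.C a := by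
        simp [RatFunc.algebraMap_eq_C]
      rw [ordAt_mul P (H.aeval_quot_ne_zero (X_sub_C_ne_zero a)) (H.aeval_quot_ne_zero ih.1), ih.2,
        hlinear, hfac]
      ring
  have hpoly : ∀ p : F[X], p ≠ 0 →
      ordAt P (compHom H (algebraMap F[X] (RatFunc F) p)) = e * polyOrd (ptMap g h P) p := by
    intro p hp
    rw [compHom_algebraMap]
    have hs := (IsAlgClosed.splits p).eq_prod_roots
    have hlc : p.leadingCoeff ≠ 0 := leadingCoeff_ne_zero.2 hp
    obtain ⟨h1, h2⟩ := hprod p.roots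
    rw [hs, map_mul, ordAt_mul P (H.aeval_quot_ne_zero (C_ne_zero.2 hlc)) (H.aeval_quot_ne_zero h1),
      h2, polyOrd_mul _ (C_ne_zero.2 hlc) h1, polyOrd_C, aeval_C, RatFunc.algebraMap_eq_C,
      ordAt_C P hlc]
    ring
  intro R hR
  have hn := RatFunc.num_ne_zero hR
  have hd := RatFunc.denom_ne_zero R
  have hR' : compHom H R = compHom H (algebraMap F[X] (RatFunc F) R.num) *
      (compHom H (algebraMap F[X] (RatFunc F) R.denom))⁻¹ := by
    rw [← map_inv₀, ← map_mul, ← div_eq_mul_inv, RatFunc.num_div_denom]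
  have hne : ∀ p : F[X], p ≠ 0 → compHom H (algebraMap F[X] (RatFunc F) p) ≠ 0 := fun p hp => by
    rw [compHom_algebraMap]; exact H.aeval_quot_ne_zero hp
  rw [hR', ordAt_mul P (hne _ hn) (inv_ne_zero (hne _ hd)), ordAt_inv P (hne _ hd), hpoly _ hn,
    hpoly _ hd, ordAt]
  ring

end Map

/-! ### Multiplicative relations between iterates -/

section Relation

open Polynomial

variable {F : Type*} [Field F] [IsAlgClosed F]

/-- The `i`-th iterate of `g / h` as a rational function. -/
noncomputable def iter {g h : F[X]} (H : IsMapPair g h) (i : ℕ) : RatFunc F :=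
  (compHom H)^[i] RatFunc.X

theorem iter_succ {g h : F[X]} (H : IsMapPair g h) (i : ℕ) :
    iter H (i + 1) = compHom H (iter H i) := Function.iterate_succ_apply' _ _ _

theorem iter_ne_zero {g h : F[X]} (H : IsMapPair g h) (i : ℕ) : iter H i ≠ 0 := by
  induction i with
  | zero => exact RatFunc.X_ne_zero
  | succ i ih =>
    rw [iter_succ]
    exact (_root_.map_ne_zero _).2 ih

/-- The order of vanishing of the product of the iterates with exponents `c m, c (m + 1), …`. -/
noncomputable def relOrd {g h : F[X]} (H : IsMapPair g h) (c : ℕ → ℤ) (M m : ℕ) (P : Option F) : ℤ :=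
  ∑ i ∈ Finset.range M, c (i + m) * ordAt P (iter H i)

/-- Every iterate other than X is a previous one composed with f, so the tail of the sum at P is e
times a shifted sum at f(P). Because `c` vanishes from `M` on, the range may be lengthened at no
cost. -/
theorem relOrd_eq {g h : F[X]} (H : IsMapPair g h) {c : ℕ → ℤ} {M : ℕ} (hc : ∀ i, M ≤ i → c i = 0)
    (m : ℕ) (P : Option F) {e : ℤ}
    (he : ∀ R : RatFunc F, R ≠ 0 → ordAt P (compHom H R) = e * ordAt (ptMap g h P) R) :
    relOrd H c M m P = c m * ordAt P RatFunc.X + e * relOrd H c M (m + 1) (ptMap g h P) := by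
  unfold relOrd
  have h1 : ∑ i ∈ Finset.range M, c (i + m) * ordAt P (iter H i) =
      ∑ i ∈ Finset.range (M + 1), c (i + m) * ordAt P (iter H i) := by
    rw [Finset.sum_range_succ, hc (M + m) (by omega)]
    ring
  rw [h1, Finset.sum_range_succ', zero_add, Finset.mul_sum, add_comm]
  congr 1
  refine Finset.sum_congr rfl fun i _ => ?_
  rw [iter_succ, he _ (iter_ne_zero H i), add_right_comm, add_assoc i m 1]
  ring

theorem relOrd_zero_of_prod_eq_one {g h : F[X]} (H : IsMapPair g h) {c : ℕ → ℤ} {M : ℕ}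
    (hrel : ∏ i ∈ Finset.range M, iter H i ^ c i = 1) (P : Option F) : relOrd H c M 0 P = 0 := by
  have := congrArg (ordAt P) hrel
  rw [ordAt_one, ordAt_prod P _ _ fun i _ => zpow_ne_zero _ (iter_ne_zero H i)] at this
  unfold relOrd
  rw [← this]
  exact Finset.sum_congr rfl fun i _ => (ordAt_zpow P (iter_ne_zero H i) _).symm

/-- Initial zero exponents can be stripped: the remaining product is a function composed with f, and
since f is surjective and e ≠ 0, the function itself has order zero everywhere. -/
theorem exists_relOrd_eq_zero {g h : F[X]} (H : IsMapPair g h) {c : ℕ → ℤ} {M : ℕ}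
    (hc : ∀ i, M ≤ i → c i = 0) (hne : ∃ i, c i ≠ 0)
    (hrel : ∏ i ∈ Finset.range M, iter H i ^ c i = 1) :
    ∃ m, c m ≠ 0 ∧ ∀ P, relOrd H c M m P = 0 := by
  classical
  refine ⟨Nat.find hne, Nat.find_spec hne, ?_⟩
  have : ∀ m ≤ Nat.find hne, ∀ P, relOrd H c M m P = 0 := by
    intro m
    induction m with
    | zero => exact fun _ P => relOrd_zero_of_prod_eq_one H hrel P
    | succ m ih =>
      intro hm P
      obtain ⟨Q, rfl⟩ := H.ptMap_surjective P
      obtain ⟨e, he, heq⟩ := H.exists_ordAt_compHom Q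
      have h1 := relOrd_eq H hc m Q heq
      have h2 : c m = 0 := by
        by_contra h3
        exact Nat.find_min hne (show m < Nat.find hne by omega) h3
      rw [ih (by omega) Q, h2, zero_mul, zero_add] at h1
      exact (mul_eq_zero.1 h1.symm).resolve_left he.ne'
  exact this _ le_rfl

/-- What a multiplicative relation between the iterates says about the map at the points `0`
and `∞`. -/
theorem exists_sign_function {g h : F[X]} (H : IsMapPair g h) {c : ℕ → ℤ} {M : ℕ}
    (hc : ∀ i, M ≤ i → c i = 0) (hne : ∃ i, c i ≠ 0)
    (hrel : ∏ i ∈ Finset.range M, iter H i ^ c i = 1) :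
    ∃ m, relOrd H c M (m + 1) (ptMap g h (some 0)) * relOrd H c M (m + 1) (ptMap g h none) < 0 ∧
      ∀ P, P ≠ some 0 → P ≠ none → relOrd H c M (m + 1) (ptMap g h P) = 0 := by
  obtain ⟨m, hm, h0⟩ := exists_relOrd_eq_zero H hc hne hrel
  refine ⟨m, ?_, fun P hP hP' => ?_⟩
  · obtain ⟨e, he, heq⟩ := H.exists_ordAt_compHom (some 0)
    obtain ⟨e', he', heq'⟩ := H.exists_ordAt_compHom none
    have h1 := relOrd_eq H hc m _ heq
    have h2 := relOrd_eq H hc m _ heq'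
    rw [h0, ordAt_X_zero] at h1
    rw [h0, ordAt_X_infty] at h2
    set x := relOrd H c M (m + 1) (ptMap g h (some 0))
    set y := relOrd H c M (m + 1) (ptMap g h none)
    -- X has order 1 at 0 and -1 at ∞, so the two contributions must cancel c_m and -c_m and hence
    -- have opposite signs.
    have h3 : (e * x) * (e' * y) < 0 := by
      have a : e * x = -c m := by linarith
      have b : e' * y = c m := by linarith
      rw [a, b]
      have := mul_self_pos.2 hm
      linarith
    have h4 : 0 < e * e' := mul_pos he he'
    by_contra hcon
    have := mul_nonneg h4.le (not_lt.1 hcon)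
    linarith
  · obtain ⟨e, he, heq⟩ := H.exists_ordAt_compHom P
    have h1 := relOrd_eq H hc m _ heq
    have hX : ordAt P RatFunc.X = 0 := by
      cases P with
      | none => exact absurd rfl hP'
      | some x => exact ordAt_X_some (by rintro rfl; exact hP rfl)
    rw [h0, hX, mul_zero, zero_add] at h1
    exact (mul_eq_zero.1 h1.symm).resolve_left he.ne'

theorem eq_C_mul_X_pow_of_roots {p : F[X]} (hp : ∀ x, p.eval x = 0 → x = 0) :
    p = C p.leadingCoeff * X ^ p.natDegree := by
  have hs := (IsAlgClosed.splits p).eq_prod_roots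
  have hcard := (IsAlgClosed.splits p).natDegree_eq_card_roots
  by_cases h0 : p = 0
  · simp [h0]
  have hr : p.roots = Multiset.replicate p.natDegree 0 := by
    rw [Multiset.eq_replicate]
    refine ⟨hcard.symm, fun b hb => hp b ?_⟩
    exact (mem_roots h0).1 hb
  conv_lhs => rw [hs, hr]
  simp

/-- `g` and `h` are binomials in `X ^ D`. -/
def IsSpan (g h : F[X]) (D : ℕ) : Prop :=
  ∃ a b c e : F, g = C a + C b * X ^ D ∧ h = C c + C e * X ^ D

/-- The polynomial cutting out the fibre over f(0) vanishes only at 0, so it is u X^D; the one for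
the fibre over f(∞) has no zeros, so it is a constant v. As f(0) ≠ f(∞), g and h are combinations of
these two. -/
theorem exists_isSpan {g h : F[X]} (H : IsMapPair g h)
    (h1 : ∀ P, ptMap g h P = ptMap g h (some 0) → P = some 0)
    (h2 : ∀ P, ptMap g h P = ptMap g h none → P = none) :
    ∃ D, IsSpan g h D := by
  have key : ∀ y : Option F, ∃ p : F[X],
      (y = none ∧ p = h ∨ ∃ a, y = some a ∧ p = g - C a * h) ∧
      ∀ x, p.eval x = 0 → ptMap g h (some x) = y := by
    intro y
    cases y with
    | none => exact ⟨h, Or.inl ⟨rfl, rfl⟩, fun x hx => ptMap_some_of_eq hx⟩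
    | some a =>
      refine ⟨g - C a * h, Or.inr ⟨a, rfl, rfl⟩, fun x hx => ?_⟩
      have hx' : g.eval x = a * h.eval x := by
        have : g.eval x - a * h.eval x = 0 := by simpa [IsRoot] using hx
        linear_combination this
      have hne : h.eval x ≠ 0 := fun h0 => H.eval_ne_zero h0 (by rw [hx', h0, mul_zero])
      rw [ptMap_some_of_ne hne, hx', mul_div_cancel_right₀ _ hne]
  have hdist : ptMap g h (some 0) ≠ ptMap g h none := fun heq => by
    have := h2 _ heq
    simp at this
  obtain ⟨p, hp, hpr⟩ := key (ptMap g h (some 0))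
  obtain ⟨r, hr, hrr⟩ := key (ptMap g h none)
  have hpX := eq_C_mul_X_pow_of_roots (p := p) fun x hx => by
    have := h1 _ (hpr x hx)
    simpa using this
  have hrC : r = C (r.coeff 0) := by
    refine eq_C_of_natDegree_eq_zero ?_
    by_contra hd
    obtain ⟨x, hx⟩ := IsAlgClosed.exists_root r
      (fun h0 => hd (natDegree_eq_zero_iff_degree_le_zero.2 h0.le))
    have := h2 _ (hrr x hx)
    simp at this
  generalize p.leadingCoeff = u at hpX
  generalize p.natDegree = D at hpX
  generalize r.coeff 0 = v at hrC
  refine ⟨D, ?_⟩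
  rcases hp with ⟨hy, rfl⟩ | ⟨a, hy, rfl⟩ <;> rcases hr with ⟨hy', rfl⟩ | ⟨a', hy', rfl⟩
  · exact absurd (hy.trans hy'.symm) hdist
  · refine ⟨v, a' * u, 0, u, ?_, by rw [hpX]; simp⟩
    rw [C_mul, mul_assoc, ← hpX, ← hrC]; ring
  · refine ⟨a * v, u, v, 0, ?_, by rw [hrC]; simp⟩
    rw [C_mul, ← hpX, ← hrC]; ring
  · have haa : a' - a ≠ 0 := by
      intro h0
      apply hdist
      rw [hy, hy', sub_eq_zero.1 h0]
    have e1 : C (a' - a) * h = C u * X ^ D - C v := by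
      rw [← hpX, ← hrC, C_sub]; ring
    have e2 : h = C ((a' - a)⁻¹) * (C u * X ^ D - C v) := by
      rw [← e1, ← mul_assoc, ← C_mul, inv_mul_cancel₀ haa, C_1, one_mul]
    have e3 : g = C u * X ^ D + C a * h := by rw [← hpX]; ring
    refine ⟨-a * ((a' - a)⁻¹ * v), u + a * ((a' - a)⁻¹ * u), -((a' - a)⁻¹ * v), (a' - a)⁻¹ * u, ?_, ?_⟩
    · rw [e3, e2]; simp only [C_mul, C_add, C_neg]; ring
    · rw [e2]; simp only [C_mul, C_neg]; ring

/-- A multiplicative relation between the iterates of `g / h` forces `g / h` to be a Möbius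
transformation of `X ^ D`; if `D` is not a power of the characteristic, `g / h` permutes `0`
and `∞`; and in any case some iterate maps `0` to `0` or `∞`. -/
theorem of_relation {g h : F[X]} (H : IsMapPair g h) {c : ℕ → ℤ} {M : ℕ}
    (hc : ∀ i, M ≤ i → c i = 0) (hne : ∃ i, c i ≠ 0)
    (hrel : ∏ i ∈ Finset.range M, iter H i ^ c i = 1) :
    ∃ D, IsSpan g h D ∧
      ((∃ ζ : F, ζ ≠ 1 ∧ ζ ^ D = 1) →
        (ptMap g h (some 0) = some 0 ∧ ptMap g h none = none) ∨
        (ptMap g h (some 0) = none ∧ ptMap g h none = some 0)) ∧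
      ∃ r, 1 ≤ r ∧ r < M ∧ ordAt (some 0) (iter H r) ≠ 0 := by
  obtain ⟨m, hneg, hzero⟩ := exists_sign_function H hc hne hrel
  set φ := ptMap g h with hφ
  set b := relOrd H c M (m + 1) with hb
  have hdist : φ (some 0) ≠ φ none := by
    intro heq
    rw [heq] at hneg
    exact absurd hneg (not_lt.2 (mul_self_nonneg _))
  have hb0 : b (φ (some 0)) ≠ 0 := fun h0 => by rw [h0, zero_mul] at hneg; exact lt_irrefl _ hneg
  have hb1 : b (φ none) ≠ 0 := fun h0 => by rw [h0, mul_zero] at hneg; exact lt_irrefl _ hneg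
  -- The function `b` is zero at the image of every point other than 0 and ∞, but not at f(0) or
  -- f(∞). So the fibres over these two values contain nothing else.
  have hf0 : ∀ P, φ P = φ (some 0) → P = some 0 := by
    intro P hP
    by_contra hP0
    by_cases hPn : P = none
    · rw [hPn] at hP; exact hdist hP.symm
    · exact hb0 (hP ▸ hzero P hP0 hPn)
  have hf1 : ∀ P, φ P = φ none → P = none := by
    intro P hP
    by_contra hPn
    by_cases hP0 : P = some 0
    · rw [hP0] at hP; exact hdist hP
    · exact hb1 (hP ▸ hzero P hP0 hPn)
  obtain ⟨D, hD⟩ := exists_isSpan H hf0 hf1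
  refine ⟨D, hD, ?_, ?_⟩
  · rintro ⟨ζ, hζ1, hζD⟩
    have hsupp : ∀ y, b y ≠ 0 → y = φ (some 0) ∨ y = φ none := by
      intro y hy
      obtain ⟨P, rfl⟩ := H.ptMap_surjective y
      by_contra hcon
      push Not at hcon
      refine hy (hzero P ?_ ?_)
      · rintro rfl; exact hcon.1 rfl
      · rintro rfl; exact hcon.2 rfl
    have hinv : ∀ x : F, φ (some (ζ * x)) = φ (some x) := by
      obtain ⟨a, b', c', e, rfl, rfl⟩ := hD
      intro x
      have e1 : ∀ u v : F, (C u + C v * X ^ D).eval (ζ * x) = (C u + C v * X ^ D).eval x := by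
        intro u v
        simp [mul_pow, hζD]
      by_cases hz : (C c' + C e * X ^ D).eval x = 0
      · rw [hφ, ptMap_some_of_eq hz, ptMap_some_of_eq ((e1 _ _).trans hz)]
      · rw [hφ, ptMap_some_of_ne hz, ptMap_some_of_ne (by rwa [e1]), e1, e1]
    -- As f(ζx) = f(x), `b` has the same sign at x and ζx. If f(0) were some x ≠ 0, then ζx ≠ x
    -- would also be in the support {f(0), f(∞)}, so f(∞) = ζx would carry the same sign as f(0).
    -- The argument for f(∞) is symmetric.
    have hsame : ∀ x : F, x ≠ 0 → 0 ≤ b (some x) * b (some (ζ * x)) ∧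
        (b (some x) ≠ 0 → b (some (ζ * x)) ≠ 0) := by
      intro x hx
      have hζ0 : ζ ≠ 0 := by
        rintro rfl
        have hD0 : D = 0 := by
          by_contra h0
          rw [zero_pow h0] at hζD
          exact zero_ne_one hζD
        obtain ⟨a, b', c', e, hg, hh⟩ := hD
        have := H.nonconst
        rw [hg, hh, hD0] at this
        simp only [pow_zero, mul_one, ← C_add, natDegree_C] at this
        simp at this
      obtain ⟨e, he, heq⟩ := H.exists_ordAt_compHom (some x)
      obtain ⟨e', he', heq'⟩ := H.exists_ordAt_compHom (some (ζ * x))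
      have h1 := relOrd_eq H hc (m + 1) _ heq
      have h2 := relOrd_eq H hc (m + 1) _ heq'
      rw [ordAt_X_some hx, mul_zero, zero_add] at h1
      rw [ordAt_X_some (mul_ne_zero hζ0 hx), mul_zero, zero_add] at h2
      rw [← hφ] at h1 h2
      rw [hinv] at h2
      rw [← hb] at h1 h2
      rw [h1, h2]
      set y := relOrd H c M (m + 1 + 1) (φ (some x))
      constructor
      · have : 0 ≤ (e * e') * (y * y) := mul_nonneg (mul_pos he he').le (mul_self_nonneg y)
        linarith
      · intro hy
        exact mul_ne_zero he'.ne' (right_ne_zero_of_mul hy)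
    have hζne : ∀ x : F, x ≠ 0 → some (ζ * x) ≠ some x := by
      intro x hx heq
      apply hζ1
      have : ζ * x = 1 * x := by rw [one_mul]; exact Option.some_injective _ heq
      exact mul_right_cancel₀ hx this
    have hA : ∀ x : F, x ≠ 0 → φ (some 0) ≠ some x := by
      intro x hx heq
      obtain ⟨s1, s2⟩ := hsame x hx
      rw [heq] at hneg hb0
      rcases hsupp _ (s2 hb0) with h' | h'
      · exact hζne x hx (h'.trans heq)
      · rw [h'] at s1
        exact absurd hneg (not_lt.2 s1)
    have hB : ∀ x : F, x ≠ 0 → φ none ≠ some x := by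
      intro x hx heq
      obtain ⟨s1, s2⟩ := hsame x hx
      rw [heq] at hneg hb1
      rcases hsupp _ (s2 hb1) with h' | h'
      · rw [h', mul_comm] at s1
        exact absurd hneg (not_lt.2 s1)
      · exact hζne x hx (h'.trans heq)
    rcases hp0 : φ (some 0) with _ | x
    · right
      refine ⟨rfl, ?_⟩
      rcases hp1 : φ none with _ | y
      · exact absurd (hp0.trans hp1.symm) hdist
      · by_cases hy : y = 0
        · rw [hy]
        · exact absurd hp1 (hB y hy)
    · left
      have hx : x = 0 := by
        by_contra hx
        exact hA x hx hp0
      refine ⟨by rw [hx], ?_⟩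
      rcases hp1 : φ none with _ | y
      · rfl
      · by_cases hy : y = 0
        · exact absurd (by rw [hp0, hp1, hx, hy]) hdist
        · exact absurd hp1 (hB y hy)
  -- Since `b` is nonzero at f(0), some f_i with nonzero exponent c (i + m + 1) has nonzero order
  -- there; then f_(i+1) has nonzero order at 0, and i + 1 < M because c vanishes from M on.
  · obtain ⟨i, hi, hne0⟩ := Finset.exists_ne_zero_of_sum_ne_zero
      (show ∑ i ∈ Finset.range M, c (i + (m + 1)) * ordAt (φ (some 0)) (iter H i) ≠ 0 from hb0)
    obtain ⟨e, he, heq⟩ := H.exists_ordAt_compHom (some 0)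
    refine ⟨i + 1, by omega, ?_, ?_⟩
    · by_contra hcon
      exact left_ne_zero_of_mul hne0 (hc _ (by omega))
    · rw [iter_succ, heq _ (iter_ne_zero H i)]
      exact mul_ne_zero he.ne' (right_ne_zero_of_mul hne0)

end Relation

/-! ### Values of the iterates at α -/

section Evaluation

open Polynomial

variable {K : Type*} [Field K]

theorem div_zpow_eq {E : Type*} [Field E] (a b : E) (c : ℤ) :
    (a / b) ^ c = (a ^ c.toNat * b ^ (-c).toNat) / (a ^ (-c).toNat * b ^ c.toNat) := by
  rcases le_total 0 c with hc | hc
  · obtain ⟨n, rfl⟩ := Int.eq_ofNat_of_zero_le hc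
    simp [div_pow]
  · obtain ⟨n, hn⟩ := Int.eq_ofNat_of_zero_le (Int.neg_nonneg.2 hc)
    obtain rfl : c = -(n : ℤ) := by omega
    simp [inv_div, div_pow]

/-- Sorting the factors by the sign of their exponents turns the relation into an equality of two
polynomial values. -/
theorem prod_div_zpow_eq_one_iff {E : Type*} [Field E] (φ : K[X] →+* E) (P Q : ℕ → K[X]) (i : ℕ)
    (hP : ∀ l ≤ i, φ (P l) ≠ 0) (hQ : ∀ l ≤ i, φ (Q l) ≠ 0) (c : ℕ → ℤ) :
    ∏ l ∈ Finset.range (i + 1), (φ (P l) / φ (Q l)) ^ c l = 1 ↔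
      φ (∏ l ∈ Finset.range (i + 1), (P l ^ (c l).toNat * Q l ^ (-c l).toNat)) =
      φ (∏ l ∈ Finset.range (i + 1), (P l ^ (-c l).toNat * Q l ^ (c l).toNat)) := by
  have h1 : ∏ l ∈ Finset.range (i + 1), (φ (P l) / φ (Q l)) ^ c l =
      φ (∏ l ∈ Finset.range (i + 1), (P l ^ (c l).toNat * Q l ^ (-c l).toNat)) /
      φ (∏ l ∈ Finset.range (i + 1), (P l ^ (-c l).toNat * Q l ^ (c l).toNat)) := by
    rw [map_prod, map_prod, ← Finset.prod_div_distrib]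
    refine Finset.prod_congr rfl fun l _ => ?_
    rw [div_zpow_eq]
    simp
  rw [h1, div_eq_one_iff_eq]
  rw [map_prod, Finset.prod_ne_zero_iff]
  intro l hl
  have hl' : l ≤ i := by have := Finset.mem_range.1 hl; omega
  rw [map_mul, map_pow, map_pow]
  exact mul_ne_zero (pow_ne_zero _ (hP l hl')) (pow_ne_zero _ (hQ l hl'))

theorem natDegree_prod_le_weight (P Q : ℕ → K[X]) (w : ℕ → ℕ) (i : ℕ)
    (hP : ∀ l ≤ i, (P l).natDegree ≤ w l) (hQ : ∀ l ≤ i, (Q l).natDegree ≤ w l) (c : ℕ → ℤ) :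
    ((∏ l ∈ Finset.range (i + 1), (P l ^ (c l).toNat * Q l ^ (-c l).toNat)).natDegree : ℤ) ≤
      weight w i c := by
  have h1 : (∏ l ∈ Finset.range (i + 1), (P l ^ (c l).toNat * Q l ^ (-c l).toNat)).natDegree ≤
      ∑ l ∈ Finset.range (i + 1), ((c l).toNat * w l + (-c l).toNat * w l) := by
    refine (natDegree_prod_le _ _).trans (Finset.sum_le_sum fun l hl => ?_)
    have hl' : l ≤ i := by have := Finset.mem_range.1 hl; omega
    refine natDegree_mul_le.trans (add_le_add ?_ ?_)
    · exact natDegree_pow_le.trans (Nat.mul_le_mul_left _ (hP l hl'))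
    · exact natDegree_pow_le.trans (Nat.mul_le_mul_left _ (hQ l hl'))
  refine (Int.ofNat_le.2 h1).trans (le_of_eq ?_)
  unfold weight
  rw [Nat.cast_sum]
  refine Finset.sum_congr rfl fun l _ => ?_
  have : ((c l).toNat : ℤ) + ((-c l).toNat : ℤ) = |c l| := by
    rcases le_total 0 (c l) with h | h
    · rw [abs_of_nonneg h]; omega
    · rw [abs_of_nonpos h]; omega
  rw [← this]
  push_cast
  ring

/-- A multiplicative relation of small weight between values at `α` of rational functions comes
from a relation between the functions. -/
theorem relation_of_aeval {L E : Type*} [Field L] [Algebra K L] [Field E] (α : L)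
    (φ : K[X] →+* E) (P Q : ℕ → K[X]) (w : ℕ → ℕ) (i : ℕ)
    (hP : ∀ l ≤ i, (P l).natDegree ≤ w l) (hQ : ∀ l ≤ i, (Q l).natDegree ≤ w l)
    (hP1 : ∀ l ≤ i, φ (P l) ≠ 0) (hQ1 : ∀ l ≤ i, φ (Q l) ≠ 0)
    (hP2 : ∀ l ≤ i, aeval α (P l) ≠ 0) (hQ2 : ∀ l ≤ i, aeval α (Q l) ≠ 0) (c : ℕ → ℤ)
    (hw : weight w i c < (minpoly K α).natDegree)
    (hrel : ∏ l ∈ Finset.range (i + 1), (aeval α (P l) / aeval α (Q l)) ^ c l = 1) :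
    ∏ l ∈ Finset.range (i + 1), (φ (P l) / φ (Q l)) ^ c l = 1 := by
  rw [prod_div_zpow_eq_one_iff φ P Q i hP1 hQ1]
  have h := (prod_div_zpow_eq_one_iff (aeval α : K[X] →ₐ[K] L).toRingHom P Q i hP2 hQ2 c).1 hrel
  set A := ∏ l ∈ Finset.range (i + 1), (P l ^ (c l).toNat * Q l ^ (-c l).toNat)
  set B := ∏ l ∈ Finset.range (i + 1), (P l ^ (-c l).toNat * Q l ^ (c l).toNat) with hB
  have hdA : (A.natDegree : ℤ) ≤ weight w i c := natDegree_prod_le_weight P Q w i hP hQ c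
  have hdB : (B.natDegree : ℤ) ≤ weight w i c := by
    have := natDegree_prod_le_weight Q P w i hQ hP c
    simp only [mul_comm (Q _ ^ _)] at this
    exact this
  -- A - B vanishes at α and has degree below that of the minimal polynomial.
  have hAB : A = B := by
    by_contra hne
    have hd : minpoly K α ∣ A - B := minpoly.dvd K α (by
      rw [map_sub]
      exact sub_eq_zero.2 h)
    have h1 := natDegree_le_of_dvd hd (sub_ne_zero.2 hne)
    have h2 := natDegree_sub_le A B
    omega
  rw [hAB]

/-- The homogenization of degree `D` of `P`, evaluated at `(g, h)`. -/
noncomputable def homog (D : ℕ) (g h P : K[X]) : K[X] :=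
  ∑ j ∈ Finset.range (D + 1), C (P.coeff j) * g ^ j * h ^ (D - j)

theorem map_homog {E : Type*} [Field E] [Algebra K E] (φ : K[X] →ₐ[K] E) {D : ℕ} {g h P : K[X]}
    (hP : P.natDegree ≤ D) (hh : φ h ≠ 0) :
    φ (homog D g h P) = φ h ^ D * aeval (φ g / φ h) P := by
  rw [homog, map_sum, aeval_eq_sum_range' (Nat.lt_succ_of_le hP), Finset.mul_sum]
  refine Finset.sum_congr rfl fun j hj => ?_
  have hj' : j ≤ D := by have := Finset.mem_range.1 hj; omega
  rw [map_mul, map_mul, map_pow, map_pow, ← algebraMap_eq, AlgHom.commutes, Algebra.smul_def,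
    div_pow, ← Nat.sub_add_cancel hj', pow_add]
  simp only [Nat.add_sub_cancel]
  field_simp

theorem natDegree_homog_le {D d : ℕ} {g h : K[X]} (P : K[X]) (hg : g.natDegree ≤ d)
    (hh : h.natDegree ≤ d) : (homog D g h P).natDegree ≤ d * D := by
  refine natDegree_sum_le_of_forall_le _ _ fun j hj => ?_
  have hj' : j ≤ D := by have := Finset.mem_range.1 hj; omega
  calc _ ≤ (C (P.coeff j) * g ^ j).natDegree + (h ^ (D - j)).natDegree := natDegree_mul_le
    _ ≤ d * j + d * (D - j) := by
        refine add_le_add ?_ ?_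
        · refine (natDegree_C_mul_le _ _).trans (natDegree_pow_le.trans ?_)
          rw [mul_comm]; exact Nat.mul_le_mul_right _ hg
        · refine natDegree_pow_le.trans ?_
          rw [mul_comm]; exact Nat.mul_le_mul_right _ hh
    _ = d * D := by rw [← mul_add, Nat.add_sub_cancel' hj']

theorem aeval_pow_card_pow [Fintype K] {L : Type*} [Field L] [Algebra K L] (x : L) (P : K[X])
    (k : ℕ) : aeval (x ^ Fintype.card K ^ k) P = aeval x P ^ Fintype.card K ^ k := by
  have h : ∀ y : L, (FiniteField.frobeniusAlgHom K L ^ k) y = y ^ Fintype.card K ^ k := by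
    intro y
    induction k with
    | zero => simp
    | succ k ih =>
      rw [pow_succ', AlgHom.mul_apply, ih, FiniteField.coe_frobeniusAlgHom, pow_succ, pow_mul]
  rw [← h, ← h, aeval_algHom_apply]

variable {F : Type*} [Field F] [Algebra K F]

/-- Substituting the variable of `F(X)` into a polynomial over `K`. -/
noncomputable def toRat (F : Type*) [Field F] [Algebra K F] : K[X] →ₐ[K] RatFunc F :=
  aeval RatFunc.X

theorem toRat_eq (P : K[X]) :
    toRat F P = algebraMap F[X] (RatFunc F) (P.map (algebraMap K F)) := by
  have h := aeval_algebraMap_apply (RatFunc F) (X : F[X]) (P.map (algebraMap K F))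
  rw [aeval_map_algebraMap, RatFunc.algebraMap_X] at h
  rw [toRat, h, aeval_X_left_apply]

theorem toRat_ne_zero {P : K[X]} (hP : P ≠ 0) : toRat F P ≠ 0 := by
  rw [toRat_eq]
  exact RatFunc.algebraMap_ne_zero ((Polynomial.map_ne_zero_iff (algebraMap K F).injective).2 hP)

variable [IsAlgClosed F]

theorem compHom_toRat {g h : K[X]}
    (H : IsMapPair (g.map (algebraMap K F)) (h.map (algebraMap K F))) (P : K[X]) :
    compHom H (toRat F P) = aeval (toRat F g / toRat F h) P := by
  rw [toRat_eq, compHom_algebraMap, aeval_map_algebraMap, quot, ← toRat_eq, ← toRat_eq]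

/-- The next numerator and denominator are h^(d^i) P(g/h) and h^(d^i) Q(g/h), whose degrees are at
most d · d^i. Their coefficients lie in K, so R(α^(q^k)) = R(α)^(q^k), and the same pair represents
both the iterate and the conjugate of α. -/
theorem exists_iter_eq [Fintype K] {L : Type*} [Field L] [Algebra K L] {g h : K[X]}
    (H : IsMapPair (g.map (algebraMap K F)) (h.map (algebraMap K F))) {d k : ℕ}
    (hg : g.natDegree ≤ d) (hh : h.natDegree ≤ d) (α : L) (hα : aeval α h ≠ 0)
    (hroot : α ^ Fintype.card K ^ k * aeval α h = aeval α g) (i : ℕ) :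
    ∃ P Q : K[X], P.natDegree ≤ d ^ i ∧ Q.natDegree ≤ d ^ i ∧ aeval α Q ≠ 0 ∧
      α ^ (Fintype.card K ^ k) ^ i * aeval α Q = aeval α P ∧
      iter H i * toRat F Q = toRat F P := by
  have hh0 : h ≠ 0 := by rintro rfl; simp at hα
  have hval : aeval α g / aeval α h = α ^ Fintype.card K ^ k := by
    rw [← hroot, mul_div_cancel_right₀ _ hα]
  induction i with
  | zero =>
    refine ⟨X, 1, by simp, by simp, by simp, by simp, ?_⟩
    simp [iter, toRat]
  | succ i ih =>
    obtain ⟨P, Q, hP, hQ, hQ0, hPQ, hrat⟩ := ih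
    have hev : ∀ R : K[X], R.natDegree ≤ d ^ i → aeval α (homog (d ^ i) g h R) =
        aeval α h ^ d ^ i * aeval α R ^ Fintype.card K ^ k := by
      intro R hR
      rw [map_homog (aeval α) hR hα, hval, aeval_pow_card_pow]
    have hrt : ∀ R : K[X], R.natDegree ≤ d ^ i → toRat F (homog (d ^ i) g h R) =
        toRat F h ^ d ^ i * compHom H (toRat F R) := by
      intro R hR
      rw [map_homog (toRat F) hR (toRat_ne_zero hh0), compHom_toRat]
    refine ⟨homog (d ^ i) g h P, homog (d ^ i) g h Q, ?_, ?_, ?_, ?_, ?_⟩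
    · rw [pow_succ']; exact natDegree_homog_le P hg hh
    · rw [pow_succ']; exact natDegree_homog_le Q hg hh
    · rw [hev Q hQ]; exact mul_ne_zero (pow_ne_zero _ hα) (pow_ne_zero _ hQ0)
    · rw [hev Q hQ, hev P hP, ← hPQ, mul_pow, pow_succ (Fintype.card K ^ k), pow_mul]; ring
    · rw [hrt Q hQ, hrt P hP, ← hrat, iter_succ, map_mul]; ring

/-- If the iterates are multiplicatively independent, so are the conjugates of `α`, up to
relations of large weight. -/
theorem prod_conj_ne_one [Fintype K] {L : Type*} [Field L] [Algebra K L] {g h : K[X]}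
    (H : IsMapPair (g.map (algebraMap K F)) (h.map (algebraMap K F))) {d k : ℕ}
    (hg : g.natDegree ≤ d) (hh : h.natDegree ≤ d) (α : L) (hα0 : α ≠ 0) (hα : aeval α h ≠ 0)
    (hroot : α ^ Fintype.card K ^ k * aeval α h = aeval α g) (i : ℕ) (c : ℕ → ℤ)
    (hind : ∏ l ∈ Finset.range (i + 1), iter H l ^ c l ≠ 1)
    (hw : weight (d ^ ·) i c < (minpoly K α).natDegree) :
    ∏ l ∈ Finset.range (i + 1), (α ^ (Fintype.card K ^ k) ^ l) ^ c l ≠ 1 := by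
  choose P Q hP hQ hQ0 hPQ hrat using exists_iter_eq H hg hh α hα hroot
  have hP0 : ∀ l, aeval α (P l) ≠ 0 := fun l => by
    rw [← hPQ]; exact mul_ne_zero (pow_ne_zero _ hα0) (hQ0 l)
  have hne : ∀ R : K[X], aeval α R ≠ 0 → toRat F R ≠ 0 := fun R hR =>
    toRat_ne_zero (by rintro rfl; simp at hR)
  intro hrel
  apply hind
  have := relation_of_aeval α (toRat F : K[X] →ₐ[K] RatFunc F).toRingHom P Q (d ^ ·) i
    (fun l _ => hP l) (fun l _ => hQ l) (fun l _ => hne _ (hP0 l)) (fun l _ => hne _ (hQ0 l))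
    (fun l _ => hP0 l) (fun l _ => hQ0 l) c hw (by
      rw [← hrel]
      refine Finset.prod_congr rfl fun l _ => ?_
      rw [← hPQ, mul_div_cancel_right₀ _ (hQ0 l)])
  rw [← this]
  refine Finset.prod_congr rfl fun l _ => ?_
  have h1 := hne _ (hQ0 l)
  congr 1
  exact (eq_div_iff h1).2 (hrat l)

end Evaluation

/-! ### Conjugates and the multiplicative order of α -/

section Order

open Polynomial

variable {K L : Type*} [Field K] [Fintype K] [Field L] [Algebra K L]

/-- The Frobenius of K(α) over K has order [K(α) : K], and its powers are determined by their value
at the generator α. -/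
theorem pow_card_pow_eq_self_iff {α : L} (hα : IsIntegral K α) (m : ℕ) :
    α ^ Fintype.card K ^ m = α ↔ (minpoly K α).natDegree ∣ m := by
  have : FiniteDimensional K (IntermediateField.adjoin K {α}) :=
    IntermediateField.adjoin.finiteDimensional hα
  have : Finite (IntermediateField.adjoin K {α}) := Module.finite_of_finite K
  rw [← IntermediateField.adjoin.finrank hα,
    ← FiniteField.orderOf_frobeniusAlgHom K (IntermediateField.adjoin K {α}),
    orderOf_dvd_iff_pow_eq_one]
  have hpow : ∀ y : IntermediateField.adjoin K {α},
      (FiniteField.frobeniusAlgHom K (IntermediateField.adjoin K {α}) ^ m) y =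
        y ^ Fintype.card K ^ m := by
    intro y
    induction m with
    | zero => simp
    | succ k ih =>
      rw [pow_succ', AlgHom.mul_apply, ih, FiniteField.coe_frobeniusAlgHom, pow_succ, pow_mul]
  constructor
  · intro h
    refine (IntermediateField.adjoin.powerBasis hα).algHom_ext ?_
    rw [hpow, IntermediateField.adjoin.powerBasis_gen]
    apply Subtype.ext
    simpa using h
  · intro h
    have h1 := hpow (IntermediateField.AdjoinSimple.gen K α)
    rw [h] at h1
    have h2 := congrArg (algebraMap _ L) h1
    simpa using h2.symm

theorem coe_pow_zpow_prod (u : Lˣ) (e : ℕ → ℕ) (c : ℕ → ℤ) (s : Finset ℕ) :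
    ((∏ l ∈ s, (u ^ e l) ^ c l : Lˣ) : L) = ∏ l ∈ s, ((u : L) ^ e l) ^ c l := by
  rw [Units.coe_prod]
  exact Finset.prod_congr rfl fun l _ => by push_cast; rfl

theorem packCount_le_orderOf {α : L} (hα0 : α ≠ 0) (hfin : 0 < orderOf α) (w : ℕ → ℕ)
    (hw : w 0 = 1) (e : ℕ → ℕ) (i n : ℕ)
    (hind : ∀ c : ℕ → ℤ, (∃ l ≤ i, c l ≠ 0) → weight w i c < n →
      ∏ l ∈ Finset.range (i + 1), (α ^ e l) ^ c l ≠ 1) :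
    packCount w i n ≤ orderOf α := by
  set u : Lˣ := Units.mk0 α hα0 with hu
  have huα : (u : L) = α := rfl
  have hord : orderOf u = orderOf α := by rw [← orderOf_units, huα]
  have hfinu : IsOfFinOrder u := by rw [← orderOf_pos_iff, hord]; exact hfin
  have : Finite (Subgroup.zpowers u) := finite_zpowers.2 hfinu
  rw [← hord, ← Nat.card_zpowers]
  refine packCount_le_card
    (fun l => (⟨u ^ e l, Subgroup.pow_mem _ (Subgroup.mem_zpowers u) _⟩ : Subgroup.zpowers u))
    w hw i n ?_
  intro c hc hwc h1
  apply hind c hc hwc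
  have h2 := congrArg (Subgroup.subtype _) h1
  rw [map_prod, map_one] at h2
  simp only [map_zpow, Subgroup.subtype_apply] at h2
  have h3 := congrArg (Units.val) h2
  rw [coe_pow_zpow_prod] at h3
  exact h3

/-- The order of q modulo the order of α is the degree of α, and divisibility of c₀ + c₁ q^k + c₂
q^(2k) by the order is a multiplicative relation between three conjugates. -/
theorem longRelations_orderOf {α : L} (hα : IsIntegral K α) (hα0 : α ≠ 0) {d n k : ℕ}
    (hdeg : (minpoly K α).natDegree = n)
    (hind : ∀ c : ℕ → ℤ, (∃ l ≤ 2, c l ≠ 0) → weight (d ^ ·) 2 c < n →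
      ∏ l ∈ Finset.range 3, (α ^ (Fintype.card K ^ k) ^ l) ^ c l ≠ 1) :
    LongRelations d n k (Fintype.card K) (orderOf α) := by
  set u : Lˣ := Units.mk0 α hα0 with hu
  have huα : (u : L) = α := rfl
  have hord : orderOf u = orderOf α := by rw [← orderOf_units, huα]
  have key : ∀ m, Fintype.card K ^ m ≡ 1 [MOD orderOf α] ↔ n ∣ m := by
    intro m
    rw [← hdeg, ← pow_card_pow_eq_self_iff hα, ← hord, ← pow_eq_pow_iff_modEq, pow_one,
      ← Units.val_inj]
    simp [huα]
  refine ⟨(key n).2 dvd_rfl, fun m hm hmn h => ?_, fun c₀ c₁ c₂ hc hwt hdvd => ?_⟩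
  · exact absurd (Nat.le_of_dvd hm ((key m).1 h)) (not_le.2 hmn)
  · rw [← hord, orderOf_dvd_iff_zpow_eq_one] at hdvd
    set c : ℕ → ℤ := fun l => if l = 0 then c₀ else if l = 1 then c₁ else c₂ with hcdef
    refine hind c ?_ ?_ ?_
    · rcases hc with hc | hc
      · exact ⟨1, by omega, by simpa [hcdef] using hc⟩
      · exact ⟨2, le_rfl, by simpa [hcdef] using hc⟩
    · simp only [weight, Finset.sum_range_succ, Finset.sum_range_zero, hcdef]
      norm_num
      linarith
    · rw [← huα, ← coe_pow_zpow_prod, ← Units.val_one, Units.val_inj, ← hdvd]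
      simp only [Finset.prod_range_succ, Finset.prod_range_zero, hcdef, one_mul]
      simp only [← zpow_natCast, ← zpow_mul, ← zpow_add]
      congr 1
      norm_num
      ring

end Order

/-! ### Möbius transformations of X^D -/

section Forms

open Polynomial

variable {K : Type*} [Field K]

theorem natDegree_eq_of_dvd_dvd {a b : K[X]} (h1 : a ∣ b) (h2 : b ∣ a) :
    a.natDegree = b.natDegree := by
  by_cases ha : a = 0
  · subst ha; rw [zero_dvd_iff.1 h1]
  · have hb : b ≠ 0 := by rintro rfl; exact ha (zero_dvd_iff.1 h2)
    exact le_antisymm (natDegree_le_of_dvd h1 hb) (natDegree_le_of_dvd h2 ha)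

theorem natDegree_num_denom {g h : K[X]} (hgh : IsCoprime g h) (hh : h ≠ 0) :
    (algebraMap K[X] (RatFunc K) g / algebraMap K[X] (RatFunc K) h).num.natDegree = g.natDegree ∧
    (algebraMap K[X] (RatFunc K) g / algebraMap K[X] (RatFunc K) h).denom.natDegree =
      h.natDegree := by
  set f := algebraMap K[X] (RatFunc K) g / algebraMap K[X] (RatFunc K) h with hf
  have hmul : f.num * h = g * f.denom := (RatFunc.num_mul_eq_mul_denom_iff hh).2 hf
  have hc := RatFunc.isCoprime_num_denom f
  constructor
  · refine natDegree_eq_of_dvd_dvd ?_ ?_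
    · exact hc.dvd_of_dvd_mul_right (hmul ▸ Dvd.intro _ rfl)
    · exact hgh.dvd_of_dvd_mul_right (hmul ▸ Dvd.intro _ rfl)
  · refine natDegree_eq_of_dvd_dvd ?_ ?_
    · exact hc.symm.dvd_of_dvd_mul_left (hmul ▸ Dvd.intro_left _ rfl)
    · exact hgh.symm.dvd_of_dvd_mul_left (hmul ▸ Dvd.intro_left _ rfl)

theorem deg_div {g h : K[X]} (hgh : IsCoprime g h) (hh : h ≠ 0) :
    deg (algebraMap K[X] (RatFunc K) g / algebraMap K[X] (RatFunc K) h) =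
      max g.natDegree h.natDegree := by
  rw [deg, (natDegree_num_denom hgh hh).1, (natDegree_num_denom hgh hh).2]

theorem isCoprime_linear {a b c e : K} (hdet : a * e - b * c ≠ 0) :
    IsCoprime (C a + C b * X : K[X]) (C c + C e * X) := by
  refine ⟨C (e / (a * e - b * c)), C (-b / (a * e - b * c)), ?_⟩
  have : (C (e / (a * e - b * c)) * (C a + C b * X) + C (-b / (a * e - b * c)) * (C c + C e * X)
      : K[X]) = C (e / (a * e - b * c) * a + -b / (a * e - b * c) * c) +
      C (e / (a * e - b * c) * b + -b / (a * e - b * c) * e) * X := by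
    simp only [C_add, C_mul]; ring
  rw [this, ← C_1]
  have h1 : e / (a * e - b * c) * a + -b / (a * e - b * c) * c = 1 := by
    rw [div_mul_eq_mul_div, div_mul_eq_mul_div, ← add_div, div_eq_one_iff_eq hdet]; ring
  have h2 : e / (a * e - b * c) * b + -b / (a * e - b * c) * e = 0 := by field_simp; ring
  rw [h1, h2]
  simp

theorem natDegree_binomial_of_ne {a b : K} (D : ℕ) (hb : b ≠ 0) :
    (C a + C b * X ^ D : K[X]).natDegree = D := by
  rw [natDegree_C_add, natDegree_C_mul_X_pow _ _ hb]

theorem deg_linear {a b c e : K} (hdet : a * e - b * c ≠ 0) :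
    deg (algebraMap K[X] (RatFunc K) (C a + C b * X) /
      algebraMap K[X] (RatFunc K) (C c + C e * X)) = 1 := by
  have hh : (C c + C e * X : K[X]) ≠ 0 := by
    intro h0
    have h1 := congrArg (coeff · 0) h0
    have h2 := congrArg (coeff · 1) h0
    simp [coeff_X, coeff_C] at h1 h2
    exact hdet (by rw [h1, h2]; ring)
  rw [deg_div (isCoprime_linear hdet) hh]
  have hle : ∀ u v : K, (C u + C v * X : K[X]).natDegree ≤ 1 := fun u v => by
    rw [natDegree_C_add]; simpa using natDegree_C_mul_X_pow_le v 1
  have h1 : ∀ u v : K, v ≠ 0 → (C u + C v * X : K[X]).natDegree = 1 := fun u v hv => by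
    rw [natDegree_C_add, natDegree_C_mul_X v hv]
  refine le_antisymm (max_le (hle _ _) (hle _ _)) ?_
  by_cases hb : b = 0
  · have he : e ≠ 0 := by rintro rfl; exact hdet (by rw [hb]; ring)
    exact (h1 c e he).ge.trans (le_max_right _ _)
  · exact (h1 a b hb).ge.trans (le_max_left _ _)

theorem comp_div {g h : K[X]} {u : RatFunc K}
    (hh : aeval u h ≠ 0)
    (hu : ∀ p : K[X], p ≠ 0 → aeval u p ≠ 0) :
    comp (algebraMap K[X] (RatFunc K) g / algebraMap K[X] (RatFunc K) h) u =
      aeval u g / aeval u h := by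
  have hh0 : h ≠ 0 := by rintro rfl; simp at hh
  set f := algebraMap K[X] (RatFunc K) g / algebraMap K[X] (RatFunc K) h with hf
  have hmul : f.num * h = g * f.denom := (RatFunc.num_mul_eq_mul_denom_iff hh0).2 hf
  have h1 := congrArg (aeval u) hmul
  rw [map_mul, map_mul] at h1
  rw [comp, RatFunc.eval, ← aeval_def, ← aeval_def, div_eq_div_iff (hu _ f.denom_ne_zero) hh, h1]

theorem aeval_X_pow_ne_zero {D : ℕ} (hD : D ≠ 0) {p : K[X]} (hp : p ≠ 0) :
    aeval (RatFunc.X ^ D : RatFunc K) p ≠ 0 := by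
  have h : aeval (RatFunc.X ^ D : RatFunc K) p = algebraMap K[X] (RatFunc K) (expand K D p) := by
    rw [expand_eq_comp_X_pow, ← RatFunc.algebraMap_X, ← map_pow, aeval_algebraMap_apply,
      aeval_def, algebraMap_eq, Polynomial.comp]
  rw [h]
  exact RatFunc.algebraMap_ne_zero ((expand_ne_zero (Nat.pos_of_ne_zero hD)).2 hp)

/-- The quotient of two binomials in `X ^ D`. -/
noncomputable def binomQuot (a b c e : K) (D : ℕ) : RatFunc K :=
  algebraMap K[X] (RatFunc K) (C a + C b * X ^ D) / algebraMap K[X] (RatFunc K) (C c + C e * X ^ D)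

theorem linear_ne_zero {a b c e : K} (hdet : a * e - b * c ≠ 0) {D : ℕ} (hD : D ≠ 0) :
    (C c + C e * X ^ D : K[X]) ≠ 0 := by
  intro h0
  have h1 := congrArg (coeff · 0) h0
  have h2 := congrArg (coeff · D) h0
  simp [coeff_X_pow, coeff_C, hD, hD.symm] at h1 h2
  exact hdet (by rw [h1, h2]; ring)

theorem isLinearFrob_binomQuot {a b c e : K} (hdet : a * e - b * c ≠ 0) {l : ℕ}
    (hD : ringChar K ^ l ≠ 0) : IsLinearFrob (binomQuot a b c e (ringChar K ^ l)) := by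
  refine ⟨_, l, deg_linear hdet, ?_⟩
  have hh : (C c + C e * X : K[X]) ≠ 0 := by
    simpa using linear_ne_zero hdet one_ne_zero
  rw [comp_div (aeval_X_pow_ne_zero hD hh) fun p hp => aeval_X_pow_ne_zero hD hp, binomQuot]
  simp [RatFunc.algebraMap_eq_C]

/-- Solving for X^D shows X^D ∈ K(f), so X is purely inseparable over K(f). Separability would put X
itself in K(f), whereas [K(X) : K(f)] = D ≥ 2. -/
theorem not_isSep_binomQuot {a b c e : K} (hdet : a * e - b * c ≠ 0) {l : ℕ}
    (hD : 2 ≤ ringChar K ^ l) : ¬ IsSep (binomQuot a b c e (ringChar K ^ l)) := by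
  intro hsep
  set D := ringChar K ^ l with hDdef
  set f := binomQuot a b c e D with hf
  have hp0 : ringChar K ≠ 0 := by
    rintro h0
    rw [hDdef, h0] at hD
    rcases Nat.eq_zero_or_pos l with rfl | hl
    · simp at hD
    · rw [zero_pow hl.ne'] at hD; omega
  have hprime : (ringChar K).Prime := (CharP.char_is_prime_or_zero K (ringChar K)).resolve_right hp0
  have : Fact (ringChar K).Prime := ⟨hprime⟩
  have hexp : ExpChar K (ringChar K) := ExpChar.prime hprime
  set E := IntermediateField.adjoin K {f} with hE
  have : ExpChar E (ringChar K) := expChar_of_injective_algebraMap (algebraMap K E).injective _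
  have hsep' : Algebra.IsSeparable E (RatFunc K) := hsep
  have hfE : f ∈ E := IntermediateField.mem_adjoin_simple_self K f
  have hCE : ∀ x : K, RatFunc.C x ∈ E := fun x => by
    rw [← RatFunc.algebraMap_eq_C]; exact E.algebraMap_mem x
  have hden := RatFunc.algebraMap_ne_zero (K := K) (linear_ne_zero hdet (D := D) (by omega))
  have hfeq : f * (RatFunc.C c + RatFunc.C e * RatFunc.X ^ D) =
      RatFunc.C a + RatFunc.C b * RatFunc.X ^ D := by
    have h1 := div_mul_cancel₀ (algebraMap K[X] (RatFunc K) (C a + C b * X ^ D)) hden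
    simpa [hf, binomQuot] using h1
  have hfeq' : (f * RatFunc.C e - RatFunc.C b) * RatFunc.X ^ D = RatFunc.C a - f * RatFunc.C c := by
    linear_combination hfeq
  have hne : f * RatFunc.C e - RatFunc.C b ≠ 0 := by
    intro h0
    rw [h0, zero_mul] at hfeq'
    have h2 : RatFunc.C (a * e - b * c) = (0 : RatFunc K) := by
      rw [map_sub, map_mul, map_mul]
      linear_combination RatFunc.C c * h0 - RatFunc.C e * hfeq'
    rw [map_eq_zero] at h2
    exact hdet h2
  have hXD : (RatFunc.X : RatFunc K) ^ D ∈ E := by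
    have : (RatFunc.X : RatFunc K) ^ D =
        (RatFunc.C a - f * RatFunc.C c) / (f * RatFunc.C e - RatFunc.C b) := by
      rw [eq_div_iff hne, ← hfeq', mul_comm]
    rw [this]
    exact E.div_mem (E.sub_mem (hCE a) (E.mul_mem hfE (hCE c)))
      (E.sub_mem (E.mul_mem hfE (hCE e)) (hCE b))
  have hX : (RatFunc.X : RatFunc K) ∈ perfectClosure E (RatFunc K) :=
    (mem_perfectClosure_iff_pow_mem (ringChar K)).2 ⟨l, ⟨⟨_, hXD⟩, rfl⟩⟩
  rw [perfectClosure.eq_bot_of_isSeparable, IntermediateField.mem_bot] at hX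
  obtain ⟨y, hy⟩ := hX
  have hXE : (RatFunc.X : RatFunc K) ∈ E := hy ▸ y.2
  have htop : E = ⊤ := by
    rw [eq_top_iff, ← RatFunc.adjoin_X, IntermediateField.adjoin_simple_le_iff]
    exact hXE
  have hrank := RatFunc.finrank_eq_max_natDegree f
  rw [← hE, htop, IntermediateField.finrank_top] at hrank
  have hcop : IsCoprime (C a + C b * X ^ D : K[X]) (C c + C e * X ^ D) := by
    have := (isCoprime_linear hdet).map (expand K D).toRingHom
    simpa using this
  have hdeg := deg_div hcop (linear_ne_zero hdet (by omega))
  rw [deg] at hdeg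
  have hdeg' : max f.num.natDegree f.denom.natDegree = D := by
    refine hdeg.trans ?_
    have hle : ∀ u v : K, (C u + C v * X ^ D : K[X]).natDegree ≤ D := fun u v => by
      rw [natDegree_C_add]; exact natDegree_C_mul_X_pow_le v D
    refine le_antisymm (max_le (hle _ _) (hle _ _)) ?_
    by_cases hb : b = 0
    · have he : e ≠ 0 := by rintro rfl; exact hdet (by rw [hb]; ring)
      exact (natDegree_binomial_of_ne D he).ge.trans (le_max_right _ _)
    · exact (natDegree_binomial_of_ne D hb).ge.trans (le_max_left _ _)
  omega

end Forms

/-! ### The only admissible functions with dependent iterates -/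

section Exotic

open Polynomial

variable {K : Type*} [Field K]

theorem Admissible.denom_ne_zero {g h : K[X]}
    (hf : Admissible (algebraMap K[X] (RatFunc K) g / algebraMap K[X] (RatFunc K) h)) : h ≠ 0 := by
  rintro rfl
  have := hf.two_le_deg
  simp [deg] at this

theorem Admissible.two_le_max {g h : K[X]} (hgh : IsCoprime g h)
    (hf : Admissible (algebraMap K[X] (RatFunc K) g / algebraMap K[X] (RatFunc K) h)) :
    2 ≤ max g.natDegree h.natDegree := by
  rw [← deg_div hgh hf.denom_ne_zero]
  exact hf.two_le_deg

theorem Admissible.isMapPair {g h : K[X]} (hgh : IsCoprime g h)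
    (hf : Admissible (algebraMap K[X] (RatFunc K) g / algebraMap K[X] (RatFunc K) h))
    (F : Type*) [Field F] [Algebra K F] :
    IsMapPair (g.map (algebraMap K F)) (h.map (algebraMap K F)) := by
  refine ⟨hgh.map (mapRingHom (algebraMap K F)), ?_⟩
  have := hf.two_le_max hgh
  rw [natDegree_map, natDegree_map]
  omega

theorem IsSpan.descend {F : Type*} [Field F] [Algebra K F] {g h : K[X]} {D : ℕ} (hD : D ≠ 0)
    (hs : IsSpan (g.map (algebraMap K F)) (h.map (algebraMap K F)) D) : IsSpan g h D := by
  obtain ⟨a, b, c, e, hg, hh⟩ := hs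
  have key : ∀ (p : K[X]) (u v : F), p.map (algebraMap K F) = C u + C v * X ^ D →
      p = C (p.coeff 0) + C (p.coeff D) * X ^ D := by
    intro p u v hp
    ext j
    by_cases h0 : j = 0
    · subst h0
      simp [coeff_X_pow, hD.symm]
    · by_cases h1 : j = D
      · subst h1
        simp [coeff_C, h0]
      · have := congrArg (coeff · j) hp
        simp only [coeff_map, coeff_add, coeff_C, coeff_C_mul, coeff_X_pow, h0, h1, if_false,
          mul_zero, add_zero] at this
        simp only [coeff_add, coeff_C, coeff_C_mul, coeff_X_pow, h0, h1, if_false, mul_zero,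
          add_zero]
        exact (map_eq_zero _).1 this
  exact ⟨_, _, _, _, key g _ _ hg, key h _ _ hh⟩

/-- Writing D = p^l m with m prime to p, one has m ≠ 1, and a primitive m-th root of unity serves.
-/
theorem exists_root_of_unity (F : Type*) [Field F] [IsAlgClosed F] {p : ℕ} [Fact p.Prime]
    [CharP F p] {D : ℕ} (hD : D ≠ 0) (hnp : ∀ l, D ≠ p ^ l) : ∃ ζ : F, ζ ≠ 1 ∧ ζ ^ D = 1 := by
  obtain ⟨l, m, hm, hDm⟩ := Nat.exists_eq_pow_mul_and_not_dvd hD p (Fact.out : p.Prime).ne_one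
  have : NeZero (m : F) := ⟨fun h0 => hm ((CharP.cast_eq_zero_iff F p m).1 h0)⟩
  obtain ⟨ζ, hζ⟩ := HasEnoughRootsOfUnity.exists_primitiveRoot F m
  refine ⟨ζ, ?_, ?_⟩
  · rintro rfl
    have h1 := hζ.eq_orderOf
    rw [orderOf_one] at h1
    exact hnp l (by rw [hDm, h1, mul_one])
  · rw [hDm, mul_comm, pow_mul, hζ.pow_eq_one, one_pow]

/-- An admissible rational function which is a Möbius transformation of `X ^ D` and which permutes
`0` and `∞` unless `D` is a power of the characteristic is of the form `β / (1 + γ X ^ (p ^ l))`. -/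
theorem Admissible.eq_of_isSpan {g h : K[X]} (hgh : IsCoprime g h) {p : ℕ} [Fact p.Prime]
    [CharP K p]
    (hf : Admissible (algebraMap K[X] (RatFunc K) g / algebraMap K[X] (RatFunc K) h))
    {F : Type*} [Field F] [IsAlgClosed F] [Algebra K F] {D : ℕ}
    (hs : IsSpan (g.map (algebraMap K F)) (h.map (algebraMap K F)) D)
    (hperm : (∃ ζ : F, ζ ≠ 1 ∧ ζ ^ D = 1) →
      (ptMap (g.map (algebraMap K F)) (h.map (algebraMap K F)) (some 0) = some 0 ∧
        ptMap (g.map (algebraMap K F)) (h.map (algebraMap K F)) none = none) ∨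
      (ptMap (g.map (algebraMap K F)) (h.map (algebraMap K F)) (some 0) = none ∧
        ptMap (g.map (algebraMap K F)) (h.map (algebraMap K F)) none = some 0)) :
    ∃ (β γ κ : K) (l : ℕ), β ≠ 0 ∧ γ ≠ 0 ∧ κ ≠ 0 ∧ 1 ≤ l ∧ p ^ l = max g.natDegree h.natDegree ∧
      g = C (κ * β) ∧ h = C κ * (1 + C γ * X ^ p ^ l) := by
  have hchar : ringChar K = p := ringChar.eq_iff.2 inferInstance
  have : CharP F p := charP_of_injective_algebraMap (algebraMap K F).injective p
  have hmax := hf.two_le_max hgh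
  have hh0 := hf.denom_ne_zero
  have hD0 : D ≠ 0 := by
    rintro rfl
    obtain ⟨a, b, c, e, hg, hh⟩ := hs
    simp only [pow_zero, mul_one, ← C_add] at hg hh
    have h1 := congrArg natDegree hg
    have h2 := congrArg natDegree hh
    rw [natDegree_map, natDegree_C] at h1 h2
    omega
  obtain ⟨a, b, c, e, hg, hh⟩ := hs.descend hD0
  have hle : ∀ u v : K, (C u + C v * X ^ D : K[X]).natDegree ≤ D := fun u v => by
    rw [natDegree_C_add]; exact natDegree_C_mul_X_pow_le v D
  have hbe : b ≠ 0 ∨ e ≠ 0 := by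
    by_contra! hcon
    rw [hg, hh, hcon.1, hcon.2] at hmax
    simp at hmax
  have hmaxD : max g.natDegree h.natDegree = D := by
    refine le_antisymm (max_le (hg ▸ hle a b) (hh ▸ hle c e)) ?_
    rcases hbe with h1 | h1
    · exact (by rw [hg]; exact (natDegree_binomial_of_ne D h1).ge : D ≤ g.natDegree).trans
        (le_max_left _ _)
    · exact (by rw [hh]; exact (natDegree_binomial_of_ne D h1).ge : D ≤ h.natDegree).trans
        (le_max_right _ _)
  have HK : IsMapPair g h := ⟨hgh, by omega⟩
  have hdet : a * e - b * c ≠ 0 := by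
    intro h0
    by_cases he : e = 0
    · have hb : b ≠ 0 := hbe.resolve_right (not_not.2 he)
      have hc : c = 0 := by
        rw [he, mul_zero, zero_sub, neg_eq_zero] at h0
        exact (mul_eq_zero.1 h0).resolve_left hb
      exact hh0 (by rw [hh, he, hc]; simp)
    · apply HK.sub_ne_zero (b / e)
      have h1 : a = b / e * c := by field_simp; linear_combination h0
      have h2 : b = b / e * e := by field_simp
      rw [hg, hh]
      conv_lhs => rw [h1]
      nth_rewrite 2 [h2]
      simp only [C_mul]
      ring
  have hfb : algebraMap K[X] (RatFunc K) g / algebraMap K[X] (RatFunc K) h = binomQuot a b c e D := by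
    rw [hg, hh, binomQuot]
  have hmono_inv : ¬ (b = 0 ∧ c = 0) := by
    rintro ⟨rfl, rfl⟩
    apply hf.not_monomial
    refine ⟨a / e, -(D : ℤ), ?_⟩
    rw [hfb, binomQuot, map_div₀]
    simp [div_eq_mul_inv]
    ring
  have hmono : ¬ (a = 0 ∧ e = 0) := by
    rintro ⟨rfl, rfl⟩
    apply hf.not_monomial
    refine ⟨b / c, D, ?_⟩
    rw [hfb, binomQuot, map_div₀]
    simp [div_eq_mul_inv]
    ring
  -- Otherwise f permutes 0 and ∞: fixing both makes it b X^D / c, exchanging them makes it a / (e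
  -- X^D), and either is a monomial.
  have hpow : ∃ l, D = p ^ l := by
    by_contra! hnp
    have hmapg : g.map (algebraMap K F) = C (algebraMap K F a) + C (algebraMap K F b) * X ^ D := by
      rw [hg]; simp
    have hmaph : h.map (algebraMap K F) = C (algebraMap K F c) + C (algebraMap K F e) * X ^ D := by
      rw [hh]; simp
    have hg0 : (g.map (algebraMap K F)).eval 0 = algebraMap K F a := by simp [hmapg, hD0]
    have hh0' : (h.map (algebraMap K F)).eval 0 = algebraMap K F c := by simp [hmaph, hD0]
    rcases hperm (exists_root_of_unity F hD0 hnp) with ⟨h1, h2⟩ | ⟨h1, h2⟩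
    · have hc : (h.map (algebraMap K F)).eval 0 ≠ 0 := by
        intro h0
        rw [ptMap_some_of_eq h0] at h1
        simp at h1
      rw [ptMap_some_of_ne hc, hg0, hh0'] at h1
      have ha : a = 0 := by
        rw [hh0'] at hc
        have h3 := (div_eq_zero_iff.1 (Option.some_injective _ h1)).resolve_right hc
        exact (map_eq_zero _).1 h3
      refine hmono ⟨ha, ?_⟩
      by_contra he
      have hlt : (h.map (algebraMap K F)).natDegree < (g.map (algebraMap K F)).natDegree := by
        by_contra hcon
        simp only [ptMap, hcon, if_false] at h2
        exact Option.some_ne_none _ h2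
      rw [natDegree_map, natDegree_map, hh, natDegree_binomial_of_ne D he, hg] at hlt
      exact absurd hlt (not_lt.2 (hle a b))
    · have hc : c = 0 := by
        by_contra hc
        rw [ptMap_some_of_ne (by rw [hh0']; simpa using hc)] at h1
        simp at h1
      have he : e ≠ 0 := by
        rintro rfl
        exact hh0 (by rw [hh, hc]; simp)
      have hhd : (h.map (algebraMap K F)).natDegree = D := by
        rw [natDegree_map, hh, natDegree_binomial_of_ne D he]
      have hnlt : ¬ (h.map (algebraMap K F)).natDegree < (g.map (algebraMap K F)).natDegree := by
        intro hlt
        simp only [ptMap, hlt, if_true] at h2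
        exact Option.some_ne_none _ h2.symm
      simp only [ptMap, hnlt, if_false, Option.some.injEq] at h2
      rw [hhd] at h2
      have hlc : (h.map (algebraMap K F)).leadingCoeff ≠ 0 :=
        leadingCoeff_ne_zero.2 ((Polynomial.map_ne_zero_iff (algebraMap K F).injective).2 hh0)
      have h3 := (div_eq_zero_iff.1 h2).resolve_right hlc
      rw [hmapg] at h3
      simp [coeff_C, hD0] at h3
      exact hmono_inv ⟨h3, hc⟩
  obtain ⟨l, rfl⟩ := hpow
  have hl : 1 ≤ l := by
    rcases Nat.eq_zero_or_pos l with rfl | hl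
    · simp at hmaxD; omega
    · exact hl
  -- For D = p^l, f is inseparable and of the form L(X^(p^l)), so only the first alternative of
  -- `shape` can hold.
  have hshape : g.natDegree ≠ h.natDegree := by
    have h1 := natDegree_num_denom hgh hh0
    rcases hf.shape with h2 | h2 | h2
    · rwa [h1.1, h1.2] at h2
    · exact absurd h2 (by
        rw [hfb, ← hchar]
        exact not_isSep_binomQuot hdet (by rw [hchar]; omega))
    · exact absurd (by
        rw [hfb, ← hchar]
        exact isLinearFrob_binomQuot hdet (by rw [hchar]; exact hD0)) h2
  have he : e ≠ 0 := by
    rintro rfl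
    have hb : b ≠ 0 := hbe.resolve_right (not_not.2 rfl)
    have hc : c ≠ 0 := by
      rintro rfl
      exact hh0 (by rw [hh]; simp)
    apply hf.not_binomial
    refine ⟨b / c, a / c, l, div_ne_zero hb hc, ?_⟩
    have hc' : (RatFunc.C c : RatFunc K) ≠ 0 := (_root_.map_ne_zero _).2 hc
    rw [hfb, binomQuot, hchar, map_div₀, map_div₀]
    simp only [map_add, map_mul, map_pow, RatFunc.algebraMap_C, RatFunc.algebraMap_X, map_zero,
      zero_mul, add_zero]
    field_simp
    ring
  have hb : b = 0 := by
    by_contra hb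
    apply hshape
    rw [hg, hh, natDegree_binomial_of_ne _ hb, natDegree_binomial_of_ne _ he]
  have hc : c ≠ 0 := fun hc => hmono_inv ⟨hb, hc⟩
  have ha : a ≠ 0 := by
    rintro rfl
    rw [hb] at hdet
    simp at hdet
  refine ⟨a / c, e / c, c, l, div_ne_zero ha hc, div_ne_zero he hc, hc, hl, hmaxD.symm, ?_, ?_⟩
  · rw [mul_div_cancel₀ _ hc, hg, hb]; simp
  · rw [mul_add, mul_one, ← mul_assoc, ← C_mul, mul_div_cancel₀ _ hc, hh]

end Exotic

/-! ### Twisted iterates of b / (1 + cX) -/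

section Moebius

open Polynomial

variable {K : Type*} [Field K]

/-- The linear recursion satisfied by numerators and denominators of the twisted iterates of the
Möbius transformation `b / (1 + c X)`. -/
noncomputable def moebSeq (b c : K) (S : ℕ) (x : K × K) : ℕ → K × K
  | 0 => x
  | j + 1 => (b ^ S ^ j * (moebSeq b c S x j).2,
      (moebSeq b c S x j).2 + c ^ S ^ j * (moebSeq b c S x j).1)

/-- `moebSeq` started at (0, 1) and (1, 0) gives the constant and the linear coefficients of the
numerator and denominator of the j-th twisted iterate. It is a product of Frobenius twists of one
matrix, so peeling off the innermost factor instead of the outermost yields this second recursion.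
-/
theorem moebSeq_frob (b c : K) {p : ℕ} [Fact p.Prime] [CharP K p] (s j : ℕ) :
    (moebSeq b c (p ^ s) (0, 1) (j + 1)).2 =
        (moebSeq b c (p ^ s) (0, 1) j).2 ^ p ^ s + b * (moebSeq b c (p ^ s) (1, 0) j).2 ^ p ^ s ∧
      (moebSeq b c (p ^ s) (0, 1) (j + 1)).1 =
        (moebSeq b c (p ^ s) (0, 1) j).1 ^ p ^ s + b * (moebSeq b c (p ^ s) (1, 0) j).1 ^ p ^ s ∧
      (moebSeq b c (p ^ s) (1, 0) (j + 1)).1 = c * (moebSeq b c (p ^ s) (0, 1) j).1 ^ p ^ s ∧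
      (moebSeq b c (p ^ s) (1, 0) (j + 1)).2 = c * (moebSeq b c (p ^ s) (0, 1) j).2 ^ p ^ s := by
  have hp : p ≠ 0 := (Fact.out : p.Prime).ne_zero
  induction j with
  | zero => simp [moebSeq, hp]
  | succ j ih =>
    obtain ⟨h1, h2, h3, h4⟩ := ih
    have hadd : ∀ x y : K, (x + y) ^ p ^ s = x ^ p ^ s + y ^ p ^ s := fun x y =>
      add_pow_char_pow x y p s
    have e1 : ∀ x j, (moebSeq b c (p ^ s) x (j + 1)).1 =
      b ^ (p ^ s) ^ j * (moebSeq b c (p ^ s) x j).2 := fun _ _ => rfl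
    have e2 : ∀ x j, (moebSeq b c (p ^ s) x (j + 1)).2 = (moebSeq b c (p ^ s) x j).2 +
      c ^ (p ^ s) ^ j * (moebSeq b c (p ^ s) x j).1 := fun _ _ => rfl
    refine ⟨?_, ?_, ?_, ?_⟩
    · rw [e2 _ (j + 1), h2]
      nth_rewrite 1 [h1]
      rw [e2 _ j, e2 _ j]
      simp only [hadd, mul_pow, ← pow_mul]
      ring
    · rw [e1 _ (j + 1), h1, e1 _ j, e1 _ j]
      simp only [mul_pow, ← pow_mul]
      ring
    · rw [e1 _ (j + 1), h4, e1 _ j]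
      simp only [mul_pow, ← pow_mul]
      ring
    · rw [e2 _ (j + 1), h4, h3, e2 _ j]
      simp only [hadd, mul_pow, ← pow_mul]
      ring

theorem moebSeq_det {b c : K} (hb : b ≠ 0) (hc : c ≠ 0) (S j : ℕ) :
    (moebSeq b c S (0, 1) j).1 * (moebSeq b c S (1, 0) j).2 -
      (moebSeq b c S (1, 0) j).1 * (moebSeq b c S (0, 1) j).2 ≠ 0 := by
  induction j with
  | zero => simp [moebSeq]
  | succ j ih =>
    intro h0
    simp only [moebSeq] at h0
    have h1 : b ^ S ^ j * c ^ S ^ j * ((moebSeq b c S (0, 1) j).1 * (moebSeq b c S (1, 0) j).2 -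
        (moebSeq b c S (1, 0) j).1 * (moebSeq b c S (0, 1) j).2) = 0 := by
      linear_combination -h0
    exact mul_ne_zero (mul_ne_zero (pow_ne_zero _ hb) (pow_ne_zero _ hc)) ih h1

theorem pow_mul_moebSeq {L : Type*} [Field L] [Algebra K L] {p : ℕ} [Fact p.Prime] [CharP K p]
    {b c : K} {s : ℕ} {x : L} (hx : x ^ p ^ s * (1 + algebraMap K L c * x) = algebraMap K L b)
    (j : ℕ) :
    x ^ (p ^ s) ^ j * (algebraMap K L (moebSeq b c (p ^ s) (0, 1) j).2 +
        algebraMap K L (moebSeq b c (p ^ s) (1, 0) j).2 * x) =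
      algebraMap K L (moebSeq b c (p ^ s) (0, 1) j).1 +
        algebraMap K L (moebSeq b c (p ^ s) (1, 0) j).1 * x := by
  have : CharP L p := charP_of_injective_algebraMap (algebraMap K L).injective p
  induction j with
  | zero => simp [moebSeq]
  | succ j ih =>
    have hj : x ^ (p ^ s) ^ (j + 1) * (1 + algebraMap K L c ^ (p ^ s) ^ j * x ^ (p ^ s) ^ j) =
        algebraMap K L b ^ (p ^ s) ^ j := by
      have hadd : (1 + algebraMap K L c * x) ^ (p ^ s) ^ j =
          1 + algebraMap K L c ^ (p ^ s) ^ j * x ^ (p ^ s) ^ j := by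
        rw [← pow_mul p s j, add_pow_char_pow, one_pow, mul_pow]
      rw [← hx, mul_pow, hadd, ← pow_mul x, ← pow_succ']
    simp only [moebSeq, map_add, map_mul, map_pow]
    linear_combination (algebraMap K L (moebSeq b c (p ^ s) (0, 1) j).2 +
        algebraMap K L (moebSeq b c (p ^ s) (1, 0) j).2 * x) * hj -
        x ^ (p ^ s) ^ (j + 1) * algebraMap K L c ^ (p ^ s) ^ j * ih

/-- Let the r-th iterate be (A + BX) / (C + EX) with A = 0. Comparing the two recursions at r + 1
gives E = 0, so the map is the scaling by B/C. The same comparison gives c^(S^r) B = c C with S =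
p^s, which makes c x fixed. -/
theorem mul_pow_eq_self_of_moebSeq {L : Type*} [Field L] [Algebra K L] {p : ℕ} [Fact p.Prime]
    [CharP K p] {b c : K} (hb : b ≠ 0) (hc : c ≠ 0) {s : ℕ} {x : L}
    (hx : x ^ p ^ s * (1 + algebraMap K L c * x) = algebraMap K L b)
    {r : ℕ} (hr : (moebSeq b c (p ^ s) (0, 1) r).1 = 0) :
    (algebraMap K L c * x) ^ (p ^ s) ^ r = algebraMap K L c * x := by
  have hS : p ^ s ≠ 0 := pow_ne_zero _ (Fact.out : p.Prime).ne_zero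
  obtain ⟨h1, -, h3, h4⟩ := moebSeq_frob b c (p := p) s r
  have hev := pow_mul_moebSeq hx r
  have hdet := moebSeq_det hb hc (p ^ s) r
  rw [hr, zero_pow hS, mul_zero] at h3
  have hE : (moebSeq b c (p ^ s) (1, 0) r).2 = 0 :=
    (mul_eq_zero.1 h3).resolve_left (pow_ne_zero _ hb)
  have e1 : (moebSeq b c (p ^ s) (0, 1) (r + 1)).2 = (moebSeq b c (p ^ s) (0, 1) r).2 := by
    simp [moebSeq, hr]
  have e2 : (moebSeq b c (p ^ s) (1, 0) (r + 1)).2 =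
      c ^ (p ^ s) ^ r * (moebSeq b c (p ^ s) (1, 0) r).1 := by
    simp [moebSeq, hE]
  rw [e1, hE, zero_pow hS, mul_zero, add_zero] at h1
  rw [e2, ← h1] at h4
  rw [hr, hE] at hev
  simp only [map_zero, zero_mul, add_zero, zero_add] at hev
  have hC : algebraMap K L (moebSeq b c (p ^ s) (0, 1) r).2 ≠ 0 := by
    rw [Ne, map_eq_zero]
    rintro h0
    rw [h0, hr] at hdet
    simp at hdet
  have h4' := congrArg (algebraMap K L) h4
  rw [map_mul, map_mul, map_pow] at h4'
  apply mul_right_cancel₀ hC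
  rw [mul_pow]
  linear_combination algebraMap K L c ^ (p ^ s) ^ r * hev + x * h4'

/-- Iterating e times raises cα to the power q^u; there c is fixed by Frobenius, so α is fixed as
well. -/
theorem natDegree_dvd_of_mul_pow_eq_self [Fintype K] {L : Type*} [Field L] [Algebra K L] {α : L}
    (hα : IsIntegral K α) {c : K} (hc : c ≠ 0) {p e u : ℕ} (hq : Fintype.card K = p ^ e)
    (h : (algebraMap K L c * α) ^ p ^ u = algebraMap K L c * α) :
    (minpoly K α).natDegree ∣ u := by
  have hc' : algebraMap K L c ≠ 0 := (_root_.map_ne_zero _).2 hc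
  have hiter : ∀ m : ℕ, (algebraMap K L c * α) ^ (p ^ u) ^ m = algebraMap K L c * α := by
    intro m
    induction m with
    | zero => simp
    | succ m ih => rw [pow_succ, pow_mul, ih, h]
  have h1 := hiter e
  rw [← pow_mul, mul_comm u e, pow_mul, ← hq, mul_pow, ← map_pow, FiniteField.pow_card_pow] at h1
  exact (pow_card_pow_eq_self_iff hα u).1 (mul_left_cancel₀ hc' h1)

/-- The iterate f_j is the p^(lj)-th power of the j-th twisted Möbius map, since taking p-th powers
is additive. The conditions on b and c say that the twisted coefficients are the needed roots of β
and γ. -/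
theorem iter_mul_moebSeq {F : Type*} [Field F] [IsAlgClosed F] [Algebra K F] {g h : K[X]}
    (H : IsMapPair (g.map (algebraMap K F)) (h.map (algebraMap K F))) {p l : ℕ} [Fact p.Prime]
    [CharP K p] {β γ κ : K} (hκ : κ ≠ 0) (hg : g = C (κ * β)) (hh : h = C κ * (1 + C γ * X ^ p ^ l))
    {b c : K} {S : ℕ} (hb : ∀ j, (b ^ S ^ j) ^ (p ^ l) ^ (j + 1) = β)
    (hc : ∀ j, (c ^ S ^ j) ^ (p ^ l) ^ (j + 1) = γ) (j : ℕ) :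
    iter H j * toRat F (C (moebSeq b c S (0, 1) j).2 + C (moebSeq b c S (1, 0) j).2 * X) ^
        (p ^ l) ^ j =
      toRat F (C (moebSeq b c S (0, 1) j).1 + C (moebSeq b c S (1, 0) j).1 * X) ^ (p ^ l) ^ j := by
  have hchar : CharP (RatFunc F) p :=
    charP_of_injective_algebraMap (algebraMap K (RatFunc F)).injective p
  have hh0 : toRat F h ≠ 0 := by
    refine toRat_ne_zero ?_
    rintro rfl
    exact H.denom_ne_zero (Polynomial.map_zero _)
  have hCx : ∀ x : K, toRat F (C x) = algebraMap K (RatFunc F) x := fun x => by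
    rw [toRat, aeval_C]
  have hX : toRat F (X : K[X]) = RatFunc.X := by rw [toRat, aeval_X]
  have hrec : ∀ j, iter H (j + 1) * (1 + algebraMap K (RatFunc F) γ * iter H j ^ p ^ l) =
      algebraMap K (RatFunc F) β := by
    intro j
    induction j with
    | zero =>
      have h1 : iter H 1 = toRat F g / toRat F h := by
        rw [iter_succ, show iter H 0 = toRat F (X : K[X]) from hX.symm, compHom_toRat, aeval_X]
      have hκ' : algebraMap K (RatFunc F) κ ≠ 0 := (_root_.map_ne_zero _).2 hκ
      have h2 : iter H 1 * toRat F h = toRat F g := by rw [h1, div_mul_cancel₀ _ hh0]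
      rw [congrArg (toRat F) hh, congrArg (toRat F) hg, map_mul, map_add, map_mul, map_one, map_pow,
        hCx, hCx, hCx, hX, map_mul] at h2
      apply mul_left_cancel₀ hκ'
      rw [← h2, show iter H 0 = RatFunc.X from rfl]
      ring
    | succ j ih =>
      have h1 := congrArg (compHom H) ih
      have hx : ∀ x : K, compHom H (algebraMap K (RatFunc F) x) = algebraMap K (RatFunc F) x :=
        fun x => by rw [← hCx, compHom_toRat, aeval_C, hCx]
      rw [map_mul, map_add, map_mul, map_pow, map_one, hx, hx, ← iter_succ, ← iter_succ] at h1
      exact h1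
  induction j with
  | zero => simp [moebSeq, iter, hX]
  | succ j ih =>
    have hadd : ∀ (x y : RatFunc F) (m : ℕ), (x + y) ^ (p ^ l) ^ m =
        x ^ (p ^ l) ^ m + y ^ (p ^ l) ^ m := fun x y m => by
      rw [← pow_mul p l m]; exact add_pow_char_pow x y p (l * m)
    have hb' := congrArg (algebraMap K (RatFunc F)) (hb j)
    have hc' := congrArg (algebraMap K (RatFunc F)) (hc j)
    have e1 : toRat F (C (moebSeq b c S (0, 1) (j + 1)).2 +
        C (moebSeq b c S (1, 0) (j + 1)).2 * X) =
        toRat F (C (moebSeq b c S (0, 1) j).2 + C (moebSeq b c S (1, 0) j).2 * X) +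
        algebraMap K (RatFunc F) (c ^ S ^ j) *
          toRat F (C (moebSeq b c S (0, 1) j).1 + C (moebSeq b c S (1, 0) j).1 * X) := by
      rw [← hCx, ← map_mul, ← map_add]
      congr 1
      simp only [moebSeq, C_add, C_mul]
      ring
    have e2 : toRat F (C (moebSeq b c S (0, 1) (j + 1)).1 +
        C (moebSeq b c S (1, 0) (j + 1)).1 * X) = algebraMap K (RatFunc F) (b ^ S ^ j) *
        toRat F (C (moebSeq b c S (0, 1) j).2 + C (moebSeq b c S (1, 0) j).2 * X) := by
      rw [← hCx, ← map_mul]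
      congr 1
      simp only [moebSeq, C_mul]
      ring
    rw [map_pow] at hb' hc'
    rw [e1, e2, hadd, mul_pow, mul_pow, hb', hc', ← hrec j, pow_succ (p ^ l) j, pow_mul, pow_mul (toRat F _), ← ih, mul_pow]
    ring

/-- A zero or pole at 0 requires a vanishing constant coefficient in the numerator or denominator. A
vanishing denominator coefficient becomes a vanishing numerator coefficient one step later. -/
theorem moebSeq_eq_zero_of_ordAt {F : Type*} [Field F] [IsAlgClosed F] [Algebra K F] {g h : K[X]}
    (H : IsMapPair (g.map (algebraMap K F)) (h.map (algebraMap K F))) {p l : ℕ} [Fact p.Prime]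
    [CharP K p] {β γ κ : K} (hκ : κ ≠ 0) (hg : g = C (κ * β)) (hh : h = C κ * (1 + C γ * X ^ p ^ l))
    {b c : K} {S : ℕ} (hb : ∀ j, (b ^ S ^ j) ^ (p ^ l) ^ (j + 1) = β)
    (hc : ∀ j, (c ^ S ^ j) ^ (p ^ l) ^ (j + 1) = γ) {r : ℕ}
    (hr : ordAt (some 0) (iter H r) ≠ 0) :
    (moebSeq b c S (0, 1) r).1 = 0 ∨ (moebSeq b c S (0, 1) (r + 1)).1 = 0 := by
  by_contra! hcon
  obtain ⟨hA, hC⟩ := hcon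
  have hC' : (moebSeq b c S (0, 1) r).2 ≠ 0 := right_ne_zero_of_mul hC
  apply hr
  have key : ∀ u v : K, u ≠ 0 → toRat F (C u + C v * X) ≠ 0 ∧
      ordAt (some 0) (toRat F (C u + C v * X)) = 0 := by
    intro u v hu
    have hne : (C u + C v * X : K[X]) ≠ 0 := fun h0 => hu (by simpa using congrArg (coeff · 0) h0)
    refine ⟨toRat_ne_zero hne, ?_⟩
    rw [toRat_eq, ordAt_algebraMap _
      ((Polynomial.map_ne_zero_iff (algebraMap K F).injective).2 hne), polyOrd,
      rootMultiplicity_eq_zero]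
    · rfl
    · simp [IsRoot, hu]
  have h1 := congrArg (ordAt (some 0)) (iter_mul_moebSeq H hκ hg hh hb hc r)
  obtain ⟨n1, o1⟩ := key _ (moebSeq b c S (1, 0) r).2 hC'
  obtain ⟨n2, o2⟩ := key _ (moebSeq b c S (1, 0) r).1 hA
  rw [ordAt_mul _ (iter_ne_zero H r) (pow_ne_zero _ n1), ordAt_pow _ n1, ordAt_pow _ n2, o1, o2] at h1
  simpa using h1

end Moebius

/-! ### Quadratic and cubic packings in the Möbius case -/

section DegreeOne

open Polynomial

variable {K : Type*} [Field K]

theorem polyOrd_zero_linear {u : K} (v : K) (hu : u ≠ 0) : polyOrd (some 0) (C u + C v * X) = 0 := by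
  rw [polyOrd, rootMultiplicity_eq_zero]
  · rfl
  · simp [IsRoot, hu]

theorem polyOrd_infty_linear (u : K) {v : K} (hv : v ≠ 0) : polyOrd none (C u + C v * X) = -1 := by
  simp only [polyOrd]
  rw [natDegree_C_add, natDegree_C_mul_X v hv]
  rfl

variable {L : Type*} [Field L] [Algebra K L]

/-- The conjugates are values at x of fractions of degree one, so all weights are 1. A short
relation is then one between rational functions, and taking orders at P gives the sum. -/
theorem linear_relation {b c : K} (hb : b ≠ 0) (hc : c ≠ 0) {p : ℕ} [Fact p.Prime] [CharP K p]
    {s : ℕ} {x : L} (hx0 : x ≠ 0) (hx : x ^ p ^ s * (1 + algebraMap K L c * x) = algebraMap K L b)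
    (i : ℕ) (e : ℕ → ℤ) (hw : weight (fun _ => 1) i e < (minpoly K x).natDegree)
    (hne : ∀ l ≤ i, (moebSeq b c (p ^ s) (0, 1) l).2 ≠ 0)
    (hrel : ∏ l ∈ Finset.range (i + 1), (x ^ (p ^ s) ^ l) ^ e l = 1) (P : Option K) :
    ∑ l ∈ Finset.range (i + 1), e l *
      (polyOrd P (C (moebSeq b c (p ^ s) (0, 1) l).1 + C (moebSeq b c (p ^ s) (1, 0) l).1 * X) -
       polyOrd P (C (moebSeq b c (p ^ s) (0, 1) l).2 + C (moebSeq b c (p ^ s) (1, 0) l).2 * X)) =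
      0 := by
  have hdeg : ∀ u v : K, (C u + C v * X : K[X]).natDegree ≤ 1 := fun u v => by
    rw [natDegree_C_add]; simpa using natDegree_C_mul_X_pow_le v 1
  set P' : ℕ → K[X] := fun l =>
    C (moebSeq b c (p ^ s) (0, 1) l).1 + C (moebSeq b c (p ^ s) (1, 0) l).1 * X with hP'
  set Q' : ℕ → K[X] := fun l =>
    C (moebSeq b c (p ^ s) (0, 1) l).2 + C (moebSeq b c (p ^ s) (1, 0) l).2 * X with hQ'
  have hev : ∀ l, x ^ (p ^ s) ^ l * aeval x (Q' l) = aeval x (P' l) := fun l => by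
    have := pow_mul_moebSeq hx l
    simpa [hP', hQ'] using this
  have hQ0 : ∀ l ≤ i, Q' l ≠ 0 := fun l hl h0 =>
    hne l hl (by simpa [hQ'] using congrArg (coeff · 0) h0)
  have hP0 : ∀ l, P' l ≠ 0 := by
    intro l h0
    have h1 : (moebSeq b c (p ^ s) (0, 1) l).1 = 0 := by
      simpa [hP'] using congrArg (coeff · 0) h0
    have h2 : (moebSeq b c (p ^ s) (1, 0) l).1 = 0 := by
      simpa [hP', coeff_C] using congrArg (coeff · 1) h0
    exact moebSeq_det hb hc (p ^ s) l (by rw [h1, h2]; ring)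
  by_cases he : ∀ l ≤ i, e l = 0
  · refine Finset.sum_eq_zero fun l hl => ?_
    rw [he l (by have := Finset.mem_range.1 hl; omega), zero_mul]
  have hweight : (1 : ℤ) ≤ weight (fun _ => 1) i e := by
    push Not at he
    obtain ⟨l, hl, hel⟩ := he
    have h1 : |e l| * ((1 : ℕ) : ℤ) ≤ weight (fun _ => 1) i e :=
      Finset.single_le_sum (f := fun l => |e l| * ((1 : ℕ) : ℤ)) (fun j _ => by positivity)
        (Finset.mem_range.2 (Nat.lt_succ_of_le hl))
    have := Int.one_le_abs hel
    push_cast at h1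
    linarith
  -- A nontrivial relation has weight at least 1, so the degree exceeds 1 and the linear
  -- denominators do not vanish at x.
  have hbig : 1 < (minpoly K x).natDegree := by omega
  have hQx : ∀ l ≤ i, aeval x (Q' l) ≠ 0 := fun l hl h0 => by
    have h1 := natDegree_le_of_dvd (minpoly.dvd K x h0) (hQ0 l hl)
    have h2 := hdeg (moebSeq b c (p ^ s) (0, 1) l).2 (moebSeq b c (p ^ s) (1, 0) l).2
    simp only [hQ'] at h1
    omega
  have hPx : ∀ l ≤ i, aeval x (P' l) ≠ 0 := fun l hl => by
    rw [← hev]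
    exact mul_ne_zero (pow_ne_zero _ hx0) (hQx l hl)
  have hφ : ∀ R : K[X], R ≠ 0 → algebraMap K[X] (RatFunc K) R ≠ 0 := fun R hR =>
    RatFunc.algebraMap_ne_zero hR
  have hr := relation_of_aeval x (algebraMap K[X] (RatFunc K)) P' Q' (fun _ => 1) i
    (fun l _ => hdeg _ _) (fun l _ => hdeg _ _) (fun l _ => hφ _ (hP0 l))
    (fun l hl => hφ _ (hQ0 l hl)) hPx hQx e hw (by
      rw [← hrel]
      refine Finset.prod_congr rfl fun l hl => ?_
      rw [← hev, mul_div_cancel_right₀ _ (hQx l (by have := Finset.mem_range.1 hl; omega))])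
  have hmem : ∀ l ∈ Finset.range (i + 1),
      algebraMap K[X] (RatFunc K) (P' l) / algebraMap K[X] (RatFunc K) (Q' l) ≠ 0 := fun l hl =>
    div_ne_zero (hφ _ (hP0 l)) (hφ _ (hQ0 l (by have := Finset.mem_range.1 hl; omega)))
  have ho := congrArg (ordAt P) hr
  rw [ordAt_one, ordAt_prod P _ _ fun l hl => zpow_ne_zero _ (hmem l hl)] at ho
  rw [← ho]
  refine Finset.sum_congr rfl fun l hl => ?_
  rw [ordAt_zpow P (hmem l hl),
    ordAt_div P (hP0 l) (hQ0 l (by have := Finset.mem_range.1 hl; omega))]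

/-- An element related to one of its conjugates by a Möbius transformation has large order. -/
theorem packCount_one_le_orderOf {b c : K} (hb : b ≠ 0) (hc : c ≠ 0) {p : ℕ} [Fact p.Prime]
    [CharP K p] {s : ℕ} {x : L} (hx0 : x ≠ 0) (hfin : 0 < orderOf x)
    (hx : x ^ p ^ s * (1 + algebraMap K L c * x) = algebraMap K L b) :
    packCount (fun _ => 1) 1 (minpoly K x).natDegree ≤ orderOf x := by
  refine packCount_le_orderOf hx0 hfin _ rfl (fun l => (p ^ s) ^ l) 1 _ fun e he hw hrel => ?_
  have hne : ∀ l ≤ 1, (moebSeq b c (p ^ s) (0, 1) l).2 ≠ 0 := by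
    intro l hl
    interval_cases l <;> simp [moebSeq]
  -- X has orders 1 and -1 at 0 and ∞, while b / (1 + cX) has orders 0 and 1; hence both exponents
  -- vanish.
  have h0 := linear_relation hb hc hx0 hx 1 e hw hne hrel (some 0)
  have h1 := linear_relation hb hc hx0 hx 1 e hw hne hrel none
  simp only [Finset.sum_range_succ, Finset.sum_range_zero, moebSeq, pow_zero, pow_one, mul_one,
    mul_zero, add_zero, zero_add] at h0 h1
  rw [polyOrd_zero_linear 0 hb, polyOrd_zero_linear c one_ne_zero, polyOrd_zero_linear 0 one_ne_zero]
    at h0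
  rw [polyOrd_infty_linear 1 hc, polyOrd_infty_linear 0 one_ne_zero] at h1
  simp [polyOrd] at h0 h1
  obtain ⟨l, hl, hel⟩ := he
  apply hel
  interval_cases l
  · exact h0
  · linarith

theorem packCount_two_le_orderOf {b c : K} (hb : b ≠ 0) (hc : c ≠ 0) {p : ℕ} [Fact p.Prime]
    [CharP K p] {s : ℕ} {x : L} (hx0 : x ≠ 0) (hfin : 0 < orderOf x)
    (hx : x ^ p ^ s * (1 + algebraMap K L c * x) = algebraMap K L b)
    (hbc : 1 + c ^ p ^ s * b ≠ 0) :
    packCount (fun _ => 1) 2 (minpoly K x).natDegree ≤ orderOf x := by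
  refine packCount_le_orderOf hx0 hfin _ rfl (fun l => (p ^ s) ^ l) 2 _ fun e he hw hrel => ?_
  have hne : ∀ l ≤ 2, (moebSeq b c (p ^ s) (0, 1) l).2 ≠ 0 := by
    intro l hl
    interval_cases l <;> simp [moebSeq, hbc]
  have h0 := linear_relation hb hc hx0 hx 2 e hw hne hrel (some 0)
  have h1 := linear_relation hb hc hx0 hx 2 e hw hne hrel none
  -- The orders at 0 and ∞ eliminate the first two exponents; this point is the pole of the second
  -- iterate, which isolates the third.
  have h2 := linear_relation hb hc hx0 hx 2 e hw hne hrel (some (-(1 + c ^ p ^ s * b) / c))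
  simp only [Finset.sum_range_succ, Finset.sum_range_zero, moebSeq, pow_zero, pow_one, mul_one,
    mul_zero, add_zero, zero_add] at h0 h1 h2
  have hbs : b ^ p ^ s ≠ 0 := pow_ne_zero _ hb
  rw [polyOrd_zero_linear 0 hb, polyOrd_zero_linear c one_ne_zero,
    polyOrd_zero_linear 0 one_ne_zero, polyOrd_zero_linear _ hbs, polyOrd_zero_linear c hbc] at h0
  rw [polyOrd_infty_linear 1 hc, polyOrd_infty_linear 0 one_ne_zero,
    polyOrd_infty_linear _ (mul_ne_zero hbs hc), polyOrd_infty_linear _ hc] at h1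
  simp [polyOrd] at h0 h1
  have he1 : e 1 = 0 := by linarith
  have hroot : (C (1 + c ^ p ^ s * b) + C c * X : K[X]).IsRoot (-(1 + c ^ p ^ s * b) / c) := by
    simp only [IsRoot, eval_add, eval_mul, eval_C, eval_X]
    field_simp
    ring
  have hnroot : ¬ (C (b ^ p ^ s) + C (b ^ p ^ s * c) * X : K[X]).IsRoot
      (-(1 + c ^ p ^ s * b) / c) := by
    have : (C (b ^ p ^ s) + C (b ^ p ^ s * c) * X : K[X]).eval (-(1 + c ^ p ^ s * b) / c) =
        -(b ^ p ^ s * c ^ p ^ s * b) := by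
      simp only [eval_add, eval_mul, eval_C, eval_X]
      field_simp
      ring
    rw [IsRoot, this, neg_eq_zero]
    exact mul_ne_zero (mul_ne_zero hbs (pow_ne_zero _ hc)) hb
  have hne0 : (C (1 + c ^ p ^ s * b) + C c * X : K[X]) ≠ 0 := fun h0 => hbc (by
    have := congrArg (coeff · 0) h0
    simpa only [coeff_add, coeff_C_zero, coeff_C_mul, coeff_X_zero, mul_zero, add_zero,
      coeff_zero] using this)
  have hpos := (rootMultiplicity_pos hne0).2 hroot
  rw [h0, he1, zero_mul, zero_mul, zero_add, zero_add] at h2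
  simp only [polyOrd] at h2
  rw [rootMultiplicity_eq_zero hnroot] at h2
  have he2 : e 2 = 0 := (mul_eq_zero.1 h2).resolve_right (by omega)
  obtain ⟨l, hl, hel⟩ := he
  apply hel
  interval_cases l
  · exact h0
  · exact he1
  · exact he2

end DegreeOne

/-! ### Small degrees and the final form of the bound -/

section Bound

theorem packVol_pow {t : ℕ} (d : ℕ) (ht : 1 ≤ t) :
    packVol (d ^ ·) (t - 1) = ((t.factorial * d ^ (t * (t - 1) / 2) : ℕ) : ℝ) := by
  obtain ⟨s, rfl⟩ := Nat.exists_eq_add_of_le' ht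
  rw [packVol, Nat.add_sub_cancel]
  push_cast
  congr 1
  have hsum : ∑ i ∈ Finset.range (s + 1), i = (s + 1) * s / 2 := Finset.sum_range_id (s + 1)
  rw [Finset.prod_pow_eq_pow_sum, ← hsum, Finset.sum_range_succ', add_zero]

theorem ascFactorial_le_of_cube_all :
    allBelow (fun n => allBelow (fun d => allBelow (fun t =>
      Nat.blt d 2 || (Nat.blt t 2 || (Nat.blt n (d ^ t) || (Nat.ble (d ^ (t + 1)) n ||
        Nat.ble (6 * n.ascFactorial t) (t.factorial * d ^ (t * (t - 1) / 2) * n ^ 3))))) 7) 12) 128 =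
      true := by
  decide +kernel

theorem ascFactorial_le_of_square_all :
    allBelow (fun n => allBelow (fun d => allBelow (fun t =>
      Nat.blt d 2 || (Nat.blt t 2 || (Nat.blt n (d ^ t) || (Nat.ble (d ^ (t + 1)) n ||
        Nat.ble (2 * n.ascFactorial t) (t.factorial * d ^ (t * (t - 1) / 2) * n ^ 2))))) 7) 12) 25 =
      true := by
  decide +kernel

/-- If `n` is at most of logarithmic size in itself, quadratic and cubic lower bounds suffice. -/
theorem ascFactorial_le_of_small {d n s t N : ℕ} (hd : 2 ≤ d) (ht : 2 ≤ t) (ht1 : d ^ t ≤ n)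
    (ht2 : n < d ^ (t + 1)) (hs : 2 ^ (s + 1) < n ^ 2) (hn : n ≤ s * (t + 1))
    (h : n ^ 3 ≤ 6 * N ∨ (n ≤ s * 3 ∧ n ^ 2 ≤ 2 * N)) :
    (n.ascFactorial t : ℝ) ≤ packVol (d ^ ·) (t - 1) * N := by
  have h2t : 2 ^ t ≤ n := (Nat.pow_le_pow_left hd t).trans ht1
  have hn0 : n ≠ 0 := by
    rintro rfl
    have := Nat.two_pow_pos t
    omega
  have hlog := Nat.pow_log_le_self 2 hn0
  have hlog' := Nat.lt_pow_succ_log_self (b := 2) one_lt_two n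
  set b := Nat.log 2 n with hb
  have htb : t ≤ b := by
    have := (Nat.pow_lt_pow_iff_right one_lt_two).1 (h2t.trans_lt hlog')
    omega
  have hsb : s ≤ 2 * b := by
    have h1 : 2 ^ (s + 1) < 2 ^ (2 * (b + 1)) := hs.trans_le (by
      rw [mul_comm 2 (b + 1), pow_mul]
      exact Nat.pow_le_pow_left hlog'.le 2)
    have := (Nat.pow_lt_pow_iff_right one_lt_two).1 h1
    omega
  -- With b = ⌊log₂ n⌋ this gives 2^b ≤ n ≤ 2b(b+1), impossible for b ≥ 7; so n < 128 and the table
  -- applies.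
  have hnb : n ≤ 2 * b * (b + 1) := hn.trans (Nat.mul_le_mul hsb (by omega))
  have hb6 : b < 7 := by
    by_contra hcon
    have hgrow : ∀ m : ℕ, 2 * (m + 7) * (m + 8) < 2 ^ (m + 7) := by
      intro m
      induction m with
      | zero => norm_num
      | succ m ih =>
        rw [show m + 1 + 7 = m + 7 + 1 by ring, pow_succ]
        nlinarith
    have := hgrow (b - 7)
    rw [show b - 7 + 7 = b by omega, show b - 7 + 8 = b + 1 by omega] at this
    omega
  have hn128 : n < 128 := hlog'.trans_le (Nat.pow_le_pow_right two_pos (show b + 1 ≤ 7 by omega))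
  have hd12 : d < 12 := by
    by_contra hcon
    have h1 : 12 ^ 2 ≤ d ^ 2 := Nat.pow_le_pow_left (by omega) 2
    have h2 : d ^ 2 ≤ d ^ t := Nat.pow_le_pow_right (by omega) ht
    omega
  have ht7 : t < 7 := by omega
  rw [packVol_pow d (by omega)]
  norm_cast
  rcases h with h | ⟨h3, h⟩
  · have := of_allBelow (of_allBelow (of_allBelow ascFactorial_le_of_cube_all n hn128) d hd12) t ht7
    simp only [Bool.or_eq_true, Nat.blt_eq, Nat.ble_eq] at this
    have h1 : 6 * n.ascFactorial t ≤ t.factorial * d ^ (t * (t - 1) / 2) * n ^ 3 := by omega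
    have h2 := Nat.mul_le_mul_left (t.factorial * d ^ (t * (t - 1) / 2)) h
    linarith
  -- From n ≤ 3s and 2^(s+1) < n² one gets 2^(s+1) < 9s², which fails from s = 9 on; so n ≤ 24.
  · have hs8 : s ≤ 8 := by
      by_contra hcon
      have hgrow : ∀ m : ℕ, ((m + 9) * 3) ^ 2 < 2 ^ (m + 10) := by
        intro m
        induction m with
        | zero => norm_num
        | succ m ih =>
          rw [show m + 1 + 10 = m + 10 + 1 by ring, pow_succ 2]
          have : ((m + 1 + 9) * 3) ^ 2 ≤ 2 * ((m + 9) * 3) ^ 2 := by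
            have := Nat.zero_le (m * m)
            have := Nat.zero_le m
            linarith
          omega
      have h4 := hgrow (s - 9)
      rw [show s - 9 + 9 = s by omega, show s - 9 + 10 = s + 1 by omega] at h4
      have := Nat.pow_le_pow_left h3 2
      omega
    have := of_allBelow (of_allBelow (of_allBelow ascFactorial_le_of_square_all n (by omega)) d hd12)
      t ht7
    simp only [Bool.or_eq_true, Nat.blt_eq, Nat.ble_eq] at this
    have h1 : 2 * n.ascFactorial t ≤ t.factorial * d ^ (t * (t - 1) / 2) * n ^ 2 := by omega
    have h2 := Nat.mul_le_mul_left (t.factorial * d ^ (t * (t - 1) / 2)) h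
    linarith

theorem choose_mul_prod_le {d n t N : ℕ} (hd : 0 < d) (ht : 1 ≤ t)
    (h : (n.ascFactorial t : ℝ) ≤ packVol (d ^ ·) (t - 1) * N) :
    ((n + t - 1).choose t : ℝ) * ∏ i ∈ Finset.range t, (1 / (d : ℝ) ^ i) ≤ N := by
  rw [packVol_pow d ht, Nat.ascFactorial_eq_factorial_mul_choose'] at h
  have hf : (0 : ℝ) < t.factorial := by positivity
  have hd' : (0 : ℝ) < (d : ℝ) ^ (t * (t - 1) / 2) := by positivity
  have hprod : ∏ i ∈ Finset.range t, (1 / (d : ℝ) ^ i) = 1 / (d : ℝ) ^ (t * (t - 1) / 2) := by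
    rw [Finset.prod_div_distrib, Finset.prod_const_one, Finset.prod_pow_eq_pow_sum,
      Finset.sum_range_id]
  rw [hprod, mul_one_div, div_le_iff₀ hd']
  push_cast at h
  rw [mul_assoc] at h
  have := le_of_mul_le_mul_left h hf
  linarith

end Bound

/-! ### Dependent and independent iterates combined -/

section Main

open Polynomial

variable {K L : Type*} [Field K] [Fintype K] [Field L] [Algebra K L]

/-- A relation reduces f to β / (1 + γ X^(p^l)), and the resulting periodicity of a multiple of α
makes n so small that a quadratic or cubic bound on the order suffices. -/
theorem ascFactorial_le_of_relation {g h : K[X]} (hgh : IsCoprime g h) {p e : ℕ} [Fact p.Prime]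
    [CharP K p] (hcard : Fintype.card K = p ^ e)
    (hf : Admissible (algebraMap K[X] (RatFunc K) g / algebraMap K[X] (RatFunc K) h))
    {F : Type*} [Field F] [IsAlgClosed F] [Algebra K F]
    (H : IsMapPair (g.map (algebraMap K F)) (h.map (algebraMap K F)))
    {d k n t : ℕ} (hg : g.natDegree ≤ d) (hh : h.natDegree ≤ d) (ht : 2 ≤ t) (ht1 : d ^ t ≤ n)
    (ht2 : n < d ^ (t + 1)) (hk1 : n ≤ Fintype.card K ^ k) (hk2 : Fintype.card K ^ k < n ^ 2)
    {α : L} (hα : IsIntegral K α) (hα0 : α ≠ 0) (hfin : 0 < orderOf α)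
    (hdeg : (minpoly K α).natDegree = n)
    (hroot : α ^ Fintype.card K ^ k * aeval α h = aeval α g)
    {c : ℕ → ℤ} (hc : ∃ l ≤ t, c l ≠ 0) (hrel : ∏ l ∈ Finset.range (t + 1), iter H l ^ c l = 1) :
    (n.ascFactorial t : ℝ) ≤ packVol (d ^ ·) (t - 1) * orderOf α := by
  have hp : p.Prime := Fact.out
  have hpL : CharP L p := charP_of_injective_algebraMap (algebraMap K L).injective p
  have hd : 2 ≤ d := (hf.two_le_max hgh).trans (max_le hg hh)
  obtain ⟨D, hspan, hperm, r, hr1, hrt, hord⟩ :=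
    of_relation H (c := fun i => if i < t + 1 then c i else 0) (M := t + 1)
      (fun i hi => if_neg (not_lt.2 hi))
      (by
        obtain ⟨l, hl, hcl⟩ := hc
        exact ⟨l, by rwa [if_pos (by omega)]⟩)
      (by
        rw [← hrel]
        exact Finset.prod_congr rfl fun l hl => by rw [if_pos (Finset.mem_range.1 hl)])
  obtain ⟨β, γ, κ, l, hβ, hγ, hκ, hl, hpl, hg', hh'⟩ := hf.eq_of_isSpan hgh (p := p) hspan hperm
  have hpd : p ^ l ≤ d := hpl.trans_le (max_le hg hh)
  -- p^l ≤ d < d² ≤ n ≤ q^k.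
  have hlek : l < e * k := by
    rw [← Nat.pow_lt_pow_iff_right hp.one_lt, pow_mul, ← hcard]
    have h1 : d ^ 2 ≤ d ^ t := Nat.pow_le_pow_right (by omega) ht
    have h2 : d < d ^ 2 := by nlinarith
    omega
  obtain ⟨s, hs⟩ := Nat.exists_eq_add_of_lt hlek
  set S := s + 1 with hS
  have hT : p ^ S * p ^ l = Fintype.card K ^ k := by
    rw [← pow_add, hcard, ← pow_mul, hs]
    congr 1
    omega
  -- The total exponent is q^(k(j+1)), and q-th powers are trivial on K. In particular x^(p^S) is
  -- the p^l-th root of x.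
  have hfix : ∀ (x : K) (j : ℕ), ((x ^ p ^ S) ^ (p ^ S) ^ j) ^ (p ^ l) ^ (j + 1) = x := by
    intro x j
    have : p ^ S * (p ^ S) ^ j * (p ^ l) ^ (j + 1) = Fintype.card K ^ (k * (j + 1)) := by
      rw [← pow_succ', ← mul_pow, hT, pow_mul]
    rw [← pow_mul, ← pow_mul, ← mul_assoc, this, FiniteField.pow_card_pow]
  set b := β ^ p ^ S with hb
  set a := γ ^ p ^ S with ha
  have hb0 : b ≠ 0 := pow_ne_zero _ hβ
  have ha0 : a ≠ 0 := pow_ne_zero _ hγ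
  have hbl : b ^ p ^ l = β := by simpa using hfix β 0
  have hal : a ^ p ^ l = γ := by simpa using hfix γ 0
  have hx : α ^ p ^ S * (1 + algebraMap K L a * α) = algebraMap K L b := by
    have hκ' : algebraMap K L κ ≠ 0 := (_root_.map_ne_zero _).2 hκ
    have h1 : (α ^ p ^ S * (1 + algebraMap K L a * α)) ^ p ^ l = algebraMap K L b ^ p ^ l := by
      rw [mul_pow, add_pow_char_pow, one_pow, mul_pow, ← pow_mul, hT, ← map_pow, ← map_pow, hbl, hal]
      apply mul_left_cancel₀ hκ'
      rw [← map_mul (algebraMap K L) κ β, ← aeval_C α (κ * β), ← hg', ← hroot, hh']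
      simp only [map_mul, map_add, map_one, map_pow, aeval_C, aeval_X]
      ring
    have h2 : (α ^ p ^ S * (1 + algebraMap K L a * α) - algebraMap K L b) ^ p ^ l = 0 := by
      rw [sub_pow_char_pow, h1, sub_self]
    exact sub_eq_zero.1 (pow_eq_zero_iff (pow_ne_zero _ hp.ne_zero) |>.1 h2)
  have hper : ∀ j, 1 ≤ j → (moebSeq b a (p ^ S) (0, 1) j).1 = 0 → n ≤ S * j := by
    intro j hj h0
    have h1 := mul_pow_eq_self_of_moebSeq hb0 ha0 hx h0
    rw [← pow_mul] at h1
    rw [← hdeg]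
    exact Nat.le_of_dvd (Nat.mul_pos (by omega) hj)
      (natDegree_dvd_of_mul_pow_eq_self hα ha0 hcard h1)
  have hn : n ≤ S * (t + 1) := by
    rcases moebSeq_eq_zero_of_ordAt H hκ hg' hh' (hfix β) (hfix γ) hord with h0 | h0
    · exact (hper r hr1 h0).trans (Nat.mul_le_mul_left _ (by omega))
    · exact (hper (r + 1) (by omega) h0).trans (Nat.mul_le_mul_left _ (by omega))
  have hSn : 2 ^ (S + 1) < n ^ 2 := by
    refine lt_of_le_of_lt ?_ hk2
    rw [← hT, pow_succ]
    refine Nat.mul_le_mul (Nat.pow_le_pow_left hp.two_le _) ?_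
    calc 2 = 2 ^ 1 := rfl
      _ ≤ p ^ 1 := Nat.pow_le_pow_left hp.two_le _
      _ ≤ p ^ l := Nat.pow_le_pow_right hp.pos hl
  refine ascFactorial_le_of_small hd ht ht1 ht2 hSn hn ?_
  -- If 1 + a^(p^S) b = 0, the numerator coefficient vanishes already at the third iterate, so n ≤
  -- 3S and the quadratic bound is enough. Otherwise three conjugates are independent and the cubic
  -- bound is available.
  by_cases hba : 1 + a ^ p ^ S * b = 0
  · right
    constructor
    · apply hper 3 (by omega)
      simp [moebSeq, hba]
    · have h1 := packCount_one_le_orderOf hb0 ha0 hα0 hfin hx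
      have h2 := pow_succ_le_packVol_mul_packCount (fun _ => 1) (fun _ => one_pos) 1 n
      rw [hdeg] at h1
      have h3 : packVol (fun _ => 1) 1 = 2 := by norm_num [packVol]
      rw [h3] at h2
      have h4 : n ^ 2 ≤ 2 * packCount (fun _ => 1) 1 n := by exact_mod_cast h2
      omega
  · left
    have h1 := packCount_two_le_orderOf hb0 ha0 hα0 hfin hx hba
    have h2 := pow_succ_le_packVol_mul_packCount (fun _ => 1) (fun _ => one_pos) 2 n
    rw [hdeg] at h1
    have h3 : packVol (fun _ => 1) 2 = 6 := by norm_num [packVol, Nat.factorial]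
    rw [h3] at h2
    have h4 : n ^ 3 ≤ 6 * packCount (fun _ => 1) 2 n := by exact_mod_cast h2
    omega

theorem ascFactorial_le {g h : K[X]} (hgh : IsCoprime g h)
    (hf : Admissible (algebraMap K[X] (RatFunc K) g / algebraMap K[X] (RatFunc K) h))
    {d k n t : ℕ} (hg : g.natDegree ≤ d) (hh : h.natDegree ≤ d) (ht : 1 ≤ t) (ht1 : d ^ t ≤ n)
    (ht2 : n < d ^ (t + 1)) (hd1 : Fintype.card K ^ (d - 1) < n ^ 2)
    (hd2 : n ^ 2 ≤ Fintype.card K ^ d) (hk1 : n ≤ Fintype.card K ^ k)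
    (hk2 : Fintype.card K ^ (k - 1) < n)
    {α : L} (hα : IsIntegral K α) (hα0 : α ≠ 0) (hfin : 0 < orderOf α)
    (hdeg : (minpoly K α).natDegree = n) (hhα : aeval α h ≠ 0)
    (hroot : α ^ Fintype.card K ^ k * aeval α h = aeval α g) :
    (n.ascFactorial t : ℝ) ≤ packVol (d ^ ·) (t - 1) * orderOf α := by
  have hq : 2 ≤ Fintype.card K := Fintype.one_lt_card
  have hd : 2 ≤ d := (hf.two_le_max hgh).trans (max_le hg hh)
  have H := hf.isMapPair hgh (AlgebraicClosure K)
  have hindep : ∀ i, ∀ c : ℕ → ℤ, ∏ l ∈ Finset.range (i + 1), iter H l ^ c l ≠ 1 →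
      weight (d ^ ·) i c < n →
      ∏ l ∈ Finset.range (i + 1), (α ^ (Fintype.card K ^ k) ^ l) ^ c l ≠ 1 := fun i c hc hw =>
    prod_conj_ne_one H hg hh α hα0 hhα hroot i c hc (by rwa [hdeg])
  by_cases hrel : ∀ i ≤ t, ∀ c : ℕ → ℤ, (∃ l ≤ i, c l ≠ 0) →
      ∏ l ∈ Finset.range (i + 1), iter H l ^ c l ≠ 1
  · refine ascFactorial_le_of_longRelations hq hd hd1 hd2 hk1 hk2 ht ht1 ht2 (fun i hi => ?_)
      fun ht' => ?_
    · exact packCount_le_orderOf hα0 hfin _ (pow_zero d) (fun l => (Fintype.card K ^ k) ^ l) i n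
        fun c hc hw => hindep i c (hrel i hi c hc) hw
    · exact longRelations_orderOf hα hα0 hdeg fun c hc hw => hindep 2 c (hrel 2 ht' c hc) hw
  · push Not at hrel
    obtain ⟨i, hi, c, hc, hrel⟩ := hrel
    obtain rfl | ht' : t = 1 ∨ 2 ≤ t := by omega
    -- For t = 1 only the powers α^c with |c| < n are needed, and these are independent whatever f
    -- is, because X has order 1 at 0.
    · have hpack : packCount (d ^ ·) 0 n ≤ orderOf α := by
        refine packCount_le_orderOf hα0 hfin _ (pow_zero d) (fun l => (Fintype.card K ^ k) ^ l) 0 n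
          fun c hc hw => hindep 0 c ?_ hw
        obtain ⟨l, hl, hcl⟩ := hc
        obtain rfl : l = 0 := by omega
        intro h1
        have h2 := congrArg (ordAt (some 0)) h1
        rw [Finset.prod_range_one, ordAt_one, ordAt_zpow _ (iter_ne_zero H 0)] at h2
        rw [show iter H 0 = RatFunc.X from rfl, ordAt_X_zero, mul_one] at h2
        exact hcl h2
      simp only [packCount] at hpack
      rw [packVol_pow d le_rfl]
      simpa [Nat.ascFactorial] using hpack
    · obtain ⟨e, hprime, hcard⟩ := FiniteField.card K (ringChar K)
      have : Fact (ringChar K).Prime := ⟨hprime⟩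
      refine ascFactorial_le_of_relation hgh (p := ringChar K) hcard hf H hg hh ht' ht1 ht2 hk1 ?_
        hα hα0 hfin hdeg hroot (c := fun l => if l < i + 1 then c l else 0) ?_ ?_
      -- This shows q^k < n²: for k ≤ 1 because k ≤ d - 1, and for k ≥ 2 because k ≤ 2(k - 1).
      · rcases Nat.lt_or_ge k 2 with hk | hk
        · refine lt_of_le_of_lt (Nat.pow_le_pow_right (by omega) (show k ≤ d - 1 by omega)) hd1
        · calc Fintype.card K ^ k ≤ Fintype.card K ^ ((k - 1) * 2) :=
                Nat.pow_le_pow_right (by omega) (by omega)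
            _ = (Fintype.card K ^ (k - 1)) ^ 2 := pow_mul _ _ _
            _ < n ^ 2 := Nat.pow_lt_pow_left hk2 two_ne_zero
      · obtain ⟨l, hl, hcl⟩ := hc
        exact ⟨l, by omega, by rwa [if_pos (by omega)]⟩
      · rw [← hrel, ← Finset.prod_subset (Finset.range_subset_range.2 (show i + 1 ≤ t + 1 by omega))]
        · exact Finset.prod_congr rfl fun l hl => by rw [if_pos (Finset.mem_range.1 hl)]
        · intro l _ hl
          rw [if_neg (by simpa using hl), zpow_zero]

end Main

end RatIter

theorem theorem3 {K L : Type*} [Field K] [Fintype K] [Field L] [Algebra K L]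
    (n q d m t : ℕ) (hn : 1 ≤ n)
    (hq : q = Fintype.card K)
    (hd : d = ⌈2 * Real.logb q n⌉₊)
    (hm : m = q ^ ⌈Real.logb q n⌉₊)
    (ht : t = ⌊Real.logb d n⌋₊)
    (g h : Polynomial K) (hgh : IsCoprime g h)
    (hg : g.natDegree ≤ d) (hh : h.natDegree ≤ d)
    (hf : RatIter.Admissible
      (algebraMap (Polynomial K) (RatFunc K) g / algebraMap (Polynomial K) (RatFunc K) h))
    (α : L) (hα : (minpoly K α).natDegree = n)
    (hroot : Polynomial.aeval α (Polynomial.X ^ m * h - g) = 0) :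
    ((n + t - 1).choose t : ℝ) * ∏ i ∈ Finset.range t, (1 / (d : ℝ) ^ i) ≤ (orderOf α : ℝ) := by
  have hq2 : 2 ≤ q := hq ▸ Fintype.one_lt_card
  have hd2 : 2 ≤ d := (hf.two_le_max hgh).trans (max_le hg hh)
  -- ⌈2 log_q n⌉ is the ceiling logarithm of n², which gives q^(d-1) < n² ≤ q^d.
  have hdc : d = Nat.clog q (n ^ 2) := by
    rw [hd, ← Real.natCeil_logb_natCast, Nat.cast_pow, Real.logb_pow]
    norm_num
  rw [Real.natCeil_logb_natCast] at hm
  rw [Real.natFloor_logb_natCast] at ht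
  have hn2 : 2 ≤ n := by
    by_contra hcon
    obtain rfl : n = 1 := by omega
    simp at hdc
    omega
  have hint : IsIntegral K α := by
    by_contra hcon
    rw [minpoly.eq_zero hcon, Polynomial.natDegree_zero] at hα
    omega
  have hα0 : α ≠ 0 := by
    rintro rfl
    rw [minpoly.zero, Polynomial.natDegree_X] at hα
    omega
  have hroot' : α ^ m * Polynomial.aeval α h = Polynomial.aeval α g := by
    rw [map_sub, map_mul, map_pow, Polynomial.aeval_X] at hroot
    exact sub_eq_zero.1 hroot
  have hhα : Polynomial.aeval α h ≠ 0 := by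
    intro h0
    rw [h0, mul_zero] at hroot'
    obtain ⟨u, v, huv⟩ := hgh
    have := congrArg (Polynomial.aeval α) huv
    rw [map_add, map_mul, map_mul, h0, ← hroot', mul_zero, mul_zero, add_zero, map_one] at this
    exact zero_ne_one this
  have hfin : 0 < orderOf α := by
    have h1 := (RatIter.pow_card_pow_eq_self_iff hint n).2 hα.dvd
    have h2 : 1 < Fintype.card K ^ n := Nat.one_lt_pow (by omega) (by omega)
    refine orderOf_pos_iff.2 (isOfFinOrder_iff_pow_eq_one.2 ⟨Fintype.card K ^ n - 1, by omega, ?_⟩)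
    apply mul_right_cancel₀ hα0
    rw [← pow_succ, Nat.sub_add_cancel h2.le, h1, one_mul]
  -- For n < d one has t = 0, and the bound reads 1 ≤ order of α.
  rcases Nat.eq_zero_or_pos t with rfl | htpos
  · simpa using (Nat.one_le_iff_ne_zero.2 hfin.ne')
  subst hq hm
  refine RatIter.choose_mul_prod_le (by omega) htpos (RatIter.ascFactorial_le hgh hf hg hh htpos
    (k := Nat.clog (Fintype.card K) n) ?_ ?_ ?_ ?_ ?_ ?_ hint hα0 hfin hα hhα hroot')
  · rw [ht]; exact Nat.pow_log_le_self d (by omega)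
  · rw [ht]; exact Nat.lt_pow_succ_log_self (by omega) n
  · rw [hdc]; exact Nat.pow_pred_clog_lt_self (by omega) (Nat.one_lt_pow two_ne_zero (by omega))
  · conv_rhs => rw [hdc]
    exact Nat.le_pow_clog (by omega) _
  · exact Nat.le_pow_clog (by omega) n
  · exact Nat.pow_pred_clog_lt_self (by omega) (by omega)
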